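/- Let $k$ be a field, write $\otimes=\otimes_k$, and let $A$ and $B$ be associative unital $k$-algebras. Let $\tau: B\otimes A\to A\otimes B$ be a twisting map, i.e. a bijective $k$-linear map with $\tau(1\otimes a)=a\otimes 1$, $\tau(b\otimes 1)=1\otimes b$ and $$\tau\,(m_B\otimes m_A)=(m_A\otimes m_B)(1\otimes\tau\otimes 1)(\tau\otimes\tau)(1\otimes\tau\otimes 1),$$ and let $A\otimes_\tau B$ be the twisted tensor product algebra: the space $A\otimes B$ with the multiplication $(m_A\otimes m_B)(1\otimes\tau\otimes 1)$. *Compatibility.* An augmented complex $P_\bullet\to A$ of $A$-bimodules is compatible with $\tau$ through bijective $k$-linear maps $\tau_{B,i}: B\otimes P_i\to P_i\otimes B$ if these form a chain map lifting $\tau$ and, with $\rho: A\otimes P_i\otimes A\to P_i$ the bimodule structure map, $$\tau_{B,i}(m_B\otimes 1)=(1\otimes m_B)(\tau_{B,i}\otimes 1)(1\otimes\tau_{B,i}),\qquad \tau_{B,i}(1\otimes\rho)=(\rho\otimes 1)(1\otimes 1\otimes\tau)(1\otimes\tau_{B,i}\otimes 1)(\tau\otimes 1\otimes 1).$$ For an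 augmented complex $Q_\bullet\to B$ of $B$-bimodules we use the same notion with the twisting map $\tau^{-1}: A\otimes B\to B\otimes A$, through maps $\tau^{-1}_{A,j}: A\otimes Q_j\to Q_j\otimes A$, and put $\tau_{j,A}=(\tau^{-1}_{A,j})^{-1}: Q_j\otimes A\to A\otimes Q_j$. *Twisted product complex.* Given such data, $X_{i,j}=P_i\otimes Q_j$ is an $A\otimes_\tau B$-bimodule: the left action is $1\otimes\tau_{B,i}\otimes 1$ followed by the left actions of $A$ on $P_i$ and of $B$ on $Q_j$, and the right action is $1\otimes\tau_{j,A}\otimes 1$ followed by the right actions. The twisted product complex of $P_\bullet$ and $Q_\bullet$ is $X_n=\bigoplus_{i+j=n}X_{i,j}$ with differential $d\otimes 1+(-1)^i\,1\otimes d$ on $X_{i,j}$, augmented by $\varepsilon\otimes\varepsilon: X_0\to A\otimes_\tau B$. *The complexes.* The bar resolution of $A$ has terms $A^{\otimes(n+2)}$, and the reduced bar resolution is its quotient with terms $A\otimes(A/k1)^{\otimes n}\otimes A$. If $A=\bigoplus_{i\ge 0}A_i$ is graded, put $V=A_1$, $R=\ker(V\otimes V\to A)$ and $K_n=\bigcap_{i}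 V^{\otimes i}\otimes R\otimes V^{\otimes(n-2-i)}\subseteq V^{\otimes n}$. The Koszul complex of $A$ is the subcomplex of the bar resolution with terms $A\otimes K_n\otimes A$. The graded algebra $A$ is Koszul if $A\neq 0$, $A_0=k1$, and the left Koszul complex $\cdots\to A\otimes K_2\to A\otimes K_1\to A\to k\to 0$ is exact. The bar resolution of $A$ is twisted by the iterations $B\otimes A^{\otimes(n+2)}\to A^{\otimes(n+2)}\otimes B$ of $\tau$, which move $B$ past one factor $A$ after the other; the reduced bar resolution by the induced maps on the quotient; the Koszul complex by the restrictions of the iterations of $\tau$. The complexes of $B$ are twisted in the same way, with $\tau^{-1}$ in place of $\tau$. For gradings $A=\bigoplus_{i\ge0} A_i$ and $B=\bigoplus_{j\ge0} B_j$, the map $\tau$ is strongly graded if $\tau(B_j\otimes A_i)\subseteq A_i\otimes B_j$ for all $i,j$. **Statement.** In each of the following cases, the complexes named are compatible with $\tau$ (respectively $\tau^{-1}$) through the maps just described, and their twisted product complex is a projective resolution of $A\otimes_\tau B$ as a bimodule over itself. 1. $P_\bullet$ is the bar or the reduced bar resolution of $A$, and $Q_\bullet$ is the bar or the reduced bar resolution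 of $B$ (all four combinations). 2. $A$ and $B$ are graded and Koszul, $\tau$ is strongly graded, and $P_\bullet$, $Q_\bullet$ are the Koszul complexes of $A$ and $B$. 3. $A$ and $B$ are graded, $\tau$ is strongly graded, one of $A$ and $B$ is Koszul, and of $P_\bullet$ and $Q_\bullet$ the one that belongs to this Koszul algebra is its Koszul complex, while the other one is the bar or the reduced bar resolution of the other algebra. -/

import Mathlib

open scoped TensorProduct
open MulOpposite

noncomputable section

namespace TwistedProduct

section TensorMaps

variable {k : Type*} [Field k]
variable {P P' Q Q' R R' S : Type*}
  [AddCommGroup P] [Module k P] [AddCommGroup P'] [Module k P']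
  [AddCommGroup Q] [Module k Q] [AddCommGroup Q'] [Module k Q']
  [AddCommGroup R] [Module k R] [AddCommGroup R'] [Module k R']
  [AddCommGroup S] [Module k S]

/-- The map `1 ⊗ f ⊗ 1` on `P ⊗ Q ⊗ R ⊗ S`, for `f : Q ⊗ R → Q' ⊗ R'`. -/
def mid (f : Q ⊗[k] R →ₗ[k] Q' ⊗[k] R') :
    (P ⊗[k] Q) ⊗[k] (R ⊗[k] S) →ₗ[k] (P ⊗[k] Q') ⊗[k] (R' ⊗[k] S) :=
  (TensorProduct.assoc k P Q' (R' ⊗[k] S)).symm.toLinearMap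
    ∘ₗ LinearMap.lTensor P ((TensorProduct.assoc k Q' R' S).toLinearMap
      ∘ₗ LinearMap.rTensor S f ∘ₗ (TensorProduct.assoc k Q R S).symm.toLinearMap)
    ∘ₗ (TensorProduct.assoc k P Q (R ⊗[k] S)).toLinearMap

/-- The map `f ⊗ 1` on `P ⊗ Q ⊗ S`, for `f : P ⊗ Q → Q' ⊗ P'`. -/
def slide (f : P ⊗[k] Q →ₗ[k] Q' ⊗[k] P') :
    P ⊗[k] (Q ⊗[k] S) →ₗ[k] Q' ⊗[k] (P' ⊗[k] S) :=
  (TensorProduct.assoc k Q' P' S).toLinearMap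
    ∘ₗ LinearMap.rTensor S f ∘ₗ (TensorProduct.assoc k P Q S).symm.toLinearMap

theorem mid_tmul (f : Q ⊗[k] R →ₗ[k] Q' ⊗[k] R') (p : P) (q : Q) (r : R) (s : S) :
    mid f ((p ⊗ₜ[k] q) ⊗ₜ[k] (r ⊗ₜ[k] s)) =
      TensorProduct.map (TensorProduct.mk k P Q' p) ((TensorProduct.mk k R' S).flip s)
        (f (q ⊗ₜ r)) := by
  simp only [mid, LinearMap.comp_apply, LinearEquiv.coe_coe, TensorProduct.assoc_tmul,
    LinearMap.lTensor_tmul, TensorProduct.assoc_symm_tmul, LinearMap.rTensor_tmul]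
  induction f (q ⊗ₜ r) using TensorProduct.induction_on with
  | zero => simp
  | tmul x y => simp
  | add x y hx hy => simp only [TensorProduct.add_tmul, TensorProduct.tmul_add, map_add, hx, hy]

theorem mid_comp {Q'' R'' : Type*} [AddCommGroup Q''] [Module k Q''] [AddCommGroup R'']
    [Module k R''] (g : Q' ⊗[k] R' →ₗ[k] Q'' ⊗[k] R'') (f : Q ⊗[k] R →ₗ[k] Q' ⊗[k] R') :
    (mid g ∘ₗ mid f : (P ⊗[k] Q) ⊗[k] (R ⊗[k] S) →ₗ[k] _) = mid (g ∘ₗ f) := by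
  ext p q r s
  simp only [mid, LinearMap.comp_apply, LinearEquiv.coe_coe, TensorProduct.assoc_tmul,
    LinearMap.lTensor_tmul, TensorProduct.assoc_symm_tmul, LinearMap.rTensor_tmul,
    LinearEquiv.apply_symm_apply, LinearEquiv.symm_apply_apply, TensorProduct.curry_apply,
    TensorProduct.AlgebraTensorModule.curry_apply, LinearMap.coe_restrictScalars]

theorem mid_id : (mid LinearMap.id : (P ⊗[k] Q) ⊗[k] (R ⊗[k] S) →ₗ[k] _) = LinearMap.id := by
  ext p q r s
  simp [mid]

theorem slide_tmul (f : P ⊗[k] Q →ₗ[k] Q' ⊗[k] P') (p : P) (q : Q) (s : S) :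
    slide f (p ⊗ₜ[k] (q ⊗ₜ[k] s)) =
      LinearMap.lTensor Q' ((TensorProduct.mk k P' S).flip s) (f (p ⊗ₜ q)) := by
  simp only [slide, LinearMap.comp_apply, LinearEquiv.coe_coe, TensorProduct.assoc_symm_tmul,
    LinearMap.rTensor_tmul]
  induction f (p ⊗ₜ q) using TensorProduct.induction_on with
  | zero => simp
  | tmul x y => simp
  | add x y hx hy => simp only [TensorProduct.add_tmul, map_add, hx, hy]

end TensorMaps

section Twisting

variable (k A B : Type*) [Field k] [Ring A] [Algebra k A] [Ring B] [Algebra k B]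

/-- A twisting map `τ : B ⊗ A → A ⊗ B`: a bijective linear map that respects the units and
satisfies `τ (m_B ⊗ m_A) = (m_A ⊗ m_B) (1 ⊗ τ ⊗ 1) (τ ⊗ τ) (1 ⊗ τ ⊗ 1)`. -/
structure TwistingMap where
  toEquiv : B ⊗[k] A ≃ₗ[k] A ⊗[k] B
  map_one_tmul : ∀ a : A, toEquiv ((1 : B) ⊗ₜ[k] a) = a ⊗ₜ[k] (1 : B)
  map_tmul_one : ∀ b : B, toEquiv (b ⊗ₜ[k] (1 : A)) = (1 : A) ⊗ₜ[k] b
  map_mul :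
    toEquiv.toLinearMap ∘ₗ TensorProduct.map (LinearMap.mul' k B) (LinearMap.mul' k A) =
      TensorProduct.map (LinearMap.mul' k A) (LinearMap.mul' k B)
        ∘ₗ mid toEquiv.toLinearMap
        ∘ₗ TensorProduct.map toEquiv.toLinearMap toEquiv.toLinearMap
        ∘ₗ mid toEquiv.toLinearMap

variable {k A B}

/-- The inverse of a twisting map, as a twisting map with the roles of `A` and `B` exchanged. -/
def TwistingMap.symm (τ : TwistingMap k A B) : TwistingMap k B A where
  toEquiv := τ.toEquiv.symm
  map_one_tmul b := by rw [← τ.map_tmul_one, LinearEquiv.symm_apply_apply]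
  map_tmul_one a := by rw [← τ.map_one_tmul, LinearEquiv.symm_apply_apply]
  map_mul := by
    have hm : ∀ x, (mid τ.toEquiv.toLinearMap
        (mid τ.toEquiv.symm.toLinearMap x : (B ⊗[k] B) ⊗[k] (A ⊗[k] A)) :
          (B ⊗[k] A) ⊗[k] (B ⊗[k] A)) = x := fun x => by
      have := congrArg (fun f => f x) (mid_comp (P := B) (S := A) (k := k)
        τ.toEquiv.toLinearMap τ.toEquiv.symm.toLinearMap)
      simpa [mid_id] using this
    have hm' : ∀ x, (mid τ.toEquiv.toLinearMap
        (mid τ.toEquiv.symm.toLinearMap x : (A ⊗[k] B) ⊗[k] (A ⊗[k] B)) :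
          (A ⊗[k] A) ⊗[k] (B ⊗[k] B)) = x := fun x => by
      have := congrArg (fun f => f x) (mid_comp (P := A) (S := B) (k := k)
        τ.toEquiv.toLinearMap τ.toEquiv.symm.toLinearMap)
      simpa [mid_id] using this
    have ht : ∀ x, TensorProduct.map τ.toEquiv.toLinearMap τ.toEquiv.toLinearMap
        (TensorProduct.map τ.toEquiv.symm.toLinearMap τ.toEquiv.symm.toLinearMap x) = x :=
      fun x => by
        rw [← LinearMap.comp_apply, ← TensorProduct.map_comp]
        simp
    refine LinearMap.ext fun x => ?_
    apply τ.toEquiv.injective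
    have h := congrArg (fun f => f (mid τ.toEquiv.symm.toLinearMap
      (TensorProduct.map τ.toEquiv.symm.toLinearMap τ.toEquiv.symm.toLinearMap
        (mid τ.toEquiv.symm.toLinearMap x)))) τ.map_mul
    simp only [LinearMap.comp_apply, LinearEquiv.coe_coe] at h ⊢
    rw [h, hm, ht, hm', LinearEquiv.apply_symm_apply]

end Twisting

section Actions

variable {k A B M N : Type*} [Field k] [Ring A] [Algebra k A] [Ring B] [Algebra k B]
  [AddCommGroup M] [Module k M] [AddCommGroup N] [Module k N]

/-- The left action `(A ⊗ B) ⊗ (M ⊗ N) → (A ⊗ M) ⊗ (B ⊗ N) → M ⊗ N` obtained from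
`c : B ⊗ M → M ⊗ B`. -/
def leftAct (l : A →ₐ[k] Module.End k M) (l' : B →ₐ[k] Module.End k N)
    (c : B ⊗[k] M →ₗ[k] M ⊗[k] B) : (A ⊗[k] B) ⊗[k] (M ⊗[k] N) →ₗ[k] M ⊗[k] N :=
  TensorProduct.map (TensorProduct.lift l.toLinearMap) (TensorProduct.lift l'.toLinearMap) ∘ₗ mid c

theorem leftAct_tmul (l : A →ₐ[k] Module.End k M) (l' : B →ₐ[k] Module.End k N)
    (c : B ⊗[k] M →ₗ[k] M ⊗[k] B) (a : A) (b : B) (m : M) (n : N) :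
    leftAct l l' c ((a ⊗ₜ b) ⊗ₜ (m ⊗ₜ n)) =
      TensorProduct.map (l a) (l'.toLinearMap.flip n) (c (b ⊗ₜ m)) := by
  rw [leftAct, LinearMap.comp_apply, mid_tmul]
  induction c (b ⊗ₜ m) using TensorProduct.induction_on with
  | zero => simp
  | tmul x y => simp
  | add x y hx hy => simp only [map_add, hx, hy]


theorem leftAct_aux (l : A →ₐ[k] Module.End k M) (l' : B →ₐ[k] Module.End k N) (a α : A) (β : B)
    (n : N) (u : M ⊗[k] B) :
    TensorProduct.map (l (a * α)) (l'.toLinearMap.flip n)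
        (LinearMap.lTensor M (LinearMap.mul' k B)
          (LinearMap.lTensor M ((TensorProduct.mk k B B).flip β) u)) =
      TensorProduct.map (l a) (l'.toLinearMap.flip (l' β n))
        (LinearMap.rTensor B (TensorProduct.lift l.toLinearMap)
          ((TensorProduct.assoc k A M B).symm (α ⊗ₜ u))) := by
  induction u using TensorProduct.induction_on with
  | zero => simp only [map_zero, TensorProduct.tmul_zero]
  | tmul x y => simp
  | add x y hx hy => simp only [map_add, hx, hy, TensorProduct.tmul_add]

theorem leftAct_mul (τ : B ⊗[k] A →ₗ[k] A ⊗[k] B)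
    (l : A →ₐ[k] Module.End k M) (l' : B →ₐ[k] Module.End k N) (c : B ⊗[k] M →ₗ[k] M ⊗[k] B)
    (hc : ∀ b b' m, c ((b * b') ⊗ₜ m) =
      LinearMap.lTensor M (LinearMap.mul' k B) (slide c (b ⊗ₜ[k] c (b' ⊗ₜ m))))
    (hl : ∀ b a m, c (b ⊗ₜ l a m) = LinearMap.rTensor B (TensorProduct.lift l.toLinearMap)
      ((TensorProduct.assoc k A M B).symm
        (LinearMap.lTensor A c (slide τ (b ⊗ₜ (a ⊗ₜ m))))))
    (x y : A ⊗[k] B) (z : M ⊗[k] N) :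
    leftAct l l' c (TensorProduct.map (LinearMap.mul' k A) (LinearMap.mul' k B)
      (mid τ (x ⊗ₜ y)) ⊗ₜ z) = leftAct l l' c (x ⊗ₜ leftAct l l' c (y ⊗ₜ z)) := by
  induction x using TensorProduct.induction_on with
  | zero => simp
  | add x x' hx hx' => simp only [map_add, TensorProduct.add_tmul, hx, hx']
  | tmul a b =>
  induction y using TensorProduct.induction_on with
  | zero => simp
  | add x x' hx hx' => simp only [map_add, TensorProduct.add_tmul, TensorProduct.tmul_add, hx, hx']
  | tmul a' b' =>
  induction z using TensorProduct.induction_on with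
  | zero => simp
  | add x x' hx hx' => simp only [map_add, TensorProduct.tmul_add, hx, hx']
  | tmul m n =>
  obtain ⟨S, hS⟩ := TensorProduct.exists_finset (τ (b ⊗ₜ a'))
  obtain ⟨T, hT⟩ := TensorProduct.exists_finset (c (b' ⊗ₜ m))
  simp only [mid_tmul, leftAct_tmul, hS, hT, map_sum, TensorProduct.sum_tmul,
    TensorProduct.tmul_sum, hc, TensorProduct.map_tmul, hl, slide_tmul,
    TensorProduct.mk_apply, LinearMap.flip_apply, LinearMap.mul'_apply, LinearMap.lTensor_tmul,
    AlgHom.toLinearMap_apply]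
  rw [Finset.sum_comm]
  refine Finset.sum_congr rfl fun t _ => Finset.sum_congr rfl fun s _ => ?_
  exact leftAct_aux l l' a s.1 t.2 n _

theorem leftAct_one (l : A →ₐ[k] Module.End k M) (l' : B →ₐ[k] Module.End k N)
    (c : B ⊗[k] M →ₗ[k] M ⊗[k] B) (hc : ∀ m, c (1 ⊗ₜ m) = m ⊗ₜ 1) (z : M ⊗[k] N) :
    leftAct l l' c ((1 ⊗ₜ 1) ⊗ₜ z) = z := by
  induction z using TensorProduct.induction_on with
  | zero => simp
  | add x x' hx hx' => simp only [map_add, TensorProduct.tmul_add, hx, hx']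
  | tmul m n => simp [leftAct_tmul, hc]

theorem leftAct_natural {M' N' : Type*} [AddCommGroup M'] [Module k M'] [AddCommGroup N']
    [Module k N'] {l : A →ₐ[k] Module.End k M} {l' : B →ₐ[k] Module.End k N}
    {c : B ⊗[k] M →ₗ[k] M ⊗[k] B}
    {l₁ : A →ₐ[k] Module.End k M'} {l₁' : B →ₐ[k] Module.End k N'}
    {c₁ : B ⊗[k] M' →ₗ[k] M' ⊗[k] B} {f : M →ₗ[k] M'} {g : N →ₗ[k] N'}
    (hf : ∀ a m, f (l a m) = l₁ a (f m)) (hg : ∀ b n, g (l' b n) = l₁' b (g n))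
    (hc : ∀ b m, LinearMap.rTensor B f (c (b ⊗ₜ m)) = c₁ (b ⊗ₜ f m))
    (x : A ⊗[k] B) (z : M ⊗[k] N) :
    TensorProduct.map f g (leftAct l l' c (x ⊗ₜ z)) =
      leftAct l₁ l₁' c₁ (x ⊗ₜ TensorProduct.map f g z) := by
  induction x using TensorProduct.induction_on with
  | zero => simp
  | add x x' hx hx' => simp only [map_add, TensorProduct.add_tmul, hx, hx']
  | tmul a b =>
  induction z using TensorProduct.induction_on with
  | zero => simp
  | add x x' hx hx' => simp only [map_add, TensorProduct.tmul_add, hx, hx']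
  | tmul m n =>
  rw [leftAct_tmul, TensorProduct.map_tmul, leftAct_tmul, ← hc]
  induction c (b ⊗ₜ m) using TensorProduct.induction_on with
  | zero => simp
  | tmul x y => simp [hf, hg]
  | add x y hx hy => simp only [map_add, hx, hy]

/-- The map `M ⊗ A → M` of a right action. -/
def rightMap (r : Aᵐᵒᵖ →ₐ[k] Module.End k M) : M ⊗[k] A →ₗ[k] M :=
  TensorProduct.lift (r.toLinearMap ∘ₗ (opLinearEquiv k).toLinearMap).flip

@[simp] theorem rightMap_tmul (r : Aᵐᵒᵖ →ₐ[k] Module.End k M) (m : M) (a : A) :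
    rightMap r (m ⊗ₜ a) = r (op a) m := by
  simp [rightMap]

/-- The right action `(M ⊗ N) ⊗ (A ⊗ B) → (M ⊗ A) ⊗ (N ⊗ B) → M ⊗ N` obtained from
`s : N ⊗ A → A ⊗ N`. -/
def rightAct (r : Aᵐᵒᵖ →ₐ[k] Module.End k M) (r' : Bᵐᵒᵖ →ₐ[k] Module.End k N)
    (s : N ⊗[k] A →ₗ[k] A ⊗[k] N) : (M ⊗[k] N) ⊗[k] (A ⊗[k] B) →ₗ[k] M ⊗[k] N :=
  TensorProduct.map (rightMap r) (rightMap r') ∘ₗ mid s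

theorem rightAct_tmul (r : Aᵐᵒᵖ →ₐ[k] Module.End k M) (r' : Bᵐᵒᵖ →ₐ[k] Module.End k N)
    (s : N ⊗[k] A →ₗ[k] A ⊗[k] N) (a : A) (b : B) (m : M) (n : N) :
    rightAct r r' s ((m ⊗ₜ n) ⊗ₜ (a ⊗ₜ b)) =
      TensorProduct.map (rightMap r ∘ₗ TensorProduct.mk k M A m) (r' (op b)) (s (n ⊗ₜ a)) := by
  rw [rightAct, LinearMap.comp_apply, mid_tmul]
  induction s (n ⊗ₜ a) using TensorProduct.induction_on with
  | zero => simp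
  | tmul x y => simp
  | add x y hx hy => simp only [map_add, hx, hy]

theorem rightAct_aux (r : Aᵐᵒᵖ →ₐ[k] Module.End k M) (r' : Bᵐᵒᵖ →ₐ[k] Module.End k N)
    (α : A) (b β : B) (m : M) (u : A ⊗[k] N) :
    TensorProduct.map (rightMap r ∘ₗ TensorProduct.mk k M A m) (r' (op (β * b)))
        (LinearMap.rTensor N (LinearMap.mul' k A) ((TensorProduct.assoc k A A N).symm (α ⊗ₜ u))) =
      TensorProduct.map (rightMap r ∘ₗ TensorProduct.mk k M A (r (op α) m)) (r' (op b))
        (LinearMap.lTensor A (rightMap r')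
          (LinearMap.lTensor A ((TensorProduct.mk k N B).flip β) u)) := by
  induction u using TensorProduct.induction_on with
  | zero => simp only [map_zero, TensorProduct.tmul_zero]
  | tmul x y => simp
  | add x y hx hy => simp only [map_add, hx, hy, TensorProduct.tmul_add]

theorem rightAct_mul (τ : B ⊗[k] A →ₗ[k] A ⊗[k] B)
    (r : Aᵐᵒᵖ →ₐ[k] Module.End k M) (r' : Bᵐᵒᵖ →ₐ[k] Module.End k N)
    (s : N ⊗[k] A →ₗ[k] A ⊗[k] N)
    (hs : ∀ n a a', s (n ⊗ₜ (a * a')) = LinearMap.rTensor N (LinearMap.mul' k A)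
      ((TensorProduct.assoc k A A N).symm
        (LinearMap.lTensor A s (slide s (n ⊗ₜ[k] (a ⊗ₜ[k] a'))))))
    (hr : ∀ n b a, s (r' (op b) n ⊗ₜ a) =
      LinearMap.lTensor A (rightMap r') (slide s (n ⊗ₜ[k] τ (b ⊗ₜ a))))
    (x y : A ⊗[k] B) (z : M ⊗[k] N) :
    rightAct r r' s (z ⊗ₜ TensorProduct.map (LinearMap.mul' k A) (LinearMap.mul' k B)
      (mid τ (x ⊗ₜ y))) = rightAct r r' s (rightAct r r' s (z ⊗ₜ x) ⊗ₜ y) := by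
  induction x using TensorProduct.induction_on with
  | zero => simp
  | add x x' hx hx' => simp only [map_add, TensorProduct.add_tmul, TensorProduct.tmul_add, hx, hx']
  | tmul a b =>
  induction y using TensorProduct.induction_on with
  | zero => simp
  | add x x' hx hx' => simp only [map_add, TensorProduct.tmul_add, hx, hx']
  | tmul a' b' =>
  induction z using TensorProduct.induction_on with
  | zero => simp
  | add x x' hx hx' => simp only [map_add, TensorProduct.add_tmul, hx, hx']
  | tmul m n =>
  obtain ⟨S, hS⟩ := TensorProduct.exists_finset (τ (b ⊗ₜ a'))
  obtain ⟨T, hT⟩ := TensorProduct.exists_finset (s (n ⊗ₜ a))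
  simp only [mid_tmul, rightAct_tmul, hS, hT, map_sum, TensorProduct.sum_tmul,
    TensorProduct.tmul_sum, hs, TensorProduct.map_tmul, hr, slide_tmul,
    TensorProduct.mk_apply, LinearMap.flip_apply, LinearMap.mul'_apply, LinearMap.lTensor_tmul,
    LinearMap.comp_apply, rightMap_tmul]
  rw [Finset.sum_comm]
  refine Finset.sum_congr rfl fun t _ => Finset.sum_congr rfl fun s _ => ?_
  exact rightAct_aux ..

theorem rightAct_one (r : Aᵐᵒᵖ →ₐ[k] Module.End k M) (r' : Bᵐᵒᵖ →ₐ[k] Module.End k N)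
    (s : N ⊗[k] A →ₗ[k] A ⊗[k] N) (hs : ∀ n, s (n ⊗ₜ 1) = 1 ⊗ₜ n) (z : M ⊗[k] N) :
    rightAct r r' s (z ⊗ₜ (1 ⊗ₜ 1)) = z := by
  induction z using TensorProduct.induction_on with
  | zero => simp
  | add x x' hx hx' => simp only [map_add, TensorProduct.add_tmul, hx, hx']
  | tmul m n => simp [rightAct_tmul, hs]

theorem rightAct_natural {M' N' : Type*} [AddCommGroup M'] [Module k M'] [AddCommGroup N']
    [Module k N'] {r : Aᵐᵒᵖ →ₐ[k] Module.End k M} {r' : Bᵐᵒᵖ →ₐ[k] Module.End k N}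
    {s : N ⊗[k] A →ₗ[k] A ⊗[k] N}
    {r₁ : Aᵐᵒᵖ →ₐ[k] Module.End k M'} {r₁' : Bᵐᵒᵖ →ₐ[k] Module.End k N'}
    {s₁ : N' ⊗[k] A →ₗ[k] A ⊗[k] N'} {f : M →ₗ[k] M'} {g : N →ₗ[k] N'}
    (hf : ∀ a m, f (r a m) = r₁ a (f m)) (hg : ∀ b n, g (r' b n) = r₁' b (g n))
    (hs : ∀ n a, LinearMap.lTensor A g (s (n ⊗ₜ a)) = s₁ (g n ⊗ₜ a))
    (x : A ⊗[k] B) (z : M ⊗[k] N) :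
    TensorProduct.map f g (rightAct r r' s (z ⊗ₜ x)) =
      rightAct r₁ r₁' s₁ (TensorProduct.map f g z ⊗ₜ x) := by
  induction x using TensorProduct.induction_on with
  | zero => simp
  | add x x' hx hx' => simp only [map_add, TensorProduct.tmul_add, hx, hx']
  | tmul a b =>
  induction z using TensorProduct.induction_on with
  | zero => simp
  | add x x' hx hx' => simp only [map_add, TensorProduct.add_tmul, hx, hx']
  | tmul m n =>
  rw [rightAct_tmul, TensorProduct.map_tmul, rightAct_tmul, ← hs]
  induction s (n ⊗ₜ a) using TensorProduct.induction_on with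
  | zero => simp
  | tmul x y => simp [hf, hg]
  | add x y hx hy => simp only [map_add, hx, hy]

theorem leftAct_rightAct_aux {l : A →ₐ[k] Module.End k M} {l' : B →ₐ[k] Module.End k N}
    {r : Aᵐᵒᵖ →ₐ[k] Module.End k M} {r' : Bᵐᵒᵖ →ₐ[k] Module.End k N}
    (hM : ∀ a a' m, l a (r a' m) = r a' (l a m)) (hN : ∀ b b' n, l' b (r' b' n) = r' b' (l' b n))
    (a : A) (b' : B) (p : M) (ν : N) (u : A ⊗[k] B) :
    TensorProduct.map (l a) (l'.toLinearMap.flip (r' (op b') ν))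
        (LinearMap.rTensor B (rightMap r) ((TensorProduct.assoc k M A B).symm (p ⊗ₜ u))) =
      TensorProduct.map (rightMap r ∘ₗ TensorProduct.mk k M A (l a p)) (r' (op b'))
        (LinearMap.lTensor A (TensorProduct.lift l'.toLinearMap)
          (LinearMap.lTensor A ((TensorProduct.mk k B N).flip ν) u)) := by
  induction u using TensorProduct.induction_on with
  | zero => simp only [map_zero, TensorProduct.tmul_zero]
  | tmul x y => simp [hM, hN]
  | add x y hx hy => simp only [map_add, hx, hy, TensorProduct.tmul_add]

theorem leftAct_rightAct (τ : B ⊗[k] A →ₗ[k] A ⊗[k] B)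
    {l : A →ₐ[k] Module.End k M} {l' : B →ₐ[k] Module.End k N}
    {r : Aᵐᵒᵖ →ₐ[k] Module.End k M} {r' : Bᵐᵒᵖ →ₐ[k] Module.End k N}
    {c : B ⊗[k] M →ₗ[k] M ⊗[k] B} {s : N ⊗[k] A →ₗ[k] A ⊗[k] N}
    (hM : ∀ a a' m, l a (r a' m) = r a' (l a m)) (hN : ∀ b b' n, l' b (r' b' n) = r' b' (l' b n))
    (hc : ∀ b m a, c (b ⊗ₜ r (op a) m) = LinearMap.rTensor B (rightMap r)
      ((TensorProduct.assoc k M A B).symm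
        (LinearMap.lTensor M τ (slide c (b ⊗ₜ[k] (m ⊗ₜ[k] a))))))
    (hs : ∀ b n a, s (l' b n ⊗ₜ a) = LinearMap.lTensor A (TensorProduct.lift l'.toLinearMap)
      (slide τ (b ⊗ₜ[k] s (n ⊗ₜ a))))
    (x y : A ⊗[k] B) (z : M ⊗[k] N) :
    leftAct l l' c (x ⊗ₜ rightAct r r' s (z ⊗ₜ y)) =
      rightAct r r' s (leftAct l l' c (x ⊗ₜ z) ⊗ₜ y) := by
  induction x using TensorProduct.induction_on with
  | zero => simp
  | add x x' hx hx' => simp only [map_add, TensorProduct.add_tmul, hx, hx']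
  | tmul a b =>
  induction y using TensorProduct.induction_on with
  | zero => simp
  | add x x' hx hx' => simp only [map_add, TensorProduct.tmul_add, hx, hx']
  | tmul a' b' =>
  induction z using TensorProduct.induction_on with
  | zero => simp
  | add x x' hx hx' => simp only [map_add, TensorProduct.tmul_add, TensorProduct.add_tmul, hx, hx']
  | tmul m n =>
  obtain ⟨S, hS⟩ := TensorProduct.exists_finset (c (b ⊗ₜ m))
  obtain ⟨T, hT⟩ := TensorProduct.exists_finset (s (n ⊗ₜ a'))
  simp only [rightAct_tmul, leftAct_tmul, hS, hT, map_sum, TensorProduct.sum_tmul,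
    TensorProduct.tmul_sum, hc, hs, TensorProduct.map_tmul, slide_tmul,
    TensorProduct.mk_apply, LinearMap.flip_apply, LinearMap.lTensor_tmul,
    LinearMap.comp_apply, rightMap_tmul, AlgHom.toLinearMap_apply]
  rw [Finset.sum_comm]
  refine Finset.sum_congr rfl fun t _ => Finset.sum_congr rfl fun s _ => ?_
  exact leftAct_rightAct_aux hM hN ..

end Actions

section TwistedTensor

variable {k A B : Type*} [Field k] [Ring A] [Algebra k A] [Ring B] [Algebra k B]

theorem TwistingMap.mul_tmul (τ : TwistingMap k A B) (b b' : B) (a : A) :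
    τ.toEquiv ((b * b') ⊗ₜ a) = LinearMap.lTensor A (LinearMap.mul' k B)
      (slide τ.toEquiv.toLinearMap (b ⊗ₜ[k] τ.toEquiv (b' ⊗ₜ a))) := by
  have h := congrArg (fun f => f ((b ⊗ₜ b') ⊗ₜ ((1 : A) ⊗ₜ a))) τ.map_mul
  obtain ⟨S, hS⟩ := TensorProduct.exists_finset (τ.toEquiv (b' ⊗ₜ a))
  simp only [LinearMap.comp_apply, TensorProduct.map_tmul, LinearMap.mul'_apply, one_mul,
    mid_tmul, LinearEquiv.coe_coe, τ.map_tmul_one, TensorProduct.mk_apply, LinearMap.flip_apply,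
    hS, TensorProduct.tmul_sum, map_sum, slide_tmul] at h ⊢
  rw [h]
  refine Finset.sum_congr rfl fun s _ => ?_
  induction τ.toEquiv (b ⊗ₜ s.1) using TensorProduct.induction_on with
  | zero => simp
  | tmul x y => simp
  | add x y hx hy => simp only [map_add, hx, hy]

theorem TwistingMap.tmul_mul (τ : TwistingMap k A B) (b : B) (a a' : A) :
    τ.toEquiv (b ⊗ₜ (a * a')) = LinearMap.rTensor B (LinearMap.mul' k A)
      ((TensorProduct.assoc k A A B).symm (LinearMap.lTensor A τ.toEquiv.toLinearMap
        (slide τ.toEquiv.toLinearMap (b ⊗ₜ[k] (a ⊗ₜ[k] a'))))) := by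
  have h := congrArg (fun f => f ((b ⊗ₜ (1 : B)) ⊗ₜ (a ⊗ₜ a'))) τ.map_mul
  obtain ⟨S, hS⟩ := TensorProduct.exists_finset (τ.toEquiv (b ⊗ₜ a))
  simp only [LinearMap.comp_apply, TensorProduct.map_tmul, LinearMap.mul'_apply, mul_one,
    mid_tmul, LinearEquiv.coe_coe, τ.map_one_tmul, TensorProduct.mk_apply, LinearMap.flip_apply,
    hS, TensorProduct.sum_tmul, map_sum, slide_tmul, LinearMap.lTensor_tmul] at h ⊢
  rw [h]
  refine Finset.sum_congr rfl fun s _ => ?_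
  induction τ.toEquiv (s.2 ⊗ₜ a') using TensorProduct.induction_on with
  | zero => simp
  | tmul x y => simp
  | add x y hx hy => simp only [map_add, hx, hy, TensorProduct.tmul_add]

/-- The twisted tensor product algebra `A ⊗_τ B`: the space `A ⊗ B` with multiplication
`(m_A ⊗ m_B) (1 ⊗ τ ⊗ 1)`. -/
def TwistedTensor (_τ : TwistingMap k A B) : Type _ := A ⊗[k] B

variable (τ : TwistingMap k A B)

instance : AddCommGroup (TwistedTensor τ) := inferInstanceAs (AddCommGroup (A ⊗[k] B))

instance : Module k (TwistedTensor τ) := inferInstanceAs (Module k (A ⊗[k] B))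

/-- The identification of `A ⊗ B` with the underlying space of `A ⊗_τ B`. -/
def TwistedTensor.of : A ⊗[k] B ≃ₗ[k] TwistedTensor τ := LinearEquiv.refl k _

/-- The multiplication map of `A ⊗_τ B`. -/
def twistedMul : (A ⊗[k] B) ⊗[k] (A ⊗[k] B) →ₗ[k] A ⊗[k] B :=
  TensorProduct.map (LinearMap.mul' k A) (LinearMap.mul' k B) ∘ₗ mid τ.toEquiv.toLinearMap

theorem twistedMul_eq_leftAct :
    twistedMul τ = leftAct (Algebra.lmul k A) (Algebra.lmul k B) τ.toEquiv.toLinearMap := rfl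

/-- The right regular action of an algebra on itself. -/
def rmul (k A : Type*) [Field k] [Ring A] [Algebra k A] : Aᵐᵒᵖ →ₐ[k] Module.End k A :=
  Algebra.lsmul k k A

@[simp] theorem rmul_apply (x : Aᵐᵒᵖ) (a : A) : rmul k A x a = a * x.unop := rfl

theorem twistedMul_eq_rightAct :
    twistedMul τ = rightAct (rmul k A) (rmul k B) τ.toEquiv.toLinearMap := by
  rw [twistedMul, rightAct]
  congr 2

theorem twistedMul_assoc (x y z : A ⊗[k] B) :
    twistedMul τ (twistedMul τ (x ⊗ₜ y) ⊗ₜ z) = twistedMul τ (x ⊗ₜ twistedMul τ (y ⊗ₜ z)) :=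
  leftAct_mul τ.toEquiv.toLinearMap (Algebra.lmul k A) (Algebra.lmul k B) τ.toEquiv.toLinearMap
    τ.mul_tmul τ.tmul_mul x y z

theorem one_twistedMul (x : A ⊗[k] B) : twistedMul τ ((1 ⊗ₜ 1) ⊗ₜ x) = x := by
  rw [twistedMul_eq_leftAct]
  exact leftAct_one _ _ _ τ.map_one_tmul x

theorem twistedMul_one (x : A ⊗[k] B) : twistedMul τ (x ⊗ₜ (1 ⊗ₜ 1)) = x := by
  rw [twistedMul_eq_rightAct]
  exact rightAct_one _ _ _ τ.map_tmul_one x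

instance : Ring (TwistedTensor τ) :=
  { (inferInstance : AddCommGroup (TwistedTensor τ)) with
    mul := fun x y => TwistedTensor.of τ
      (twistedMul τ ((TwistedTensor.of τ).symm x ⊗ₜ (TwistedTensor.of τ).symm y))
    one := TwistedTensor.of τ (1 ⊗ₜ 1)
    mul_assoc := twistedMul_assoc τ
    one_mul := one_twistedMul τ
    mul_one := twistedMul_one τ
    left_distrib := fun x y z => by
      change TwistedTensor.of τ (twistedMul τ (_ ⊗ₜ (TwistedTensor.of τ).symm (y + z))) =
        TwistedTensor.of τ _ + TwistedTensor.of τ _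
      rw [map_add, TensorProduct.tmul_add, map_add, map_add]
    right_distrib := fun x y z => by
      change TwistedTensor.of τ (twistedMul τ ((TwistedTensor.of τ).symm (x + y) ⊗ₜ _)) =
        TwistedTensor.of τ _ + TwistedTensor.of τ _
      rw [map_add, TensorProduct.add_tmul, map_add, map_add]
    zero_mul := fun x => by
      change TwistedTensor.of τ (twistedMul τ
        ((TwistedTensor.of τ).symm 0 ⊗ₜ (TwistedTensor.of τ).symm x)) = 0
      rw [map_zero, TensorProduct.zero_tmul, map_zero, map_zero]
    mul_zero := fun x => by
      change TwistedTensor.of τ (twistedMul τ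
        ((TwistedTensor.of τ).symm x ⊗ₜ (TwistedTensor.of τ).symm 0)) = 0
      rw [map_zero, TensorProduct.tmul_zero, map_zero, map_zero] }

theorem TwistedTensor.mul_def (x y : TwistedTensor τ) :
    x * y = TwistedTensor.of τ
      (twistedMul τ ((TwistedTensor.of τ).symm x ⊗ₜ (TwistedTensor.of τ).symm y)) := rfl

theorem TwistedTensor.one_def : (1 : TwistedTensor τ) = TwistedTensor.of τ (1 ⊗ₜ 1) := rfl

instance : Algebra k (TwistedTensor τ) :=
  Algebra.ofModule
    (fun r x y => by
      rw [TwistedTensor.mul_def, TwistedTensor.mul_def, map_smul, ← TensorProduct.smul_tmul',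
        map_smul, map_smul])
    (fun r x y => by
      rw [TwistedTensor.mul_def, TwistedTensor.mul_def, map_smul, TensorProduct.tmul_smul,
        map_smul, map_smul])

end TwistedTensor

section Bimodules

/-! Bimodules over a `k`-algebra `R` are left modules over the enveloping algebra
`R ⊗ Rᵐᵒᵖ`; thus `r • m • s` is `(r ⊗ₜ op s) • m`. -/

variable {k R M : Type*} [Field k] [Ring R] [Algebra k R] [AddCommGroup M] [Module k M]

/-- The left action of `R` on an `R`-bimodule. -/
def lAct (k R M : Type*) [Field k] [Ring R] [Algebra k R] [AddCommGroup M] [Module k M]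
    [Module (R ⊗[k] Rᵐᵒᵖ) M] [IsScalarTower k (R ⊗[k] Rᵐᵒᵖ) M] : R →ₐ[k] Module.End k M :=
  (Algebra.lsmul k k M).comp (Algebra.TensorProduct.includeLeft : R →ₐ[k] R ⊗[k] Rᵐᵒᵖ)

/-- The right action of `R` on an `R`-bimodule. -/
def rAct (k R M : Type*) [Field k] [Ring R] [Algebra k R] [AddCommGroup M] [Module k M]
    [Module (R ⊗[k] Rᵐᵒᵖ) M] [IsScalarTower k (R ⊗[k] Rᵐᵒᵖ) M] : Rᵐᵒᵖ →ₐ[k] Module.End k M :=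
  (Algebra.lsmul k k M).comp (Algebra.TensorProduct.includeRight : Rᵐᵒᵖ →ₐ[k] R ⊗[k] Rᵐᵒᵖ)

/-- The bimodule structure map `R ⊗ M ⊗ R → M`, `r ⊗ m ⊗ s ↦ r m s`. -/
def bimoduleMap (k R M : Type*) [Field k] [Ring R] [Algebra k R] [AddCommGroup M] [Module k M]
    [Module (R ⊗[k] Rᵐᵒᵖ) M] [IsScalarTower k (R ⊗[k] Rᵐᵒᵖ) M] : R ⊗[k] (M ⊗[k] R) →ₗ[k] M :=
  TensorProduct.lift (Algebra.lsmul k k M : R ⊗[k] Rᵐᵒᵖ →ₐ[k] Module.End k M).toLinearMap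
    ∘ₗ LinearMap.rTensor M (LinearMap.lTensor R (opLinearEquiv k : R ≃ₗ[k] Rᵐᵒᵖ).toLinearMap)
    ∘ₗ (TensorProduct.assoc k R R M).symm.toLinearMap
    ∘ₗ LinearMap.lTensor R (TensorProduct.comm k M R).toLinearMap

section
variable [Module (R ⊗[k] Rᵐᵒᵖ) M] [IsScalarTower k (R ⊗[k] Rᵐᵒᵖ) M]

theorem lAct_apply (r : R) (m : M) : lAct k R M r m = (r ⊗ₜ[k] (1 : Rᵐᵒᵖ)) • m := rfl

theorem rAct_apply (s : Rᵐᵒᵖ) (m : M) : rAct k R M s m = ((1 : R) ⊗ₜ[k] s) • m := rfl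

@[simp] theorem bimoduleMap_tmul (r s : R) (m : M) :
    bimoduleMap k R M (r ⊗ₜ (m ⊗ₜ s)) = (r ⊗ₜ[k] op s) • m := by
  simp [bimoduleMap]

theorem lAct_rAct (r : R) (s : Rᵐᵒᵖ) (m : M) :
    lAct k R M r (rAct k R M s m) = rAct k R M s (lAct k R M r m) := by
  simp only [lAct_apply, rAct_apply, smul_smul, Algebra.TensorProduct.tmul_mul_tmul, one_mul,
    mul_one]

end

/-- The `R`-bimodule structure given by two commuting actions. -/
abbrev bimoduleOfActions (l : R →ₐ[k] Module.End k M) (r : Rᵐᵒᵖ →ₐ[k] Module.End k M)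
    (h : ∀ x y, Commute (l x) (r y)) : Module (R ⊗[k] Rᵐᵒᵖ) M :=
  Module.compHom M (Algebra.TensorProduct.lift l r h).toRingHom

theorem bimoduleOfActions_smul (l : R →ₐ[k] Module.End k M) (r : Rᵐᵒᵖ →ₐ[k] Module.End k M)
    (h : ∀ x y, Commute (l x) (r y)) (x : R) (y : Rᵐᵒᵖ) (m : M) :
    letI := bimoduleOfActions l r h
    (x ⊗ₜ[k] y) • m = l x (r y m) := rfl

theorem bimoduleOfActions_tower (l : R →ₐ[k] Module.End k M) (r : Rᵐᵒᵖ →ₐ[k] Module.End k M)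
    (h : ∀ x y, Commute (l x) (r y)) :
    letI := bimoduleOfActions l r h
    IsScalarTower k (R ⊗[k] Rᵐᵒᵖ) M := by
  let := bimoduleOfActions l r h
  refine ⟨fun c x m => ?_⟩
  change Algebra.TensorProduct.lift l r h (c • x) m = c • Algebra.TensorProduct.lift l r h x m
  rw [map_smul]; rfl

/-- A linear map commuting with the two actions is a bimodule map. -/
def bimoduleHom {N : Type*} [AddCommGroup N] [Module k N]
    [Module (R ⊗[k] Rᵐᵒᵖ) M] [Module (R ⊗[k] Rᵐᵒᵖ) N]
    (f : M →ₗ[k] N) (hf : ∀ (r : R) (s : Rᵐᵒᵖ) (m : M), f ((r ⊗ₜ[k] s) • m) = (r ⊗ₜ[k] s) • f m) :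
    M →ₗ[R ⊗[k] Rᵐᵒᵖ] N where
  toFun := f
  map_add' := map_add f
  map_smul' x m := by
    rw [RingHom.id_apply]
    change f (x • m) = x • f m
    induction x using TensorProduct.induction_on with
    | zero => exact (congrArg f (zero_smul (R ⊗[k] Rᵐᵒᵖ) m)).trans ((map_zero f).trans (zero_smul (R ⊗[k] Rᵐᵒᵖ) (f m)).symm)
    | tmul r s => exact hf r s m
    | add x y hx hy => rw [add_smul, add_smul, map_add, hx, hy]

/-- A sequence `⋯ → X 1 → X 0 → R → 0` of bimodules over the `k`-algebra `R`. -/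
structure AugmentedSequence (k R : Type*) [Field k] [Ring R] [Algebra k R] where
  X : ℕ → Type*
  [addCommGroup : ∀ n, AddCommGroup (X n)]
  [module : ∀ n, Module k (X n)]
  [bimodule : ∀ n, Module (R ⊗[k] Rᵐᵒᵖ) (X n)]
  [tower : ∀ n, IsScalarTower k (R ⊗[k] Rᵐᵒᵖ) (X n)]
  d : ∀ n, X (n + 1) →ₗ[R ⊗[k] Rᵐᵒᵖ] X n
  ε : X 0 →ₗ[k] R
  ε_smul : ∀ (r s : R) (x : X 0), ε ((r ⊗ₜ[k] op s) • x) = r * ε x * s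

attribute [instance] AugmentedSequence.addCommGroup AugmentedSequence.module
  AugmentedSequence.bimodule AugmentedSequence.tower

/-- The sequence is a projective resolution of `R` as an `R`-bimodule. -/
structure AugmentedSequence.IsProjectiveResolution (P : AugmentedSequence k R) : Prop where
  projective : ∀ n, Module.Projective (R ⊗[k] Rᵐᵒᵖ) (P.X n)
  exact_succ : ∀ n, Function.Exact (P.d (n + 1)) (P.d n)
  exact_zero : Function.Exact (P.d 0) P.ε
  surjective : Function.Surjective P.ε

end Bimodules

section Compatibility

variable {k A B : Type*} [Field k] [Ring A] [Algebra k A] [Ring B] [Algebra k B]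

theorem slide_symm_slide {P P' Q Q' S : Type*}
    [AddCommGroup P] [Module k P] [AddCommGroup P'] [Module k P']
    [AddCommGroup Q] [Module k Q] [AddCommGroup Q'] [Module k Q'] [AddCommGroup S] [Module k S]
    (e : P ⊗[k] Q ≃ₗ[k] Q' ⊗[k] P') (x : P ⊗[k] (Q ⊗[k] S)) :
    slide e.symm.toLinearMap (slide e.toLinearMap x) = x := by
  simp only [slide, LinearMap.comp_apply, LinearEquiv.coe_coe, LinearEquiv.symm_apply_apply]
  rw [← LinearMap.comp_apply (LinearMap.rTensor S e.symm.toLinearMap), ← LinearMap.rTensor_comp]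
  simp

/-- A map `τ_{B,M} : B ⊗ M → M ⊗ B` through which the `A`-bimodule `M` is compatible with the
twisting map `τ`: a bijective linear map with
`τ_{B,M} (m_B ⊗ 1) = (1 ⊗ m_B) (τ_{B,M} ⊗ 1) (1 ⊗ τ_{B,M})` and
`τ_{B,M} (1 ⊗ ρ) = (ρ ⊗ 1) (1 ⊗ 1 ⊗ τ) (1 ⊗ τ_{B,M} ⊗ 1) (τ ⊗ 1 ⊗ 1)`,
where `ρ : A ⊗ M ⊗ A → M` is the bimodule structure map. -/
structure CompatibleMap (τ : TwistingMap k A B) (M : Type*) [AddCommGroup M] [Module k M]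
    [Module (A ⊗[k] Aᵐᵒᵖ) M] [IsScalarTower k (A ⊗[k] Aᵐᵒᵖ) M] where
  toEquiv : B ⊗[k] M ≃ₗ[k] M ⊗[k] B
  map_mul :
    toEquiv.toLinearMap ∘ₗ LinearMap.rTensor M (LinearMap.mul' k B)
        ∘ₗ (TensorProduct.assoc k B B M).symm.toLinearMap =
      LinearMap.lTensor M (LinearMap.mul' k B) ∘ₗ slide toEquiv.toLinearMap
        ∘ₗ LinearMap.lTensor B toEquiv.toLinearMap
  map_bimodule :
    toEquiv.toLinearMap ∘ₗ LinearMap.lTensor B (bimoduleMap k A M) =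
      LinearMap.rTensor B (bimoduleMap k A M)
        ∘ₗ (TensorProduct.assoc k A (M ⊗[k] A) B).symm.toLinearMap
        ∘ₗ LinearMap.lTensor A ((TensorProduct.assoc k M A B).symm.toLinearMap
          ∘ₗ LinearMap.lTensor M τ.toEquiv.toLinearMap ∘ₗ slide toEquiv.toLinearMap)
        ∘ₗ slide τ.toEquiv.toLinearMap

namespace CompatibleMap

section
variable {τ : TwistingMap k A B} {M : Type*} [AddCommGroup M] [Module k M]
    [Module (A ⊗[k] Aᵐᵒᵖ) M] [IsScalarTower k (A ⊗[k] Aᵐᵒᵖ) M] (c : CompatibleMap τ M)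

theorem mul_tmul (b b' : B) (m : M) : c.toEquiv ((b * b') ⊗ₜ m) =
    LinearMap.lTensor M (LinearMap.mul' k B)
      (slide c.toEquiv.toLinearMap (b ⊗ₜ[k] c.toEquiv (b' ⊗ₜ m))) := by
  have h := congrArg (fun f => f (b ⊗ₜ (b' ⊗ₜ m))) c.map_mul
  simpa using h

theorem one_tmul (m : M) : c.toEquiv (1 ⊗ₜ m) = m ⊗ₜ 1 := by
  have h : ∀ x : B ⊗[k] M, LinearMap.lTensor M (LinearMap.mul' k B)
      (slide c.toEquiv.toLinearMap ((1 : B) ⊗ₜ[k] c.toEquiv x)) = c.toEquiv x := by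
    intro x
    induction x using TensorProduct.induction_on with
    | zero => simp
    | tmul b m => rw [← c.mul_tmul, one_mul]
    | add x y hx hy => simp only [map_add, TensorProduct.tmul_add, hx, hy]
  have h' := h (c.toEquiv.symm (m ⊗ₜ 1))
  rw [LinearEquiv.apply_symm_apply, slide_tmul] at h'
  rw [← h', LinearEquiv.coe_coe]
  induction c.toEquiv (1 ⊗ₜ m) using TensorProduct.induction_on with
  | zero => simp
  | tmul x y => simp
  | add x y hx hy => rw [map_add, map_add, ← hx, ← hy]

theorem tmul_lAct (b : B) (a : A) (m : M) : c.toEquiv (b ⊗ₜ lAct k A M a m) =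
    LinearMap.rTensor B (TensorProduct.lift (lAct k A M).toLinearMap)
      ((TensorProduct.assoc k A M B).symm (LinearMap.lTensor A c.toEquiv.toLinearMap
        (slide τ.toEquiv.toLinearMap (b ⊗ₜ (a ⊗ₜ m))))) := by
  have h := congrArg (fun f => f (b ⊗ₜ (a ⊗ₜ (m ⊗ₜ (1 : A))))) c.map_bimodule
  simp only [LinearMap.comp_apply, LinearMap.lTensor_tmul, bimoduleMap_tmul, LinearEquiv.coe_coe,
    slide_tmul] at h ⊢
  rw [lAct_apply, ← op_one, h]
  induction τ.toEquiv (b ⊗ₜ a) using TensorProduct.induction_on with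
  | zero => simp
  | add x y hx hy => simp only [map_add, hx, hy]
  | tmul α β =>
    simp only [LinearMap.lTensor_tmul, LinearMap.flip_apply, TensorProduct.mk_apply,
      LinearMap.comp_apply, slide_tmul, LinearEquiv.coe_coe]
    induction c.toEquiv (β ⊗ₜ m) using TensorProduct.induction_on with
    | zero => simp
    | add x y hx hy => simp only [map_add, hx, hy, TensorProduct.tmul_add]
    | tmul p β' => simp [τ.map_tmul_one, lAct_apply]

theorem tmul_rAct (b : B) (m : M) (a : A) : c.toEquiv (b ⊗ₜ rAct k A M (op a) m) =
    LinearMap.rTensor B (rightMap (rAct k A M)) ((TensorProduct.assoc k M A B).symm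
      (LinearMap.lTensor M τ.toEquiv.toLinearMap
        (slide c.toEquiv.toLinearMap (b ⊗ₜ[k] (m ⊗ₜ[k] a))))) := by
  have h := congrArg (fun f => f (b ⊗ₜ ((1 : A) ⊗ₜ (m ⊗ₜ a)))) c.map_bimodule
  simp only [LinearMap.comp_apply, LinearMap.lTensor_tmul, bimoduleMap_tmul, LinearEquiv.coe_coe,
    slide_tmul, τ.map_tmul_one, LinearMap.flip_apply, TensorProduct.mk_apply] at h ⊢
  rw [rAct_apply, h]
  induction c.toEquiv (b ⊗ₜ m) using TensorProduct.induction_on with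
  | zero => simp
  | add x y hx hy => simp only [map_add, hx, hy, TensorProduct.tmul_add]
  | tmul p β =>
    simp only [LinearMap.lTensor_tmul, LinearMap.flip_apply, TensorProduct.mk_apply,
      LinearEquiv.coe_coe]
    induction τ.toEquiv (β ⊗ₜ a) using TensorProduct.induction_on with
    | zero => simp
    | add x y hx hy => simp only [map_add, hx, hy, TensorProduct.tmul_add]
    | tmul α β' => simp [rAct_apply]

end

section
variable {τ : TwistingMap k A B} {N : Type*} [AddCommGroup N] [Module k N]
    [Module (B ⊗[k] Bᵐᵒᵖ) N] [IsScalarTower k (B ⊗[k] Bᵐᵒᵖ) N] (c : CompatibleMap τ.symm N)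

/-! For a `B`-bimodule `N` compatible with `τ⁻¹`, the map `τ_{N,A} = (τ⁻¹_{A,N})⁻¹`. -/

theorem symm_tmul_one (n : N) : c.toEquiv.symm (n ⊗ₜ 1) = 1 ⊗ₜ n := by
  rw [LinearEquiv.symm_apply_eq, c.one_tmul]

theorem symm_tmul_mul (n : N) (a a' : A) : c.toEquiv.symm (n ⊗ₜ (a * a')) =
    LinearMap.rTensor N (LinearMap.mul' k A) ((TensorProduct.assoc k A A N).symm
      (LinearMap.lTensor A c.toEquiv.symm.toLinearMap
        (slide c.toEquiv.symm.toLinearMap (n ⊗ₜ[k] (a ⊗ₜ[k] a'))))) := by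
  have h := congrArg (fun f => f (LinearMap.lTensor A c.toEquiv.symm.toLinearMap
        (slide c.toEquiv.symm.toLinearMap (n ⊗ₜ[k] (a ⊗ₜ[k] a'))))) c.map_mul
  have h' : slide c.toEquiv.toLinearMap
      (slide c.toEquiv.symm.toLinearMap (n ⊗ₜ[k] (a ⊗ₜ[k] a'))) = n ⊗ₜ[k] (a ⊗ₜ[k] a') :=
    slide_symm_slide c.toEquiv.symm _
  simp only [LinearMap.comp_apply] at h
  rw [← LinearMap.comp_apply (LinearMap.lTensor A _) (LinearMap.lTensor A _),
    ← LinearMap.lTensor_comp, LinearEquiv.comp_coe, LinearEquiv.symm_trans_self,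
    LinearEquiv.refl_toLinearMap, LinearMap.lTensor_id, LinearMap.id_apply,
    h', LinearMap.lTensor_tmul, LinearMap.mul'_apply] at h
  rw [LinearEquiv.symm_apply_eq]
  exact h.symm

theorem symm_lAct_tmul (b : B) (n : N) (a : A) : c.toEquiv.symm (lAct k B N b n ⊗ₜ a) =
    LinearMap.lTensor A (TensorProduct.lift (lAct k B N).toLinearMap)
      (slide τ.toEquiv.toLinearMap (b ⊗ₜ[k] c.toEquiv.symm (n ⊗ₜ a))) := by
  have h : ∀ w : A ⊗[k] (B ⊗[k] N),
      c.toEquiv (LinearMap.lTensor A (TensorProduct.lift (lAct k B N).toLinearMap) w) =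
        LinearMap.rTensor A (TensorProduct.lift (lAct k B N).toLinearMap)
          ((TensorProduct.assoc k B N A).symm (LinearMap.lTensor B c.toEquiv.toLinearMap
            (slide τ.symm.toEquiv.toLinearMap w))) := by
    intro w
    induction w using TensorProduct.induction_on with
    | zero => simp only [map_zero]
    | add x y hx hy => simp only [map_add, hx, hy]
    | tmul a w =>
      induction w using TensorProduct.induction_on with
      | zero => simp only [map_zero, TensorProduct.tmul_zero]
      | add x y hx hy => simp only [map_add, hx, hy, TensorProduct.tmul_add]
      | tmul b n => exact c.tmul_lAct a b n
  rw [LinearEquiv.symm_apply_eq, h]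
  have h' : slide τ.symm.toEquiv.toLinearMap
      (slide τ.toEquiv.toLinearMap (b ⊗ₜ[k] c.toEquiv.symm (n ⊗ₜ a))) =
      b ⊗ₜ[k] c.toEquiv.symm (n ⊗ₜ a) := slide_symm_slide _ _
  rw [h']
  simp

theorem symm_rAct_tmul (n : N) (b : B) (a : A) : c.toEquiv.symm (rAct k B N (op b) n ⊗ₜ a) =
    LinearMap.lTensor A (rightMap (rAct k B N))
      (slide c.toEquiv.symm.toLinearMap (n ⊗ₜ[k] τ.toEquiv (b ⊗ₜ a))) := by
  have h : ∀ w : A ⊗[k] (N ⊗[k] B),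
      c.toEquiv (LinearMap.lTensor A (rightMap (rAct k B N)) w) =
        LinearMap.rTensor A (rightMap (rAct k B N))
          ((TensorProduct.assoc k N B A).symm (LinearMap.lTensor N τ.symm.toEquiv.toLinearMap
            (slide c.toEquiv.toLinearMap w))) := by
    intro w
    induction w using TensorProduct.induction_on with
    | zero => simp only [map_zero]
    | add x y hx hy => simp only [map_add, hx, hy]
    | tmul a w =>
      induction w using TensorProduct.induction_on with
      | zero => simp only [map_zero, TensorProduct.tmul_zero]
      | add x y hx hy => simp only [map_add, hx, hy, TensorProduct.tmul_add]
      | tmul n b =>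
        rw [LinearMap.lTensor_tmul, rightMap_tmul]
        exact c.tmul_rAct a n b
  rw [LinearEquiv.symm_apply_eq, h]
  have h' : slide c.toEquiv.toLinearMap
      (slide c.toEquiv.symm.toLinearMap (n ⊗ₜ[k] τ.toEquiv (b ⊗ₜ a))) =
      n ⊗ₜ[k] τ.toEquiv (b ⊗ₜ a) := slide_symm_slide c.toEquiv.symm _
  rw [h']
  simp [TwistingMap.symm]

end

end CompatibleMap

end Compatibility

section TwistedBimodule

variable {k A B : Type*} [Field k] [Ring A] [Algebra k A] [Ring B] [Algebra k B]
  {τ : TwistingMap k A B}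
  {M : Type*} [AddCommGroup M] [Module k M]
  [Module (A ⊗[k] Aᵐᵒᵖ) M] [IsScalarTower k (A ⊗[k] Aᵐᵒᵖ) M]
  {N : Type*} [AddCommGroup N] [Module k N]
  [Module (B ⊗[k] Bᵐᵒᵖ) N] [IsScalarTower k (B ⊗[k] Bᵐᵒᵖ) N]

/-- The left action of `A ⊗_τ B` on `M ⊗ N`: the composite
`A ⊗ B ⊗ M ⊗ N → A ⊗ M ⊗ B ⊗ N → M ⊗ N` of `1 ⊗ τ_{B,M} ⊗ 1` with the left actions. -/
def twistedLAct (c : CompatibleMap τ M) (N : Type*) [AddCommGroup N] [Module k N]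
    [Module (B ⊗[k] Bᵐᵒᵖ) N] [IsScalarTower k (B ⊗[k] Bᵐᵒᵖ) N] :
    TwistedTensor τ →ₐ[k] Module.End k (M ⊗[k] N) :=
  AlgHom.ofLinearMap
    (TensorProduct.curry (leftAct (lAct k A M) (lAct k B N) c.toEquiv.toLinearMap)
      ∘ₗ (TwistedTensor.of τ).symm.toLinearMap)
    (LinearMap.ext fun z => leftAct_one _ _ _ c.one_tmul z)
    (fun x y => LinearMap.ext fun z =>
      leftAct_mul τ.toEquiv.toLinearMap _ _ _ c.mul_tmul c.tmul_lAct
        ((TwistedTensor.of τ).symm x) ((TwistedTensor.of τ).symm y) z)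

/-- The right action of `A ⊗_τ B` on `M ⊗ N`: the composite
`M ⊗ N ⊗ A ⊗ B → M ⊗ A ⊗ N ⊗ B → M ⊗ N` of `1 ⊗ τ_{N,A} ⊗ 1` with the right actions. -/
def twistedRAct (M : Type*) [AddCommGroup M] [Module k M]
    [Module (A ⊗[k] Aᵐᵒᵖ) M] [IsScalarTower k (A ⊗[k] Aᵐᵒᵖ) M] (c' : CompatibleMap τ.symm N) :
    (TwistedTensor τ)ᵐᵒᵖ →ₐ[k] Module.End k (M ⊗[k] N) :=
  AlgHom.ofLinearMap
    ((TensorProduct.curry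
        (rightAct (rAct k A M) (rAct k B N) c'.toEquiv.symm.toLinearMap)).flip
      ∘ₗ (TwistedTensor.of τ).symm.toLinearMap
      ∘ₗ (opLinearEquiv k : TwistedTensor τ ≃ₗ[k] (TwistedTensor τ)ᵐᵒᵖ).symm.toLinearMap)
    (LinearMap.ext fun z => rightAct_one _ _ _ c'.symm_tmul_one z)
    (fun x y => LinearMap.ext fun z =>
      rightAct_mul τ.toEquiv.toLinearMap _ _ _ c'.symm_tmul_mul c'.symm_rAct_tmul
        ((TwistedTensor.of τ).symm y.unop) ((TwistedTensor.of τ).symm x.unop) z)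

theorem twistedLAct_apply (c : CompatibleMap τ M) (x : TwistedTensor τ) (z : M ⊗[k] N) :
    twistedLAct c N x z = leftAct (lAct k A M) (lAct k B N) c.toEquiv.toLinearMap
      ((TwistedTensor.of τ).symm x ⊗ₜ z) := rfl

theorem twistedRAct_apply (c' : CompatibleMap τ.symm N) (x : (TwistedTensor τ)ᵐᵒᵖ)
    (z : M ⊗[k] N) :
    twistedRAct M c' x z = rightAct (rAct k A M) (rAct k B N) c'.toEquiv.symm.toLinearMap
      (z ⊗ₜ (TwistedTensor.of τ).symm x.unop) := rfl

theorem twistedLAct_commute (c : CompatibleMap τ M) (c' : CompatibleMap τ.symm N)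
    (x : TwistedTensor τ) (y : (TwistedTensor τ)ᵐᵒᵖ) :
    Commute (twistedLAct c N x) (twistedRAct M c' y) :=
  LinearMap.ext fun z => leftAct_rightAct τ.toEquiv.toLinearMap lAct_rAct lAct_rAct
    c.tmul_rAct c'.symm_lAct_tmul ((TwistedTensor.of τ).symm x)
    ((TwistedTensor.of τ).symm y.unop) z

/-- The space `M ⊗ N` with its `A ⊗_τ B`-bimodule structure, for an `A`-bimodule `M` and a
`B`-bimodule `N` that are compatible with `τ`. -/
def TwistedBimodule (_c : CompatibleMap τ M) (_c' : CompatibleMap τ.symm N) : Type _ := M ⊗[k] N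

variable (c : CompatibleMap τ M) (c' : CompatibleMap τ.symm N)

instance : AddCommGroup (TwistedBimodule c c') := inferInstanceAs (AddCommGroup (M ⊗[k] N))

instance : Module k (TwistedBimodule c c') := inferInstanceAs (Module k (M ⊗[k] N))

/-- The identification of `M ⊗ N` with the underlying space of the twisted bimodule. -/
def TwistedBimodule.of : M ⊗[k] N ≃ₗ[k] TwistedBimodule c c' := LinearEquiv.refl k _

instance : Module (TwistedTensor τ ⊗[k] (TwistedTensor τ)ᵐᵒᵖ) (TwistedBimodule c c') :=
  bimoduleOfActions (M := TwistedBimodule c c') (twistedLAct c N) (twistedRAct M c')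
    (twistedLAct_commute c c')

instance : IsScalarTower k (TwistedTensor τ ⊗[k] (TwistedTensor τ)ᵐᵒᵖ) (TwistedBimodule c c') :=
  bimoduleOfActions_tower (M := TwistedBimodule c c') (twistedLAct c N) (twistedRAct M c')
    (twistedLAct_commute c c')

theorem TwistedBimodule.smul_of (x : TwistedTensor τ) (y : (TwistedTensor τ)ᵐᵒᵖ) (z : M ⊗[k] N) :
    (x ⊗ₜ[k] y) • TwistedBimodule.of c c' z =
      TwistedBimodule.of c c' (twistedLAct c N x (twistedRAct M c' y z)) := rfl

/-- The two-sided action is the composite of `1 ⊗ τ_{B,M} ⊗ τ_{N,A} ⊗ 1`, `1 ⊗ 1 ⊗ τ ⊗ 1 ⊗ 1`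
and `ρ_{A,M} ⊗ ρ_{B,N}`. -/
theorem TwistedBimodule.smul_tmul (a a' : A) (b b' : B) (m : M) (n : N) :
    (TwistedTensor.of τ (a ⊗ₜ b) ⊗ₜ[k] op (TwistedTensor.of τ (a' ⊗ₜ b'))) •
        TwistedBimodule.of c c' (m ⊗ₜ n) =
      TwistedBimodule.of c c'
        (TensorProduct.map
          (bimoduleMap k A M ∘ₗ TensorProduct.mk k A (M ⊗[k] A) a)
          (bimoduleMap k B N ∘ₗ (TensorProduct.assoc k B N B).toLinearMap
            ∘ₗ (TensorProduct.mk k (B ⊗[k] N) B).flip b')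
          (mid τ.toEquiv.toLinearMap (c.toEquiv (b ⊗ₜ m) ⊗ₜ[k] c'.toEquiv.symm (n ⊗ₜ a')))) := by
  rw [TwistedBimodule.smul_of]
  congr 1
  rw [twistedRAct_apply, twistedLAct_apply, LinearEquiv.symm_apply_apply, unop_op,
    LinearEquiv.symm_apply_apply, rightAct_tmul]
  obtain ⟨S, hS⟩ := TensorProduct.exists_finset (c.toEquiv (b ⊗ₜ m))
  obtain ⟨T, hT⟩ := TensorProduct.exists_finset (c'.toEquiv.symm (n ⊗ₜ a'))
  simp only [hS, hT, map_sum, TensorProduct.sum_tmul, TensorProduct.tmul_sum, LinearEquiv.coe_coe,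
    TensorProduct.map_tmul, leftAct_tmul, LinearMap.comp_apply, rightMap_tmul,
    TensorProduct.mk_apply, c.tmul_rAct, slide_tmul, mid_tmul, LinearMap.lTensor_tmul,
    LinearMap.flip_apply]
  refine Finset.sum_congr rfl fun t _ => Finset.sum_congr rfl fun s _ => ?_
  induction τ.toEquiv (s.2 ⊗ₜ t.1) using TensorProduct.induction_on with
  | zero => simp
  | add x y hx hy => simp only [map_add, hx, hy, TensorProduct.tmul_add]
  | tmul α β => simp [lAct_apply, rAct_apply, smul_smul]

end TwistedBimodule

section TwistedProductComplex

variable {k A B : Type*} [Field k] [Ring A] [Algebra k A] [Ring B] [Algebra k B]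

/-- The differentials as `k`-linear maps. -/
def AugmentedSequence.dₖ {R : Type*} [Ring R] [Algebra k R] (P : AugmentedSequence k R) (n : ℕ) :
    P.X (n + 1) →ₗ[k] P.X n :=
  (P.d n).restrictScalars k

theorem AugmentedSequence.ε_lAct {R : Type*} [Ring R] [Algebra k R] (P : AugmentedSequence k R)
    (r : R) (x : P.X 0) : P.ε (lAct k R (P.X 0) r x) = r * P.ε x :=
  (P.ε_smul r 1 x).trans (mul_one _)

theorem AugmentedSequence.ε_rAct {R : Type*} [Ring R] [Algebra k R] (P : AugmentedSequence k R)
    (r : Rᵐᵒᵖ) (x : P.X 0) : P.ε (rAct k R (P.X 0) r x) = P.ε x * r.unop :=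
  (P.ε_smul 1 r.unop x).trans (by rw [one_mul])

/-- Maps `τ_{B,n} : B ⊗ P n → P n ⊗ B` through which the sequence `P` of `A`-bimodules, augmented
by `A`, is compatible with the twisting map `τ`: each `P n` is compatible with `τ` through
`τ_{B,n}`, and the `τ_{B,n}` form a chain map lifting `τ`. -/
structure CompatibleTwist (τ : TwistingMap k A B) (P : AugmentedSequence k A) where
  tw : ∀ n, CompatibleMap τ (P.X n)
  d_comm : ∀ n, LinearMap.rTensor B (P.dₖ n) ∘ₗ (tw (n + 1)).toEquiv.toLinearMap =
    (tw n).toEquiv.toLinearMap ∘ₗ LinearMap.lTensor B (P.dₖ n)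
  ε_comm : LinearMap.rTensor B P.ε ∘ₗ (tw 0).toEquiv.toLinearMap =
    τ.toEquiv.toLinearMap ∘ₗ LinearMap.lTensor B P.ε

variable {τ : TwistingMap k A B}

section
variable {M M' : Type*} [AddCommGroup M] [Module k M]
  [Module (A ⊗[k] Aᵐᵒᵖ) M] [IsScalarTower k (A ⊗[k] Aᵐᵒᵖ) M]
  [AddCommGroup M'] [Module k M']
  [Module (A ⊗[k] Aᵐᵒᵖ) M'] [IsScalarTower k (A ⊗[k] Aᵐᵒᵖ) M']
  {N N' : Type*} [AddCommGroup N] [Module k N]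
  [Module (B ⊗[k] Bᵐᵒᵖ) N] [IsScalarTower k (B ⊗[k] Bᵐᵒᵖ) N]
  [AddCommGroup N'] [Module k N']
  [Module (B ⊗[k] Bᵐᵒᵖ) N'] [IsScalarTower k (B ⊗[k] Bᵐᵒᵖ) N']

theorem comm_symm {P Q P' Q' : Type*}
    [AddCommGroup P] [Module k P] [AddCommGroup Q] [Module k Q]
    [AddCommGroup P'] [Module k P'] [AddCommGroup Q'] [Module k Q']
    {e : P ≃ₗ[k] Q} {e' : P' ≃ₗ[k] Q'} {f : Q →ₗ[k] Q'} {g : P →ₗ[k] P'}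
    (h : f ∘ₗ e.toLinearMap = e'.toLinearMap ∘ₗ g) (x : Q) : g (e.symm x) = e'.symm (f x) := by
  rw [LinearEquiv.eq_symm_apply]
  have := congrArg (fun F => F (e.symm x)) h
  simpa using this.symm

/-- The map `f ⊗ g` of `A ⊗_τ B`-bimodules, for bimodule maps `f` and `g` that commute with the
twisting. -/
def TwistedBimodule.map (c₁ : CompatibleMap τ M) (c₂ : CompatibleMap τ M')
    (c₁' : CompatibleMap τ.symm N) (c₂' : CompatibleMap τ.symm N')
    (f : M →ₗ[A ⊗[k] Aᵐᵒᵖ] M') (g : N →ₗ[B ⊗[k] Bᵐᵒᵖ] N')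
    (hf : LinearMap.rTensor B (f.restrictScalars k) ∘ₗ c₁.toEquiv.toLinearMap =
      c₂.toEquiv.toLinearMap ∘ₗ LinearMap.lTensor B (f.restrictScalars k))
    (hg : LinearMap.rTensor A (g.restrictScalars k) ∘ₗ c₁'.toEquiv.toLinearMap =
      c₂'.toEquiv.toLinearMap ∘ₗ LinearMap.lTensor A (g.restrictScalars k)) :
    TwistedBimodule c₁ c₁' →ₗ[TwistedTensor τ ⊗[k] (TwistedTensor τ)ᵐᵒᵖ] TwistedBimodule c₂ c₂' :=
  bimoduleHom
    ((TwistedBimodule.of c₂ c₂').toLinearMap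
      ∘ₗ TensorProduct.map (f.restrictScalars k) (g.restrictScalars k)
      ∘ₗ (TwistedBimodule.of c₁ c₁').symm.toLinearMap)
    (fun x y z => by
      have h : ∀ (n : N) (a : A), LinearMap.lTensor A (g.restrictScalars k)
          (c₁'.toEquiv.symm.toLinearMap (n ⊗ₜ[k] a)) =
            c₂'.toEquiv.symm.toLinearMap (g.restrictScalars k n ⊗ₜ[k] a) :=
        fun n a => comm_symm (e := c₁'.toEquiv) (e' := c₂'.toEquiv) hg (n ⊗ₜ[k] a)
      obtain ⟨z, rfl⟩ := (TwistedBimodule.of c₁ c₁').surjective z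
      simp only [LinearMap.comp_apply, LinearEquiv.coe_coe, TwistedBimodule.smul_of,
        LinearEquiv.symm_apply_apply]
      congr 1
      rw [twistedLAct_apply, leftAct_natural (l₁ := lAct k A M') (l₁' := lAct k B N')
        (c₁ := c₂.toEquiv.toLinearMap), twistedRAct_apply,
        rightAct_natural (r₁ := rAct k A M') (r₁' := rAct k B N')
        (s₁ := c₂'.toEquiv.symm.toLinearMap)]
      · rfl
      · exact fun a m => f.map_smul _ _
      · exact fun b n => g.map_smul _ _
      · exact h
      · exact fun a m => f.map_smul _ _
      · exact fun b n => g.map_smul _ _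
      · exact fun b m => congrArg (fun F => F (b ⊗ₜ m)) hf)

end

variable {P : AugmentedSequence k A} {Q : AugmentedSequence k B}
  (c : CompatibleTwist τ P) (c' : CompatibleTwist τ.symm Q)

/-- The bimodule `X i j = P i ⊗ Q j` over `A ⊗_τ B`. -/
abbrev bicomplexX (i j : ℕ) : Type _ := TwistedBimodule (c.tw i) (c'.tw j)

/-- The bimodule `X n = ⨁_{i + j = n} P i ⊗ Q j` over `A ⊗_τ B`. -/
abbrev totalX (n : ℕ) : Type _ :=
  DirectSum {p : ℕ × ℕ // p.1 + p.2 = n} fun p => bicomplexX c c' p.1.1 p.1.2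

/-- The horizontal differential `d ⊗ 1 : X i j → X (i - 1) j`, zero for `i = 0`. -/
def horizontalD (n : ℕ) : ∀ i j : ℕ, i + j = n + 1 →
    (bicomplexX c c' i j →ₗ[TwistedTensor τ ⊗[k] (TwistedTensor τ)ᵐᵒᵖ] totalX c c' n)
  | 0, _, _ => 0
  | i + 1, j, h =>
    DirectSum.lof (TwistedTensor τ ⊗[k] (TwistedTensor τ)ᵐᵒᵖ) _
        (fun p : {p : ℕ × ℕ // p.1 + p.2 = n} => bicomplexX c c' p.1.1 p.1.2)
        ⟨(i, j), by simp only; omega⟩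
      ∘ₗ TwistedBimodule.map (c.tw (i + 1)) (c.tw i) (c'.tw j) (c'.tw j) (P.d i) LinearMap.id
        (c.d_comm i) (by ext; simp)

/-- The map `1 ⊗ d : X i j → X i (j - 1)`, zero for `j = 0`. -/
def verticalD (n : ℕ) : ∀ i j : ℕ, i + j = n + 1 →
    (bicomplexX c c' i j →ₗ[TwistedTensor τ ⊗[k] (TwistedTensor τ)ᵐᵒᵖ] totalX c c' n)
  | _, 0, _ => 0
  | i, j + 1, h =>
    DirectSum.lof (TwistedTensor τ ⊗[k] (TwistedTensor τ)ᵐᵒᵖ) _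
        (fun p : {p : ℕ × ℕ // p.1 + p.2 = n} => bicomplexX c c' p.1.1 p.1.2)
        ⟨(i, j), by simp only; omega⟩
      ∘ₗ TwistedBimodule.map (c.tw i) (c.tw i) (c'.tw (j + 1)) (c'.tw j) LinearMap.id (Q.d j)
        (by ext; simp) (c'.d_comm j)

/-- The differential of the total complex: on `P i ⊗ Q j` it is `d ⊗ 1 + (-1)^i (1 ⊗ d)`. -/
def totalD (n : ℕ) :
    totalX c c' (n + 1) →ₗ[TwistedTensor τ ⊗[k] (TwistedTensor τ)ᵐᵒᵖ] totalX c c' n :=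
  DirectSum.toModule _ _ _ fun p =>
    horizontalD c c' n p.1.1 p.1.2 p.2 + (-1 : ℤ) ^ p.1.1 • verticalD c c' n p.1.1 p.1.2 p.2

/-- The augmentation `ε ⊗ ε : P 0 ⊗ Q 0 → A ⊗ B`. -/
def bicomplexε : ∀ i j : ℕ, bicomplexX c c' i j →ₗ[k] TwistedTensor τ
  | 0, 0 => (TwistedTensor.of τ).toLinearMap ∘ₗ TensorProduct.map P.ε Q.ε
      ∘ₗ (TwistedBimodule.of (c.tw 0) (c'.tw 0)).symm.toLinearMap
  | _, _ => 0

/-- The augmentation `X 0 = P 0 ⊗ Q 0 → A ⊗_τ B`. -/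
def totalε : totalX c c' 0 →ₗ[k] TwistedTensor τ :=
  DirectSum.toModule _ _ _ fun p => bicomplexε c c' p.1.1 p.1.2

theorem bicomplexε_smul (x y : TwistedTensor τ) : ∀ (i j : ℕ) (z : bicomplexX c c' i j),
    bicomplexε c c' i j ((x ⊗ₜ[k] op y) • z) = x * bicomplexε c c' i j z * y
  | 0, 0, z => by
    have h : ∀ (n : Q.X 0) (a : A), LinearMap.lTensor A Q.ε
        ((c'.tw 0).toEquiv.symm.toLinearMap (n ⊗ₜ[k] a)) =
          τ.symm.toEquiv.symm.toLinearMap (Q.ε n ⊗ₜ[k] a) :=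
      fun n a => comm_symm (e := (c'.tw 0).toEquiv) (e' := τ.symm.toEquiv) c'.ε_comm (n ⊗ₜ[k] a)
    obtain ⟨z, rfl⟩ := (TwistedBimodule.of (c.tw 0) (c'.tw 0)).surjective z
    simp only [bicomplexε, LinearMap.comp_apply, LinearEquiv.coe_coe, TwistedBimodule.smul_of,
      LinearEquiv.symm_apply_apply]
    rw [twistedLAct_apply, leftAct_natural (l₁ := Algebra.lmul k A) (l₁' := Algebra.lmul k B)
        (c₁ := τ.toEquiv.toLinearMap), twistedRAct_apply,
        rightAct_natural (r₁ := rmul k A) (r₁' := rmul k B)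
        (s₁ := τ.symm.toEquiv.symm.toLinearMap), mul_assoc]
    · rw [TwistedTensor.mul_def, TwistedTensor.mul_def, LinearEquiv.symm_apply_apply,
        LinearEquiv.symm_apply_apply, twistedMul_eq_leftAct]
      congr 3
    · exact fun a m => P.ε_rAct a m
    · exact fun a m => Q.ε_rAct a m
    · exact h
    · exact fun a m => P.ε_lAct a m
    · exact fun a m => Q.ε_lAct a m
    · exact fun b m => congrArg (fun F => F (b ⊗ₜ m)) c.ε_comm
  | 0, j + 1, z => by simp [bicomplexε]
  | i + 1, j, z => by simp [bicomplexε]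

theorem totalε_of (p : {p : ℕ × ℕ // p.1 + p.2 = 0}) (w : bicomplexX c c' p.1.1 p.1.2) :
    totalε c c' (DirectSum.lof k _ (fun p : {p : ℕ × ℕ // p.1 + p.2 = 0} =>
      bicomplexX c c' p.1.1 p.1.2) p w) = bicomplexε c c' p.1.1 p.1.2 w := by
  rw [totalε, DirectSum.toModule_lof]

theorem totalε_smul (x y : TwistedTensor τ) (z : totalX c c' 0) :
    totalε c c' ((x ⊗ₜ[k] op y) • z) = x * totalε c c' z * y := by
  induction z using DirectSum.induction_on with
  | zero =>
    rw [map_zero, mul_zero, zero_mul]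
    exact (congrArg _ (smul_zero _)).trans (map_zero _)
  | of p z =>
    rw [← DirectSum.lof_eq_of k, totalε_of, ← bicomplexε_smul, ← totalε_of]
    exact congrArg _ (DirectSum.of_smul _ _ _ _).symm
  | add z w hz hw =>
    rw [map_add, mul_add, add_mul, ← hz, ← hw, ← map_add]
    exact congrArg _ (smul_add _ _ _)

/-- The twisted product complex of `P` and `Q`: the total complex of `P i ⊗ Q j`, augmented by
`A ⊗_τ B`. -/
def twistedProduct : AugmentedSequence k (TwistedTensor τ) where
  X := totalX c c'
  d := totalD c c'
  ε := totalε c c'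
  ε_smul x y z := by
    exact totalε_smul c c' x y z

end TwistedProductComplex

section IteratedTensors

universe u

variable (k : Type*) [Field k]

/-- The iterated tensor product `V ⊗ (V ⊗ (⋯ ⊗ (V ⊗ X)))` with `n` factors `V`. -/
def iter (V X : Type u) [AddCommGroup V] [Module k V] [AddCommGroup X] [Module k X] :
    ℕ → ModuleCat.{u} k
  | 0 => ModuleCat.of k X
  | n + 1 => ModuleCat.of k (V ⊗[k] iter V X n)

variable {k}
variable {V W X : Type u} [AddCommGroup V] [Module k V] [AddCommGroup W] [Module k W]
  [AddCommGroup X] [Module k X]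

/-- The map `f ⊗ ⋯ ⊗ f ⊗ 1 : V ⊗ ⋯ ⊗ V ⊗ X → W ⊗ ⋯ ⊗ W ⊗ X`. -/
def iterMap (X : Type u) [AddCommGroup X] [Module k X] (f : V →ₗ[k] W) :
    ∀ n, iter k V X n →ₗ[k] iter k W X n
  | 0 => LinearMap.id
  | n + 1 => TensorProduct.map f (iterMap X f n)

/-- The action of the endomorphisms of `X` on the last factor of `V ⊗ ⋯ ⊗ V ⊗ X`. -/
def iterEnd (V X : Type u) [AddCommGroup V] [Module k V] [AddCommGroup X] [Module k X] :
    ∀ n, Module.End k X →ₐ[k] Module.End k (iter k V X n)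
  | 0 => AlgHom.id k _
  | n + 1 => (Module.End.lTensorAlgHom k (iter k V X n) V).comp (iterEnd V X n)

theorem iterEnd_succ_tmul (n : ℕ) (f : Module.End k X) (v : V) (y : iter k V X n) :
    iterEnd V X (n + 1) f (v ⊗ₜ[k] y : V ⊗[k] iter k V X n) =
      (v ⊗ₜ[k] iterEnd V X n f y : V ⊗[k] iter k V X n) := rfl

theorem iterMap_succ_tmul (n : ℕ) (f : V →ₗ[k] W) (v : V) (y : iter k V X n) :
    iterMap X f (n + 1) (v ⊗ₜ[k] y : V ⊗[k] iter k V X n) =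
      (f v ⊗ₜ[k] iterMap X f n y : W ⊗[k] iter k W X n) := rfl

end IteratedTensors

section InducedBimodules

variable {k A Y : Type*} [Field k] [Ring A] [Algebra k A] [AddCommGroup Y] [Module k Y]

/-- The `A`-bimodule `A ⊗ Y`, for a right `A`-module `Y`. -/
abbrev inducedBimodule (r : Aᵐᵒᵖ →ₐ[k] Module.End k Y) : Module (A ⊗[k] Aᵐᵒᵖ) (A ⊗[k] Y) :=
  bimoduleOfActions (M := A ⊗[k] Y)
    ((Module.End.rTensorAlgHom k A Y).comp (Algebra.lmul k A))
    ((Module.End.lTensorAlgHom k Y A).comp r)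
    (fun a s => by
      refine LinearMap.ext fun z => ?_
      induction z using TensorProduct.induction_on with
      | zero => simp only [map_zero]
      | tmul b y => rfl
      | add x y hx hy => simp only [map_add, hx, hy])

theorem inducedBimodule_tower (r : Aᵐᵒᵖ →ₐ[k] Module.End k Y) :
    let := inducedBimodule r
    IsScalarTower k (A ⊗[k] Aᵐᵒᵖ) (A ⊗[k] Y) :=
  bimoduleOfActions_tower ..

theorem inducedBimodule_smul (r : Aᵐᵒᵖ →ₐ[k] Module.End k Y) (a b : A) (s : Aᵐᵒᵖ) (y : Y) :
    letI := inducedBimodule r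
    (a ⊗ₜ[k] s) • (b ⊗ₜ[k] y) = (a * b) ⊗ₜ[k] r s y := rfl

/-- A linear map commuting with the actions is a map of induced bimodules. -/
def inducedHom {Z : Type*} [AddCommGroup Z] [Module k Z]
    (r : Aᵐᵒᵖ →ₐ[k] Module.End k Y) (r' : Aᵐᵒᵖ →ₐ[k] Module.End k Z)
    (f : A ⊗[k] Y →ₗ[k] A ⊗[k] Z)
    (h : ∀ a b s y, f ((a * b) ⊗ₜ r s y) =
      LinearMap.rTensor Z (LinearMap.mulLeft k a) (LinearMap.lTensor A (r' s) (f (b ⊗ₜ y)))) :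
    letI := inducedBimodule r
    letI := inducedBimodule r'
    (A ⊗[k] Y) →ₗ[A ⊗[k] Aᵐᵒᵖ] (A ⊗[k] Z) :=
  letI := inducedBimodule r
  letI := inducedBimodule r'
  bimoduleHom f (fun a s z => by
    induction z using TensorProduct.induction_on with
    | zero => rw [smul_zero, map_zero, smul_zero]
    | tmul b y => exact h a b s y
    | add x y hx hy => rw [smul_add, map_add, map_add, smul_add, hx, hy])

theorem inducedε (r : Aᵐᵒᵖ →ₐ[k] Module.End k Y) (f : A ⊗[k] Y →ₗ[k] A)
    (h : ∀ a b s y, f ((a * b) ⊗ₜ r s y) = a * f (b ⊗ₜ y) * s.unop) (a b : A) (z : A ⊗[k] Y) :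
    letI := inducedBimodule r
    f ((a ⊗ₜ[k] op b) • z) = a * f z * b := by
  let := inducedBimodule r
  induction z using TensorProduct.induction_on with
  | zero => rw [smul_zero, map_zero, mul_zero, zero_mul]
  | tmul c y => exact h a c (op b) y
  | add x y hx hy => rw [smul_add, map_add, map_add, mul_add, add_mul, hx, hy]

theorem mul'_rmul (a b : A) (s : Aᵐᵒᵖ) :
    LinearMap.mul' k A (a ⊗ₜ rmul k A s b) = rmul k A s (LinearMap.mul' k A (a ⊗ₜ b)) := by
  simp [mul_assoc]

theorem mul'_sandwich (a b : A) (s : Aᵐᵒᵖ) (y : A) :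
    LinearMap.mul' k A ((a * b) ⊗ₜ rmul k A s y) = a * LinearMap.mul' k A (b ⊗ₜ y) * s.unop := by
  simp [mul_assoc]

theorem mul'_one_tmul (y : A) : LinearMap.mul' k A (1 ⊗ₜ y) = y := by simp

end InducedBimodules

section BarResolution

universe u

variable {k : Type*} [Field k] {A : Type u} [Ring A] [Algebra k A]

/-- The right action of `A` on the last factor of `V ⊗ ⋯ ⊗ V ⊗ A`. -/
def iterRight (k : Type*) [Field k] (V A : Type u) [Ring A] [Algebra k A] [AddCommGroup V]
    [Module k V] (n : ℕ) : Aᵐᵒᵖ →ₐ[k] Module.End k (iter k V A n) :=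
  (iterEnd V A n).comp (rmul k A)

/-- The map `a ⊗ b ⊗ y ↦ a b ⊗ y - a ⊗ q (b ⊗ y)`. -/
def barStep {Y : Type*} [AddCommGroup Y] [Module k Y] (q : A ⊗[k] Y →ₗ[k] Y) :
    A ⊗[k] (A ⊗[k] Y) →ₗ[k] A ⊗[k] Y :=
  LinearMap.rTensor Y (LinearMap.mul' k A) ∘ₗ (TensorProduct.assoc k A A Y).symm.toLinearMap -
    LinearMap.lTensor A q

section
variable {Y : Type*} [AddCommGroup Y] [Module k Y]

theorem barStep_tmul (q : A ⊗[k] Y →ₗ[k] Y) (a b : A) (y : Y) :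
    barStep q (a ⊗ₜ (b ⊗ₜ y)) = (a * b) ⊗ₜ y - a ⊗ₜ q (b ⊗ₜ y) := by
  simp [barStep]

theorem barStep_right {q : A ⊗[k] Y →ₗ[k] Y} {f : Module.End k Y}
    (h : ∀ a y, q (a ⊗ₜ f y) = f (q (a ⊗ₜ y))) (a : A) (z : A ⊗[k] Y) :
    barStep q (a ⊗ₜ LinearMap.lTensor A f z) = LinearMap.lTensor A f (barStep q (a ⊗ₜ z)) := by
  induction z using TensorProduct.induction_on with
  | zero => simp
  | tmul b y => simp [barStep_tmul, h]
  | add x y hx hy => simp only [map_add, TensorProduct.tmul_add, hx, hy]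

theorem barStep_left (q : A ⊗[k] Y →ₗ[k] Y) (a b : A) (z : A ⊗[k] Y) :
    barStep q ((a * b) ⊗ₜ z) =
      LinearMap.rTensor Y (LinearMap.mulLeft k a) (barStep q (b ⊗ₜ z)) := by
  induction z using TensorProduct.induction_on with
  | zero => simp
  | tmul c y => simp [barStep_tmul, mul_assoc]
  | add x y hx hy => simp only [map_add, TensorProduct.tmul_add, hx, hy]

end

variable (k A) in
/-- The map `A^{⊗ (n + 2)} → A^{⊗ (n + 1)}`,
`a₀ ⊗ ⋯ ⊗ aₙ₊₁ ↦ ∑ i ≤ n, (-1)^i a₀ ⊗ ⋯ ⊗ aᵢ aᵢ₊₁ ⊗ ⋯ ⊗ aₙ₊₁`, by recursion on `n`: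
`a₀ ⊗ a₁ ⊗ y ↦ a₀ a₁ ⊗ y - a₀ ⊗ barD (a₁ ⊗ y)`. -/
def barD : ∀ n, A ⊗[k] iter k A A n →ₗ[k] iter k A A n
  | 0 => LinearMap.mul' k A
  | n + 1 => barStep (barD n)

theorem barD_right (s : Aᵐᵒᵖ) : ∀ (n : ℕ) (a : A) (y : iter k A A n),
    barD k A n (a ⊗ₜ iterRight k A A n s y) = iterRight k A A n s (barD k A n (a ⊗ₜ y))
  | 0, a, y => mul'_rmul a y s
  | n + 1, a, y => barStep_right (fun a y => barD_right s n a y) a y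

variable (k A) in
/-- The bar resolution of `A`: the bimodules `A^{⊗ (n + 2)} = A ⊗ A^{⊗ n} ⊗ A` with the
differentials `barD`. -/
def bar : AugmentedSequence k A where
  X n := A ⊗[k] iter k A A n
  addCommGroup _ := inferInstance
  module _ := inferInstance
  bimodule n := inducedBimodule (iterRight k A A n)
  tower n := inducedBimodule_tower (iterRight k A A n)
  d n := inducedHom (iterRight k A A (n + 1)) (iterRight k A A n) (barD k A (n + 1))
    (fun a b s y => (barStep_left _ a b _).trans
      (congrArg _ (barD_right s (n + 1) b y)))
  ε := LinearMap.mul' k A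
  ε_smul := inducedε (iterRight k A A 0) (LinearMap.mul' k A) mul'_sandwich

/-! ### The reduced bar resolution -/

variable (k A) in
/-- The quotient space `A / k 1`. -/
abbrev Reduced : Type u := A ⧸ Submodule.span k {(1 : A)}

/-- The quotient map `A → A / k 1`. -/
def reduce (k : Type*) [Field k] (A : Type u) [Ring A] [Algebra k A] : A →ₗ[k] Reduced k A :=
  (Submodule.span k {(1 : A)}).mkQ

section
variable {Y : Type*} [AddCommGroup Y] [Module k Y]

theorem barStep_one (q : A ⊗[k] Y →ₗ[k] Y) (hq : ∀ y, q (1 ⊗ₜ y) = y) (a : A) (y : Y) :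
    barStep q (a ⊗ₜ (1 ⊗ₜ y)) = 0 := by
  rw [barStep_tmul, hq, mul_one, sub_self]

theorem reduce_one : reduce k A 1 = 0 :=
  (Submodule.Quotient.mk_eq_zero _).mpr (Submodule.mem_span_singleton_self 1)

theorem reduce_surjective : Function.Surjective (reduce k A) := Submodule.mkQ_surjective _

/-- A linear section of the quotient map `A → A / k 1`. -/
def reduceSection (k : Type*) [Field k] (A : Type u) [Ring A] [Algebra k A] :
    Reduced k A →ₗ[k] A :=
  Classical.choose (LinearMap.exists_rightInverse_of_surjective (reduce k A)
    (LinearMap.range_eq_top.mpr reduce_surjective))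

theorem reduce_reduceSection (b : Reduced k A) : reduce k A (reduceSection k A b) = b :=
  LinearMap.congr_fun (Classical.choose_spec
    (LinearMap.exists_rightInverse_of_surjective (reduce k A)
      (LinearMap.range_eq_top.mpr reduce_surjective))) b

/-- If `q (1 ⊗ y) = y`, the map `a ⊗ b ⊗ y ↦ a b ⊗ y - a ⊗ q (b ⊗ y)` with `b` in `A / k 1`, which
does not depend on the representative of `b`. -/
def reducedStep (q : A ⊗[k] Y →ₗ[k] Y) (_hq : ∀ y, q (1 ⊗ₜ y) = y) :
    A ⊗[k] (Reduced k A ⊗[k] Y) →ₗ[k] A ⊗[k] Y :=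
  barStep q ∘ₗ LinearMap.lTensor A (LinearMap.rTensor Y (reduceSection k A))

theorem reducedStep_tmul (q : A ⊗[k] Y →ₗ[k] Y) (hq : ∀ y, q (1 ⊗ₜ y) = y) (a b : A) (y : Y) :
    reducedStep q hq (a ⊗ₜ (reduce k A b ⊗ₜ y)) = (a * b) ⊗ₜ y - a ⊗ₜ q (b ⊗ₜ y) := by
  have h : reduceSection k A (reduce k A b) - b ∈ Submodule.span k {(1 : A)} :=
    (Submodule.Quotient.eq _).mp (reduce_reduceSection (reduce k A b))
  obtain ⟨r, hr⟩ := Submodule.mem_span_singleton.mp h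
  rw [← barStep_tmul]
  simp only [reducedStep, LinearMap.comp_apply, LinearMap.lTensor_tmul, LinearMap.rTensor_tmul]
  rw [← sub_eq_zero, ← map_sub, ← TensorProduct.tmul_sub, ← TensorProduct.sub_tmul, ← hr,
    ← TensorProduct.smul_tmul', TensorProduct.tmul_smul, map_smul, barStep_one q hq, smul_zero]

theorem reducedStep_section (q : A ⊗[k] Y →ₗ[k] Y) (hq : ∀ y, q (1 ⊗ₜ y) = y)
    (z : Reduced k A ⊗[k] Y) :
    LinearMap.rTensor Y (reduce k A) (reducedStep q hq (1 ⊗ₜ z)) = z := by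
  induction z using TensorProduct.induction_on with
  | zero => simp
  | tmul b y =>
    obtain ⟨b, rfl⟩ := reduce_surjective b
    simp [reducedStep_tmul, reduce_one]
  | add x y hx hy => simp only [map_add, TensorProduct.tmul_add, hx, hy]

theorem reducedStep_right {q : A ⊗[k] Y →ₗ[k] Y} (hq : ∀ y, q (1 ⊗ₜ y) = y) {f : Module.End k Y}
    (h : ∀ a y, q (a ⊗ₜ f y) = f (q (a ⊗ₜ y))) (a : A) (z : Reduced k A ⊗[k] Y) :
    reducedStep q hq (a ⊗ₜ LinearMap.lTensor _ f z) =
      LinearMap.lTensor A f (reducedStep q hq (a ⊗ₜ z)) := by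
  induction z using TensorProduct.induction_on with
  | zero => simp
  | tmul b y =>
    obtain ⟨b, rfl⟩ := reduce_surjective b
    simp [reducedStep_tmul, h]
  | add x y hx hy => simp only [map_add, TensorProduct.tmul_add, hx, hy]

theorem reducedStep_left (q : A ⊗[k] Y →ₗ[k] Y) (hq : ∀ y, q (1 ⊗ₜ y) = y) (a b : A)
    (z : Reduced k A ⊗[k] Y) :
    reducedStep q hq ((a * b) ⊗ₜ z) =
      LinearMap.rTensor Y (LinearMap.mulLeft k a) (reducedStep q hq (b ⊗ₜ z)) := by
  induction z using TensorProduct.induction_on with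
  | zero => simp
  | tmul c y =>
    obtain ⟨c, rfl⟩ := reduce_surjective c
    simp [reducedStep_tmul, mul_assoc]
  | add x y hx hy => simp only [map_add, TensorProduct.tmul_add, hx, hy]

theorem reducedStep_natural {Z : Type*} [AddCommGroup Z] [Module k Z] {q : A ⊗[k] Y →ₗ[k] Y}
    {q' : A ⊗[k] Z →ₗ[k] Z} (hq' : ∀ y, q' (1 ⊗ₜ y) = y) {p : Y →ₗ[k] Z}
    (h : ∀ a y, q' (a ⊗ₜ p y) = p (q (a ⊗ₜ y))) (a : A) (z : A ⊗[k] Y) :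
    reducedStep q' hq' (a ⊗ₜ TensorProduct.map (reduce k A) p z) =
      LinearMap.lTensor A p (barStep q (a ⊗ₜ z)) := by
  induction z using TensorProduct.induction_on with
  | zero => simp
  | tmul c y => simp [reducedStep_tmul, barStep_tmul, h]
  | add x y hx hy => simp only [map_add, TensorProduct.tmul_add, hx, hy]

theorem reducedStep_natural_all {Z : Type*} [AddCommGroup Z] [Module k Z] {q : A ⊗[k] Y →ₗ[k] Y}
    {q' : A ⊗[k] Z →ₗ[k] Z} (hq' : ∀ y, q' (1 ⊗ₜ y) = y) {p : Y →ₗ[k] Z}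
    (h : ∀ a y, q' (a ⊗ₜ p y) = p (q (a ⊗ₜ y))) (x : A ⊗[k] (A ⊗[k] Y)) :
    reducedStep q' hq' (LinearMap.lTensor A (TensorProduct.map (reduce k A) p) x) =
      LinearMap.lTensor A p (barStep q x) := by
  induction x using TensorProduct.induction_on with
  | zero => simp
  | tmul a z => exact reducedStep_natural hq' h a z
  | add x y hx hy => simp only [map_add, hx, hy]

end

variable (k A) in
/-- The map `reducedD` followed by the quotient map on the first factor, with the property
that is needed to pass to `A / k 1` in the next step. -/
def reducedAux : ∀ n, {q : A ⊗[k] iter k (Reduced k A) A n →ₗ[k] iter k (Reduced k A) A n //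
    ∀ y, q (1 ⊗ₜ y) = y}
  | 0 => ⟨LinearMap.mul' k A, mul'_one_tmul (k := k) (A := A)⟩
  | n + 1 => ⟨LinearMap.rTensor (iter k (Reduced k A) A n) (reduce k A)
      ∘ₗ reducedStep (reducedAux n).1 (reducedAux n).2,
      reducedStep_section (reducedAux n).1 (reducedAux n).2⟩

variable (k A) in
/-- The differential `A ⊗ Ā^{⊗ (n + 1)} ⊗ A → A ⊗ Ā^{⊗ n} ⊗ A`, where `Ā = A / k 1`, given by the
same formula as the one of the bar resolution. -/
def reducedD (n : ℕ) : A ⊗[k] iter k (Reduced k A) A (n + 1) →ₗ[k]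
    A ⊗[k] iter k (Reduced k A) A n :=
  reducedStep (reducedAux k A n).1 (reducedAux k A n).2

theorem reducedAux_right (s : Aᵐᵒᵖ) : ∀ (n : ℕ) (a : A) (y : iter k (Reduced k A) A n),
    (reducedAux k A n).1 (a ⊗ₜ iterRight k (Reduced k A) A n s y) =
      iterRight k (Reduced k A) A n s ((reducedAux k A n).1 (a ⊗ₜ y))
  | 0, a, y => mul'_rmul a y s
  | n + 1, a, y => by
    refine (congrArg (LinearMap.rTensor (iter k (Reduced k A) A n) (reduce k A))
      (reducedStep_right (reducedAux k A n).2 (fun a y => reducedAux_right s n a y) a y)).trans ?_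
    exact (LinearMap.congr_fun (LinearMap.rTensor_comp_lTensor _ _ _) _).trans
      (LinearMap.congr_fun (LinearMap.lTensor_comp_rTensor _ _ _) _).symm

variable (k A) in
/-- The reduced bar resolution of `A`: the bimodules `A ⊗ Ā^{⊗ n} ⊗ A` with the differentials
`reducedD`. -/
def reducedBar : AugmentedSequence k A where
  X n := A ⊗[k] iter k (Reduced k A) A n
  addCommGroup _ := inferInstance
  module _ := inferInstance
  bimodule n := inducedBimodule (iterRight k (Reduced k A) A n)
  tower n := inducedBimodule_tower (iterRight k (Reduced k A) A n)
  d n := inducedHom (iterRight k (Reduced k A) A (n + 1)) (iterRight k (Reduced k A) A n)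
    (reducedD k A n)
    (fun a b s y => (reducedStep_left _ _ a b _).trans (congrArg _
      (reducedStep_right (reducedAux k A n).2 (fun a y => reducedAux_right s n a y) b y)))
  ε := LinearMap.mul' k A
  ε_smul := inducedε (iterRight k (Reduced k A) A 0) (LinearMap.mul' k A)
    mul'_sandwich

variable (k A) in
/-- The quotient map `1 ⊗ π ⊗ ⋯ ⊗ π ⊗ 1` from the bar to the reduced bar resolution. -/
def barToReduced (n : ℕ) : (bar k A).X n →ₗ[k] (reducedBar k A).X n :=
  LinearMap.lTensor A (iterMap A (reduce k A) n)

theorem reducedAux_barToReduced : ∀ (n : ℕ) (a : A) (y : iter k A A n),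
    (reducedAux k A n).1 (a ⊗ₜ iterMap A (reduce k A) n y) =
      iterMap A (reduce k A) n (barD k A n (a ⊗ₜ y))
  | 0, _, _ => rfl
  | n + 1, a, y => by
    refine (congrArg (LinearMap.rTensor (iter k (Reduced k A) A n) (reduce k A))
      (reducedStep_natural (reducedAux k A n).2
        (fun a y => reducedAux_barToReduced n a y) a y)).trans ?_
    exact LinearMap.congr_fun (LinearMap.rTensor_comp_lTensor _ _ _) _

theorem barToReduced_comm (n : ℕ) (x : (bar k A).X (n + 1)) :
    (reducedBar k A).d n (barToReduced k A (n + 1) x) = barToReduced k A n ((bar k A).d n x) :=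
  reducedStep_natural_all (reducedAux k A n).2 (fun a y => reducedAux_barToReduced n a y) x

end BarResolution

section IteratedTwist

universe u v

variable {k : Type*} [Field k] {A : Type u} [Ring A] [Algebra k A] {B : Type v} [Ring B]
  [Algebra k B]

/-- The map `(1 ⊗ t) (τ ⊗ 1) : B ⊗ A ⊗ Y → A ⊗ B ⊗ Y → A ⊗ Y ⊗ B`. -/
def twistStep (τ : TwistingMap k A B) {Y : Type*} [AddCommGroup Y] [Module k Y]
    (t : B ⊗[k] Y ≃ₗ[k] Y ⊗[k] B) : B ⊗[k] (A ⊗[k] Y) ≃ₗ[k] (A ⊗[k] Y) ⊗[k] B :=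
  (TensorProduct.assoc k B A Y).symm
    ≪≫ₗ TensorProduct.congr τ.toEquiv (LinearEquiv.refl k Y)
    ≪≫ₗ TensorProduct.assoc k A B Y
    ≪≫ₗ TensorProduct.congr (LinearEquiv.refl k A) t
    ≪≫ₗ (TensorProduct.assoc k A Y B).symm

/-- The iterated twist `B ⊗ A^{⊗ (n + 1)} → A^{⊗ (n + 1)} ⊗ B`, which moves `B` past one factor
`A` after the other from left to right. -/
def iterTwist (τ : TwistingMap k A B) : ∀ n, B ⊗[k] iter k A A n ≃ₗ[k] iter k A A n ⊗[k] B
  | 0 => τ.toEquiv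
  | n + 1 => twistStep τ (iterTwist τ n)

/-- The iterated twist on the terms `A^{⊗ (n + 2)}` of the bar resolution. -/
def barTwist (τ : TwistingMap k A B) (n : ℕ) :
    B ⊗[k] (bar k A).X n ≃ₗ[k] (bar k A).X n ⊗[k] B :=
  twistStep τ (iterTwist τ n)

end IteratedTwist

section KoszulResolution

universe u

variable {k : Type*} [Field k]

section
variable {V Y : Type*} [AddCommGroup V] [Module k V] [AddCommGroup Y] [Module k Y]

/-- The subspace `R ⊗ Y` of `V ⊗ V ⊗ Y`. -/
def relFirst (R : Submodule k (V ⊗[k] V)) (Y : Type*) [AddCommGroup Y] [Module k Y] :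
    Submodule k (V ⊗[k] (V ⊗[k] Y)) :=
  LinearMap.range ((TensorProduct.assoc k V V Y).toLinearMap ∘ₗ LinearMap.rTensor Y R.subtype)

/-- The subspace `V ⊗ S` of `V ⊗ Y`. -/
def relNext (V : Type*) [AddCommGroup V] [Module k V] (S : Submodule k Y) :
    Submodule k (V ⊗[k] Y) :=
  LinearMap.range (LinearMap.lTensor V S.subtype)

theorem relFirst_map (R : Submodule k (V ⊗[k] V)) {Z : Type*} [AddCommGroup Z] [Module k Z]
    (f : Y →ₗ[k] Z) {x : V ⊗[k] (V ⊗[k] Y)} (hx : x ∈ relFirst R Y) :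
    LinearMap.lTensor V (LinearMap.lTensor V f) x ∈ relFirst R Z := by
  obtain ⟨w, rfl⟩ := hx
  refine ⟨LinearMap.lTensor R f w, ?_⟩
  induction w using TensorProduct.induction_on with
  | zero => simp only [map_zero]
  | add x y hx hy => simp only [map_add, hx, hy]
  | tmul r y =>
    simp only [LinearMap.comp_apply, LinearEquiv.coe_coe, LinearMap.lTensor_tmul,
      LinearMap.rTensor_tmul]
    induction R.subtype r using TensorProduct.induction_on with
    | zero => simp only [map_zero, TensorProduct.zero_tmul]
    | add x y hx hy => simp only [map_add, TensorProduct.add_tmul, hx, hy]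
    | tmul v v' => simp

theorem relNext_map {Z : Type*} [AddCommGroup Z] [Module k Z] {S : Submodule k Y}
    {T : Submodule k Z} (f : Y →ₗ[k] Z) (h : ∀ y ∈ S, f y ∈ T) {x : V ⊗[k] Y}
    (hx : x ∈ relNext V S) : LinearMap.lTensor V f x ∈ relNext V T := by
  obtain ⟨w, rfl⟩ := hx
  refine ⟨LinearMap.lTensor V (f.restrict h) w, ?_⟩
  rw [← LinearMap.comp_apply, ← LinearMap.comp_apply, ← LinearMap.lTensor_comp,
    ← LinearMap.lTensor_comp]
  rfl

theorem iInf_relNext_le {ι : Type*} (S : ι → Submodule k Y) :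
    ⨅ i, relNext V (S i) ≤ relNext V (⨅ i, S i) := by
  classical
  intro x hx
  rw [Submodule.mem_iInf] at hx
  let b := Module.Basis.ofVectorSpace k V
  let e := TensorProduct.equivFinsuppOfBasisLeft b (N := Y)
  have hc : ∀ j, e x j ∈ ⨅ i, S i := by
    intro j
    rw [Submodule.mem_iInf]
    intro i
    obtain ⟨w, rfl⟩ := hx i
    clear hx
    induction w using TensorProduct.induction_on with
    | zero => simp only [map_zero]; exact (S i).zero_mem
    | add x y hx hy => simp only [map_add]; exact (S i).add_mem hx hy
    | tmul v s =>
      simp only [LinearMap.lTensor_tmul, e, TensorProduct.equivFinsuppOfBasisLeft_apply_tmul_apply]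
      exact (S i).smul_mem _ s.2
  rw [← e.symm_apply_apply x, TensorProduct.equivFinsuppOfBasisLeft_symm_apply]
  exact Submodule.sum_mem _ fun j _ => ⟨b j ⊗ₜ ⟨e x j, hc j⟩, rfl⟩

theorem lTensor_subtype_injective (V : Type*) [AddCommGroup V] [Module k V] (S : Submodule k Y) :
    Function.Injective (LinearMap.lTensor V S.subtype) :=
  Module.Flat.lTensor_preserves_injective_linearMap _ S.injective_subtype

/-- The inclusion of a subspace `K` of `V ⊗ S ⊆ V ⊗ Y` into `V ⊗ S`. -/
def intoTensor {K : Submodule k (V ⊗[k] Y)} {S : Submodule k Y} (h : K ≤ relNext V S) :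
    K →ₗ[k] V ⊗[k] S :=
  (LinearEquiv.ofInjective _ (lTensor_subtype_injective V S)).symm.toLinearMap
    ∘ₗ Submodule.inclusion h

theorem lTensor_intoTensor {K : Submodule k (V ⊗[k] Y)} {S : Submodule k Y}
    (h : K ≤ relNext V S) (x : K) : LinearMap.lTensor V S.subtype (intoTensor h x) = x :=
  congrArg Subtype.val ((LinearEquiv.ofInjective _ (lTensor_subtype_injective V S)).apply_symm_apply
    (Submodule.inclusion h x))

/-- The map `a ⊗ (v ⊗ y) ↦ a v ⊗ y`. -/
def mulFirst {A : Type*} [Ring A] [Algebra k A] (i : V →ₗ[k] A) (Y : Type*) [AddCommGroup Y]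
    [Module k Y] : A ⊗[k] (V ⊗[k] Y) →ₗ[k] A ⊗[k] Y :=
  LinearMap.rTensor Y (LinearMap.mul' k A ∘ₗ LinearMap.lTensor A i)
    ∘ₗ (TensorProduct.assoc k A V Y).symm.toLinearMap

theorem mulFirst_left {A : Type*} [Ring A] [Algebra k A] (i : V →ₗ[k] A) (a b : A)
    (z : V ⊗[k] Y) : mulFirst i Y ((a * b) ⊗ₜ z) =
      LinearMap.rTensor Y (LinearMap.mulLeft k a) (mulFirst i Y (b ⊗ₜ z)) := by
  induction z using TensorProduct.induction_on with
  | zero => simp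
  | tmul v y => simp [mulFirst, mul_assoc]
  | add x y hx hy => simp only [map_add, TensorProduct.tmul_add, hx, hy]

theorem mulFirst_right {A : Type*} [Ring A] [Algebra k A] (i : V →ₗ[k] A) {Z : Type*}
    [AddCommGroup Z] [Module k Z] (f : Y →ₗ[k] Z) (a : A) (z : V ⊗[k] Y) :
    mulFirst i Z (a ⊗ₜ LinearMap.lTensor V f z) =
      LinearMap.lTensor A f (mulFirst i Y (a ⊗ₜ z)) := by
  induction z using TensorProduct.induction_on with
  | zero => simp
  | tmul v y => simp [mulFirst]
  | add x y hx hy => simp only [map_add, TensorProduct.tmul_add, hx, hy]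

end

section
variable {V : Type u} [AddCommGroup V] [Module k V] (R : Submodule k (V ⊗[k] V))
  (X : Type u) [AddCommGroup X] [Module k X]

/-- The subspace `V^{⊗ i} ⊗ R ⊗ V^{⊗ (n - 2 - i)} ⊗ X` of `V^{⊗ n} ⊗ X` for `i + 2 ≤ n`, and the
whole space for other `i`. -/
def relAt : ∀ n, ℕ → Submodule k (iter k V X n)
  | 0, _ => ⊤
  | 1, _ => ⊤
  | n + 2, 0 => relFirst R (iter k V X n)
  | n + 2, i + 1 => relNext V (relAt (n + 1) i)

/-- The subspace `K n ⊗ X = ⋂ i, V^{⊗ i} ⊗ R ⊗ V^{⊗ (n - 2 - i)} ⊗ X` of `V^{⊗ n} ⊗ X`, where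
`K n = ⋂ i, V^{⊗ i} ⊗ R ⊗ V^{⊗ (n - 2 - i)}`. -/
def kosSpace (n : ℕ) : Submodule k (iter k V X n) := ⨅ i, relAt R X n i

theorem mem_kosSpace {n : ℕ} {x : iter k V X n} :
    x ∈ kosSpace R X n ↔ ∀ i, x ∈ relAt R X n i := Submodule.mem_iInf _

theorem relAt_succ_le : ∀ n i, relAt R X (n + 1) (i + 1) ≤ relNext V (relAt R X n i)
  | 0, _ => fun x _ => ⟨LinearMap.lTensor V (LinearMap.codRestrict ⊤ LinearMap.id fun _ => trivial) x,
      (LinearMap.congr_fun (LinearMap.lTensor_comp V _ _) x).symm.trans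
        (LinearMap.congr_fun (LinearMap.lTensor_id V _) x)⟩
  | _ + 1, _ => le_rfl

theorem kosSpace_succ_le (n : ℕ) : kosSpace R X (n + 1) ≤ relNext V (kosSpace R X n) :=
  (le_iInf fun i => (iInf_le (relAt R X (n + 1)) (i + 1)).trans (relAt_succ_le R X n i)).trans
    (iInf_relNext_le (V := V) (relAt R X n))

/-- The inclusion `K (n + 1) ⊗ X → V ⊗ K n ⊗ X`. -/
def kosHead (n : ℕ) : kosSpace R X (n + 1) →ₗ[k] V ⊗[k] kosSpace R X n :=
  intoTensor (kosSpace_succ_le R X n)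

variable {A : Type u} [Ring A] [Algebra k A] (i : V →ₗ[k] A)

/-- The map `A ⊗ K (n + 1) ⊗ X → A ⊗ K n ⊗ X`,
`a ⊗ v₁ ⊗ ⋯ ⊗ vₙ₊₁ ⊗ x ↦ a v₁ ⊗ v₂ ⊗ ⋯ ⊗ vₙ₊₁ ⊗ x`. -/
def kosLeft (n : ℕ) : A ⊗[k] kosSpace R X (n + 1) →ₗ[k] A ⊗[k] kosSpace R X n :=
  mulFirst i (kosSpace R X n) ∘ₗ LinearMap.lTensor A (kosHead R X n)

/-- The map `V^{⊗ (n + 1)} ⊗ A → V^{⊗ n} ⊗ A`,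
`v₁ ⊗ ⋯ ⊗ vₙ₊₁ ⊗ a ↦ v₁ ⊗ ⋯ ⊗ vₙ ⊗ vₙ₊₁ a`. -/
def mulLast : ∀ n, iter k V A (n + 1) →ₗ[k] iter k V A n
  | 0 => LinearMap.mul' k A ∘ₗ LinearMap.rTensor A i
  | n + 1 => LinearMap.lTensor V (mulLast n)

theorem mulLast_mem : ∀ n j (x : iter k V A (n + 1)), x ∈ relAt R A (n + 1) j →
    mulLast i n x ∈ relAt R A n j
  | 0, _, _, _ => trivial
  | 1, _, _, _ => trivial
  | _ + 2, 0, _, hx => relFirst_map R _ hx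
  | n + 2, j + 1, _, hx => relNext_map _ (mulLast_mem (n + 1) j) hx

/-- The map `K (n + 1) ⊗ A → K n ⊗ A`,
`v₁ ⊗ ⋯ ⊗ vₙ₊₁ ⊗ a ↦ v₁ ⊗ ⋯ ⊗ vₙ ⊗ vₙ₊₁ a`. -/
def kosRight (n : ℕ) : kosSpace R A (n + 1) →ₗ[k] kosSpace R A n :=
  (mulLast i n).restrict fun x hx => (mem_kosSpace R A).mpr fun j =>
    mulLast_mem R i n j x ((mem_kosSpace R A).mp hx j)

theorem iterEnd_mem (f : Module.End k X) : ∀ n j (x : iter k V X n), x ∈ relAt R X n j →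
    iterEnd V X n f x ∈ relAt R X n j
  | 0, _, _, _ => trivial
  | 1, _, _, _ => trivial
  | _ + 2, 0, _, hx => relFirst_map R _ hx
  | n + 2, j + 1, _, hx => relNext_map _ (iterEnd_mem f (n + 1) j) hx

theorem iterEnd_mem_kosSpace (f : Module.End k X) (n : ℕ) (x : iter k V X n)
    (hx : x ∈ kosSpace R X n) : iterEnd V X n f x ∈ kosSpace R X n :=
  (mem_kosSpace R X).mpr fun j => iterEnd_mem R X f n j x ((mem_kosSpace R X).mp hx j)

/-- The action of the endomorphisms of `X` on the last factor of `K n ⊗ X`. -/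
def kosEnd (n : ℕ) : Module.End k X →ₐ[k] Module.End k (kosSpace R X n) :=
  AlgHom.ofLinearMap
    { toFun := fun f => (iterEnd V X n f).restrict (iterEnd_mem_kosSpace R X f n)
      map_add' := fun f g => LinearMap.ext fun x => Subtype.ext <|
        LinearMap.congr_fun (map_add (iterEnd V X n) f g) x.1
      map_smul' := fun c f => LinearMap.ext fun x => Subtype.ext <|
        LinearMap.congr_fun (map_smul (iterEnd V X n) c f) x.1 }
    (LinearMap.ext fun x => Subtype.ext <| LinearMap.congr_fun (map_one (iterEnd V X n)) x.1)
    (fun f g => LinearMap.ext fun x => Subtype.ext <|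
      LinearMap.congr_fun (map_mul (iterEnd V X n) f g) x.1)

/-- The right action of `A` on `K n ⊗ A`. -/
def kosAct (A : Type u) [Ring A] [Algebra k A] (n : ℕ) :
    Aᵐᵒᵖ →ₐ[k] Module.End k (kosSpace R A n) :=
  (kosEnd R A n).comp (rmul k A)

theorem kosHead_right (f : Module.End k X) (n : ℕ) (x : kosSpace R X (n + 1)) :
    kosHead R X n (kosEnd R X (n + 1) f x) =
      LinearMap.lTensor V (kosEnd R X n f) (kosHead R X n x) := by
  apply lTensor_subtype_injective V (kosSpace R X n)
  refine (lTensor_intoTensor _ _).trans ?_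
  have h : LinearMap.lTensor V (kosSpace R X n).subtype
      (LinearMap.lTensor V (kosEnd R X n f) (kosHead R X n x)) =
      LinearMap.lTensor V (iterEnd V X n f)
        (LinearMap.lTensor V (kosSpace R X n).subtype (kosHead R X n x)) := by
    exact (LinearMap.congr_fun (LinearMap.lTensor_comp V (kosSpace R X n).subtype
      (kosEnd R X n f)) (kosHead R X n x)).symm.trans
      (LinearMap.congr_fun (LinearMap.lTensor_comp V (iterEnd V X n f)
        (kosSpace R X n).subtype) (kosHead R X n x))
  rw [h]
  exact congrArg _ (lTensor_intoTensor (kosSpace_succ_le R X n) x).symm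

theorem mulLast_right (s : Aᵐᵒᵖ) : ∀ (n : ℕ) (x : iter k V A (n + 1)),
    mulLast i n (iterRight k V A (n + 1) s x) = iterRight k V A n s (mulLast i n x)
  | 0, x => by
    have h : (LinearMap.mul' k A ∘ₗ LinearMap.rTensor A i) ∘ₗ LinearMap.lTensor V (rmul k A s) =
        rmul k A s ∘ₗ (LinearMap.mul' k A ∘ₗ LinearMap.rTensor A i) := by
      ext v a
      simp [mul_assoc]
    exact LinearMap.congr_fun h x
  | n + 1, x => by
    have h : mulLast i n ∘ₗ iterRight k V A (n + 1) s = iterRight k V A n s ∘ₗ mulLast i n :=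
      LinearMap.ext (mulLast_right s n)
    have h' := congrArg (LinearMap.lTensor V) h
    rw [LinearMap.lTensor_comp, LinearMap.lTensor_comp] at h'
    exact LinearMap.congr_fun h' x

/-- The differential `A ⊗ K (n + 1) ⊗ A → A ⊗ K n ⊗ A`,
`a ⊗ v₁ ⊗ ⋯ ⊗ vₙ₊₁ ⊗ b ↦ a v₁ ⊗ ⋯ ⊗ vₙ₊₁ ⊗ b + (-1)^(n + 1) a ⊗ v₁ ⊗ ⋯ ⊗ vₙ₊₁ b`. -/
def kosD (n : ℕ) : A ⊗[k] kosSpace R A (n + 1) →ₗ[k] A ⊗[k] kosSpace R A n :=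
  kosLeft R A i n + (-1 : ℤ) ^ (n + 1) • LinearMap.lTensor A (kosRight R i n)

theorem kosD_smul (n : ℕ) (a b : A) (s : Aᵐᵒᵖ) (x : kosSpace R A (n + 1)) :
    kosD R i n ((a * b) ⊗ₜ kosAct R A (n + 1) s x) =
      LinearMap.rTensor _ (LinearMap.mulLeft k a)
        (LinearMap.lTensor A (kosAct R A n s) (kosD R i n (b ⊗ₜ x))) := by
  have h₁ : kosLeft R A i n ((a * b) ⊗ₜ kosAct R A (n + 1) s x) =
      LinearMap.rTensor _ (LinearMap.mulLeft k a)
        (LinearMap.lTensor A (kosAct R A n s) (kosLeft R A i n (b ⊗ₜ x))) := by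
    refine (mulFirst_left i a b _).trans (congrArg _ ?_)
    refine Eq.trans ?_ (mulFirst_right i (kosAct R A n s) b (kosHead R A n x))
    exact congrArg (fun z => mulFirst i _ (b ⊗ₜ z)) (kosHead_right R A (rmul k A s) n x)
  have h₂ : kosRight R i n (kosAct R A (n + 1) s x) = kosAct R A n s (kosRight R i n x) :=
    Subtype.ext (mulLast_right i s n x.1)
  simp only [kosD, LinearMap.add_apply, LinearMap.smul_apply, map_add, map_zsmul, h₁,
    LinearMap.lTensor_tmul, LinearMap.rTensor_tmul, h₂, LinearMap.mulLeft_apply]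

/-- The augmentation `A ⊗ K 0 ⊗ A = A ⊗ A → A`, `a ⊗ b ↦ a b`. -/
def kosε (A : Type u) [Ring A] [Algebra k A] : A ⊗[k] kosSpace R A 0 →ₗ[k] A :=
  LinearMap.mul' k A ∘ₗ LinearMap.lTensor A (kosSpace R A 0).subtype

theorem kosε_smul (a b : A) (s : Aᵐᵒᵖ) (x : kosSpace R A 0) :
    kosε R A ((a * b) ⊗ₜ kosAct R A 0 s x) = a * kosε R A (b ⊗ₜ x) * s.unop :=
  mul'_sandwich (k := k) a b s x.1

/-- The sequence of bimodules `A ⊗ K n ⊗ A` with the differentials `kosD`, for a linear map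
`i : V → A` and a subspace `R` of `V ⊗ V`. -/
def koszulSequence : AugmentedSequence k A where
  X n := A ⊗[k] kosSpace R A n
  addCommGroup _ := inferInstance
  module _ := inferInstance
  bimodule n := inducedBimodule (kosAct R A n)
  tower n := inducedBimodule_tower (kosAct R A n)
  d n := inducedHom (kosAct R A (n + 1)) (kosAct R A n) (kosD R i n) (kosD_smul R i n)
  ε := kosε R A
  ε_smul := inducedε (kosAct R A 0) (kosε R A) (kosε_smul R)

/-- The map `A ⊗ K n ⊗ A → A ⊗ A^{⊗ n} ⊗ A` given by `K n ⊆ V^{⊗ n}` and `i : V → A`. -/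
def koszulToBar (n : ℕ) : (koszulSequence R i).X n →ₗ[k] (bar k A).X n :=
  LinearMap.lTensor A (iterMap A i n ∘ₗ (kosSpace R A n).subtype)

end

section
variable {A : Type u} [Ring A] [Algebra k A] (𝒜 : ℕ → Submodule k A)

/-- The space of quadratic relations: the kernel of the multiplication `A₁ ⊗ A₁ → A`. -/
def relations : Submodule k (𝒜 1 ⊗[k] 𝒜 1) :=
  LinearMap.ker (LinearMap.mul' k A ∘ₗ TensorProduct.map (𝒜 1).subtype (𝒜 1).subtype)

/-- The bimodule Koszul complex `A ⊗ K n ⊗ A` of the graded algebra `A`, with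
`K n = ⋂ i, V^{⊗ i} ⊗ R ⊗ V^{⊗ (n - 2 - i)}` for `V = A₁` and `R` the space of quadratic
relations. -/
def koszul : AugmentedSequence k A := koszulSequence (relations 𝒜) (𝒜 1).subtype

/-- The embedding of the Koszul complex into the bar resolution. -/
def koszulEmbedding (n : ℕ) : (koszul 𝒜).X n →ₗ[k] (bar k A).X n :=
  koszulToBar (relations 𝒜) (𝒜 1).subtype n

/-- The augmentation `A ⊗ A₀ → A₀ ⊆ A`, `a ⊗ c ↦ a₀ c`, of the left Koszul complex. -/
def koszulAugmentation [GradedAlgebra 𝒜] : A ⊗[k] kosSpace (relations 𝒜) (𝒜 0) 0 →ₗ[k] A :=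
  LinearMap.mul' k A ∘ₗ TensorProduct.map (GradedAlgebra.proj 𝒜 0)
    ((𝒜 0).subtype ∘ₗ (kosSpace (relations 𝒜) (𝒜 0) 0).subtype)

/-- A graded algebra `A` is Koszul if it is connected, `A₀ = k`, and the left Koszul complex
`⋯ → A ⊗ K 2 → A ⊗ K 1 → A → k → 0` is exact. (The complex is written as
`A ⊗ K n ⊗ A₀`, with `A₀ = k`.) Exactness in the last two degrees says that `A` is generated by
`A₁` with quadratic relations. -/
structure IsKoszul [GradedAlgebra 𝒜] : Prop where
  nontrivial : Nontrivial A
  connected : 𝒜 0 = 1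
  exact_succ : ∀ n, Function.Exact (kosLeft (relations 𝒜) (𝒜 0) (𝒜 1).subtype (n + 1))
    (kosLeft (relations 𝒜) (𝒜 0) (𝒜 1).subtype n)
  exact_zero : Function.Exact (kosLeft (relations 𝒜) (𝒜 0) (𝒜 1).subtype 0)
    (koszulAugmentation 𝒜)

end

end KoszulResolution

section Twists

universe u v

variable {k : Type*} [Field k] {A : Type u} [Ring A] [Algebra k A] {B : Type v} [Ring B]
  [Algebra k B]

/-- A twisting map is strongly graded if it takes `B_j ⊗ A_i` into `A_i ⊗ B_j` for all `i, j`. -/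
def TwistingMap.StronglyGraded (τ : TwistingMap k A B) (𝒜 : ℕ → Submodule k A)
    (ℬ : ℕ → Submodule k B) : Prop :=
  ∀ i j, ∀ a ∈ 𝒜 i, ∀ b ∈ ℬ j, τ.toEquiv (b ⊗ₜ a) ∈
    LinearMap.range (TensorProduct.map (𝒜 i).subtype (ℬ j).subtype)

/-- The bar resolution is twisted by iterations of `τ`. -/
def IsBarTwist {τ : TwistingMap k A B} (c : CompatibleTwist τ (bar k A)) : Prop :=
  ∀ n, (c.tw n).toEquiv = barTwist τ n

/-- The reduced bar resolution is twisted by the maps induced by iterations of `τ` on the quotient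
of the bar resolution. -/
def IsReducedBarTwist {τ : TwistingMap k A B} (c : CompatibleTwist τ (reducedBar k A)) : Prop :=
  ∀ n, (c.tw n).toEquiv.toLinearMap ∘ₗ LinearMap.lTensor B (barToReduced k A n) =
    LinearMap.rTensor B (barToReduced k A n) ∘ₗ (barTwist τ n).toLinearMap

/-- The Koszul resolution is twisted by the restriction of iterations of `τ` under its embedding
into the bar resolution. -/
def IsKoszulTwist {τ : TwistingMap k A B} {𝒜 : ℕ → Submodule k A}
    (c : CompatibleTwist τ (koszul 𝒜)) : Prop :=
  ∀ n, LinearMap.rTensor B (koszulEmbedding 𝒜 n) ∘ₗ (c.tw n).toEquiv.toLinearMap =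
    (barTwist τ n).toLinearMap ∘ₗ LinearMap.lTensor B (koszulEmbedding 𝒜 n)

/-- Twistings of `P` and `Q` that satisfy `hP` and `hQ` exist, and for all of them the twisted
product complex of `P` and `Q` is a projective resolution of the `A ⊗_τ B`-bimodule `A ⊗_τ B`. -/
def TwistedProductResolves (τ : TwistingMap k A B) (P : AugmentedSequence k A)
    (Q : AugmentedSequence k B) (hP : CompatibleTwist τ P → Prop)
    (hQ : CompatibleTwist τ.symm Q → Prop) : Prop :=
  (∃ c, hP c) ∧ (∃ c', hQ c') ∧
    ∀ c c', hP c → hQ c' → (twistedProduct c c').IsProjectiveResolution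

end Twists

end TwistedProduct

end

/-! The twisting enters only the module structure of the twisted product complex. As a complex of
vector spaces it is the ordinary tensor product of `P` and `Q` over `k`, so its exactness is a
Künneth statement. Over a field an exact augmented complex has a `k`-linear contraction. If `s` and
`s'` contract `P` and `Q`, and `η` is the chosen section of the augmentation of `P`, then `s ⊗ 1`,
corrected by `ηε ⊗ s'` in column zero, contracts the product (`twistedProduct_isExact`).

Projectivity rests on generators past which the other algebra can be moved. Each term of the
complexes in question is `A ⊗ U ⊗ A` for a space `U` with its own bijection `B ⊗ U → U ⊗ B` matching
the twist (`TwistBasis`), and similarly `B ⊗ W ⊗ B` over `B`. Acting on `U ⊗ W` with the enveloping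
algebra of `A ⊗_τ B` means moving `B` past `U` and `A` past `W`, then `B` past `A`, and finally
forming the products. Every one of these steps is bijective, so `P i ⊗ Q j` is a free bimodule on `U
⊗ W` (`twistedBimodule_projective`).

The twists are handled by a small calculus of maps that commute with moving `B` (`Intertwines`) and
of subspaces preserved by the move (`Stable`). The basic intertwiner is the multiplication of `A`,
by the axiom of a twisting map; the bar differential and the bimodule actions are built from it. For
the reduced bar resolution one uses that `k 1` is stable. For the Koszul complex, strong grading
makes `τ` commute with the projections to the graded pieces, so `A₁` is stable; then so are the
kernel `R` and the intersections `K n`, because tensoring over a field commutes with kernels and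
arbitrary intersections. Compatibility passes down along the surjection from the bar resolution, or
back along the embedding into it. The same two maps show that the twist is unique, so generators
found for one twist serve for every twist allowed in the statement.

It remains that the given complexes are exact. For the bar and reduced bar resolutions, `x ↦ 1 ⊗ x`
does this. The Koszul differential is `l + r`, where `l` multiplies into the left factor `A` and
raises its degree by one, while `r` preserves that degree. The leading component of a cycle is
therefore a cycle for `l`, and exactness of the left Koszul complex, tensored with `A` on the right,
lets one remove leading components one by one (`mem_range_of_leading`, `koszul_isExact`). Everything
for `B` is the same with `τ.symm`. -/

noncomputable section

namespace TwistedProduct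

/-! ### Exact complexes over a field are contractible. -/

section Contractions

variable {k R : Type*} [Field k] [Ring R] [Algebra k R]

/-- The augmented sequence is exact. -/
structure AugmentedSequence.IsExact (P : AugmentedSequence k R) : Prop where
  exact_succ : ∀ n, Function.Exact (P.d (n + 1)) (P.d n)
  exact_zero : Function.Exact (P.d 0) P.ε
  surjective : Function.Surjective P.ε

/-- A `k`-linear contracting homotopy of an augmented sequence. -/
structure Contraction (P : AugmentedSequence k R) where
  s : ∀ n, P.X n →ₗ[k] P.X (n + 1)
  η : R →ₗ[k] P.X 0
  ε_η : ∀ r, P.ε (η r) = r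
  zero : ∀ x, P.dₖ 0 (s 0 x) + η (P.ε x) = x
  succ : ∀ n x, P.dₖ (n + 1) (s (n + 1) x) + s n (P.dₖ n x) = x

/-- Vector spaces are projective, so `f` lifts through `g` corestricted to its range. -/
theorem exists_comp_eq {L M N : Type*} [AddCommGroup L] [Module k L] [AddCommGroup M] [Module k M]
    [AddCommGroup N] [Module k N] (g : L →ₗ[k] N) (f : M →ₗ[k] N) (h : ∀ x, ∃ y, g y = f x) :
    ∃ s : M →ₗ[k] L, ∀ x, g (s x) = f x := by
  obtain ⟨s, hs⟩ := Module.projective_lifting_property g.rangeRestrict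
    (f.codRestrict (LinearMap.range g) h) g.surjective_rangeRestrict
  exact ⟨s, fun x => congrArg Subtype.val (LinearMap.congr_fun hs x)⟩

/-- The next homotopy is a lift of `1 - s d` through the differential. This map has values in the
cycles precisely when `d s d = d`. The new homotopy `s'` has the same property, since `d s' d = d -
s d d = d`. -/
theorem AugmentedSequence.IsExact.exists_contraction {P : AugmentedSequence k R} (h : P.IsExact) :
    Nonempty (Contraction P) := by
  obtain ⟨η, hη⟩ := exists_comp_eq P.ε LinearMap.id h.surjective
  have h₀ : ∃ s : P.X 0 →ₗ[k] P.X 1, ∀ x, P.dₖ 0 (s x) = x - η (P.ε x) := by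
    refine exists_comp_eq (P.dₖ 0) (LinearMap.id - η ∘ₗ P.ε) fun x => ?_
    refine (h.exact_zero _).mp ?_
    simp [show P.ε (η (P.ε x)) = P.ε x from hη _]
  have h₁ : ∀ (n : ℕ) (s : P.X n →ₗ[k] P.X (n + 1)),
      (∀ x, P.dₖ n (s (P.dₖ n x)) = P.dₖ n x) →
      ∃ s' : P.X (n + 1) →ₗ[k] P.X (n + 2), ∀ x, P.dₖ (n + 1) (s' x) = x - s (P.dₖ n x) := by
    intro n s hs
    refine exists_comp_eq (P.dₖ (n + 1)) (LinearMap.id - s ∘ₗ P.dₖ n) fun x => ?_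
    refine (h.exact_succ n _).mp ?_
    change P.dₖ n (x - s (P.dₖ n x)) = 0
    rw [map_sub, hs, sub_self]
  obtain ⟨s₀, hs₀⟩ := h₀
  choose g hg using h₁
  have hd : ∀ n x, P.dₖ n (P.dₖ (n + 1) x) = 0 := fun n => (h.exact_succ n).apply_apply_eq_zero
  -- The homotopies are chosen together with the identity `d s d = d` that makes the next choice
  -- possible.
  let T : ∀ n, {s : P.X n →ₗ[k] P.X (n + 1) // ∀ x, P.dₖ n (s (P.dₖ n x)) = P.dₖ n x} :=
    fun n => Nat.rec ⟨s₀, fun x => by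
        rw [hs₀, show P.ε (P.dₖ 0 x) = 0 from h.exact_zero.apply_apply_eq_zero x, map_zero,
          sub_zero]⟩
      (fun n s => ⟨g n s.1 s.2, fun x => by rw [hg, hd, map_zero, sub_zero]⟩) n
  refine ⟨⟨fun n => (T n).1, η, hη, fun x => ?_, fun n x => ?_⟩⟩
  · exact (congrArg (· + _) (hs₀ x)).trans (sub_add_cancel _ _)
  · exact (congrArg (· + _) (hg n (T n).1 (T n).2 x)).trans (sub_add_cancel _ _)

end Contractions

/-! ### Exactness of the twisted product complex. -/

section TotalComplex

/-- The general formula for the differential, used in column one, produces the sign with this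
exponent. -/
theorem neg_one_pow_zero_add_one : (-1 : ℤ) ^ (0 + 1) = -1 := rfl

variable {k A B : Type*} [Field k] [Ring A] [Algebra k A] [Ring B] [Algebra k B]
  {τ : TwistingMap k A B} {P : AugmentedSequence k A} {Q : AugmentedSequence k B}
  (c : CompatibleTwist τ P) (c' : CompatibleTwist τ.symm Q)

/-- The inclusion of `P i ⊗ Q j` into the total complex. -/
def totalInc (n i j : ℕ) (h : i + j = n) : P.X i ⊗[k] Q.X j →ₗ[k] totalX c c' n :=
  DirectSum.lof k {p : ℕ × ℕ // p.1 + p.2 = n} (fun p => bicomplexX c c' p.1.1 p.1.2) ⟨(i, j), h⟩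
    ∘ₗ (TwistedBimodule.of (c.tw i) (c'.tw j)).toLinearMap

theorem totalX_induction {n : ℕ} {p : totalX c c' n → Prop} (zero : p 0)
    (add : ∀ x y, p x → p y → p (x + y))
    (inc : ∀ i j h x y, p (totalInc c c' n i j h (x ⊗ₜ y))) (z : totalX c c' n) : p z := by
  induction z using DirectSum.induction_on with
  | zero => exact zero
  | add x y hx hy => exact add x y hx hy
  | of q w =>
    obtain ⟨⟨i, j⟩, h⟩ := q
    have : ∀ w : P.X i ⊗[k] Q.X j, p (totalInc c c' n i j h w) := by
      intro w
      induction w using TensorProduct.induction_on with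
      | zero => rw [map_zero]; exact zero
      | tmul x y => exact inc i j h x y
      | add x y hx hy => rw [map_add]; exact add _ _ hx hy
    exact this w

theorem totalD_of (n : ℕ) (p : {p : ℕ × ℕ // p.1 + p.2 = n + 1})
    (w : bicomplexX c c' p.1.1 p.1.2) :
    totalD c c' n (DirectSum.of (fun p : {p : ℕ × ℕ // p.1 + p.2 = n + 1} =>
      bicomplexX c c' p.1.1 p.1.2) p w) = horizontalD c c' n p.1.1 p.1.2 p.2 w +
        (-1 : ℤ) ^ p.1.1 • verticalD c c' n p.1.1 p.1.2 p.2 w := by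
  rw [totalD, ← DirectSum.lof_eq_of (TwistedTensor τ ⊗[k] (TwistedTensor τ)ᵐᵒᵖ),
    DirectSum.toModule_lof]
  rfl

theorem totalD_inc (n i j : ℕ) (h : i + j = n + 1) (w : P.X i ⊗[k] Q.X j) :
    totalD c c' n (totalInc c c' (n + 1) i j h w) =
      horizontalD c c' n i j h (TwistedBimodule.of _ _ w) +
        (-1 : ℤ) ^ i • verticalD c c' n i j h (TwistedBimodule.of _ _ w) :=
  totalD_of c c' n ⟨(i, j), h⟩ _

/-- The differential is defined by cases on vanishing indices. It has one formula on each edge of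
the first quadrant, and one in the interior. -/
theorem totalD_inc_zero_succ (n j : ℕ) (h : 0 + (j + 1) = n + 1) (x : P.X 0) (y : Q.X (j + 1)) :
    totalD c c' n (totalInc c c' (n + 1) 0 (j + 1) h (x ⊗ₜ y)) =
      totalInc c c' n 0 j (by omega) (x ⊗ₜ Q.dₖ j y) := by
  rw [totalD_inc, pow_zero, one_smul]
  exact zero_add _

theorem totalD_inc_succ_zero (n i : ℕ) (h : (i + 1) + 0 = n + 1) (x : P.X (i + 1)) (y : Q.X 0) :
    totalD c c' n (totalInc c c' (n + 1) (i + 1) 0 h (x ⊗ₜ y)) =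
      totalInc c c' n i 0 (by omega) (P.dₖ i x ⊗ₜ y) := by
  rw [totalD_inc]
  exact (congrArg _ (smul_zero _)).trans (add_zero _)

theorem totalD_inc_succ_succ (n i j : ℕ) (h : (i + 1) + (j + 1) = n + 1) (x : P.X (i + 1))
    (y : Q.X (j + 1)) :
    totalD c c' n (totalInc c c' (n + 1) (i + 1) (j + 1) h (x ⊗ₜ y)) =
      totalInc c c' n i (j + 1) (by omega) (P.dₖ i x ⊗ₜ y) +
        (-1 : ℤ) ^ (i + 1) • totalInc c c' n (i + 1) j (by omega) (x ⊗ₜ Q.dₖ j y) := by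
  rw [totalD_inc]
  rfl

theorem totalε_inc (x : P.X 0) (y : Q.X 0) :
    totalε c c' (totalInc c c' 0 0 0 rfl (x ⊗ₜ y)) = TwistedTensor.of τ (P.ε x ⊗ₜ Q.ε y) :=
  totalε_of c c' ⟨(0, 0), rfl⟩ (TwistedBimodule.of (c.tw 0) (c'.tw 0) (x ⊗ₜ y))

variable (hP : Contraction P) (hQ : Contraction Q)

/-- The components `s ⊗ 1 + η ε ⊗ s'` of the contracting homotopy of the total complex. -/
def homotopyComponent (n : ℕ) :
    ∀ i j : ℕ, i + j = n → (P.X i ⊗[k] Q.X j →ₗ[k] totalX c c' (n + 1))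
  | 0, j, h => totalInc c c' (n + 1) 1 j (by omega) ∘ₗ LinearMap.rTensor _ (hP.s 0) +
      totalInc c c' (n + 1) 0 (j + 1) (by omega) ∘ₗ TensorProduct.map (hP.η ∘ₗ P.ε) (hQ.s j)
  | i + 1, j, h => totalInc c c' (n + 1) (i + 2) j (by omega) ∘ₗ LinearMap.rTensor _ (hP.s (i + 1))

/-- The contracting homotopy of the total complex. -/
def totalHomotopy (n : ℕ) : totalX c c' n →ₗ[k] totalX c c' (n + 1) :=
  DirectSum.toModule k _ _ fun p => homotopyComponent c c' hP hQ n p.1.1 p.1.2 p.2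
    ∘ₗ (TwistedBimodule.of (c.tw p.1.1) (c'.tw p.1.2)).symm.toLinearMap

theorem totalHomotopy_of (n : ℕ) (p : {p : ℕ × ℕ // p.1 + p.2 = n})
    (w : P.X p.1.1 ⊗[k] Q.X p.1.2) :
    totalHomotopy c c' hP hQ n (DirectSum.lof k _ (fun p : {p : ℕ × ℕ // p.1 + p.2 = n} =>
      bicomplexX c c' p.1.1 p.1.2) p (TwistedBimodule.of _ _ w)) =
      homotopyComponent c c' hP hQ n p.1.1 p.1.2 p.2 w := by
  rw [totalHomotopy, DirectSum.toModule_lof]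
  rfl

theorem totalHomotopy_inc (n i j : ℕ) (h : i + j = n) (w : P.X i ⊗[k] Q.X j) :
    totalHomotopy c c' hP hQ n (totalInc c c' n i j h w) =
      homotopyComponent c c' hP hQ n i j h w :=
  totalHomotopy_of c c' hP hQ n ⟨(i, j), h⟩ w

theorem totalHomotopy_inc_zero (n j : ℕ) (h : 0 + j = n) (x : P.X 0) (y : Q.X j) :
    totalHomotopy c c' hP hQ n (totalInc c c' n 0 j h (x ⊗ₜ y)) =
      totalInc c c' (n + 1) 1 j (by omega) (hP.s 0 x ⊗ₜ y) +
        totalInc c c' (n + 1) 0 (j + 1) (by omega) (hP.η (P.ε x) ⊗ₜ hQ.s j y) :=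
  totalHomotopy_inc c c' hP hQ n 0 j h _

theorem totalHomotopy_inc_succ (n i j : ℕ) (h : (i + 1) + j = n) (x : P.X (i + 1)) (y : Q.X j) :
    totalHomotopy c c' hP hQ n (totalInc c c' n (i + 1) j h (x ⊗ₜ y)) =
      totalInc c c' (n + 1) (i + 2) j (by omega) (hP.s (i + 1) x ⊗ₜ y) :=
  totalHomotopy_inc c c' hP hQ n (i + 1) j h _

/-- The three terms `d s ⊗ 1`, `ηε ⊗ d s'` and `ηε ⊗ η'ε'` telescope: the last two add up to `ηε ⊗
1`, which is what `d s ⊗ 1` lacks. -/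
theorem totalHomotopy_zero (z : totalX c c' 0) :
    totalD c c' 0 (totalHomotopy c c' hP hQ 0 z) +
      totalInc c c' 0 0 0 rfl (TensorProduct.map hP.η hQ.η
        ((TwistedTensor.of τ).symm (totalε c c' z))) = z := by
  induction z using totalX_induction with
  | zero => simp only [map_zero, add_zero]
  | add x y hx hy =>
    simp only [map_add]
    rw [add_add_add_comm, hx, hy]
  | inc i j h x y =>
    obtain ⟨rfl, rfl⟩ : i = 0 ∧ j = 0 := by omega
    rw [totalHomotopy_inc_zero, map_add, totalD_inc_succ_zero, totalD_inc_zero_succ, totalε_inc,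
      LinearEquiv.symm_apply_apply, TensorProduct.map_tmul, add_assoc, ← map_add,
      ← TensorProduct.tmul_add, hQ.zero, ← map_add, ← TensorProduct.add_tmul, hP.zero]

/-- The two terms containing `s ⊗ d` have opposite signs, because `s` shifts the column by one, and
the horizontal terms give `d s + s d = 1`. In column zero only `1 - ηε` is obtained, and the
correction `ηε ⊗ s'` supplies the missing part by `d s' + s' d = 1`. -/
theorem totalHomotopy_succ (hP' : P.IsExact) (n : ℕ) (z : totalX c c' (n + 1)) :
    totalD c c' (n + 1) (totalHomotopy c c' hP hQ (n + 1) z) +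
      totalHomotopy c c' hP hQ n (totalD c c' n z) = z := by
  have hε : ∀ x, P.ε (P.dₖ 0 x) = 0 := hP'.exact_zero.apply_apply_eq_zero
  induction z using totalX_induction with
  | zero => simp only [map_zero, add_zero]
  | add x y hx hy =>
    simp only [map_add]
    rw [add_add_add_comm, hx, hy]
  | inc i j h x y =>
    match i, j, h with
    | 0, j + 1, h =>
      rw [totalHomotopy_inc_zero, map_add, totalD_inc_succ_succ, totalD_inc_zero_succ,
        totalD_inc_zero_succ, totalHomotopy_inc_zero, neg_one_pow_zero_add_one, neg_one_smul,
        add_add_add_comm, neg_add_cancel_right, ← map_add, ← TensorProduct.tmul_add,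
          hQ.succ, ← map_add, ← TensorProduct.add_tmul, hP.zero]
    -- Column one is separate: its horizontal differential lands in column zero, where the homotopy
    -- has its extra term; that term vanishes by `ε d = 0`.
    | 1, 0, h =>
      rw [totalHomotopy_inc_succ, totalD_inc_succ_zero, totalD_inc_succ_zero,
        totalHomotopy_inc_zero, hε, map_zero, TensorProduct.zero_tmul, map_zero,
        add_zero (totalInc _ _ _ _ _ _ _), ← map_add, ← TensorProduct.add_tmul, hP.succ]
    | i + 2, 0, h =>
      rw [totalHomotopy_inc_succ, totalD_inc_succ_zero, totalD_inc_succ_zero,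
        totalHomotopy_inc_succ, ← map_add, ← TensorProduct.add_tmul, hP.succ]
    | 1, j + 1, h =>
      rw [totalHomotopy_inc_succ, totalD_inc_succ_succ, totalD_inc_succ_succ, map_add, map_zsmul,
        totalHomotopy_inc_zero, totalHomotopy_inc_succ, hε, map_zero, TensorProduct.zero_tmul,
        map_zero, add_zero (totalInc _ _ _ _ _ _ _), pow_succ _ (0 + 1), mul_neg_one, neg_smul,
          add_add_add_comm,
        neg_add_cancel, add_zero, ← map_add, ← TensorProduct.add_tmul, hP.succ]
    | i + 2, j + 1, h =>
      rw [totalHomotopy_inc_succ, totalD_inc_succ_succ, totalD_inc_succ_succ, map_add, map_zsmul,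
        totalHomotopy_inc_succ, totalHomotopy_inc_succ, pow_succ _ (i + 2), pow_succ _ (i + 1),
        mul_neg_one, neg_smul,
          add_add_add_comm,
        neg_add_cancel, add_zero, ← map_add, ← TensorProduct.add_tmul, hP.succ]

theorem totalε_totalD (hP' : P.IsExact) (hQ' : Q.IsExact) (z : totalX c c' 1) :
    totalε c c' (totalD c c' 0 z) = 0 := by
  have hε : ∀ x, P.ε (P.dₖ 0 x) = 0 := hP'.exact_zero.apply_apply_eq_zero
  have hε' : ∀ x, Q.ε (Q.dₖ 0 x) = 0 := hQ'.exact_zero.apply_apply_eq_zero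
  induction z using totalX_induction with
  | zero => simp only [map_zero]
  | add x y hx hy => rw [map_add, map_add, hx, hy, add_zero]
  | inc i j h x y =>
    obtain ⟨rfl, rfl⟩ | ⟨rfl, rfl⟩ : (i = 0 ∧ j = 1) ∨ (i = 1 ∧ j = 0) := by omega
    · rw [totalD_inc_zero_succ, totalε_inc, hε', TensorProduct.tmul_zero, map_zero]
    · rw [totalD_inc_succ_zero, totalε_inc, hε, TensorProduct.zero_tmul, map_zero]

theorem totalD_totalD (hP' : P.IsExact) (hQ' : Q.IsExact) (n : ℕ) (z : totalX c c' (n + 2)) :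
    totalD c c' n (totalD c c' (n + 1) z) = 0 := by
  have hd : ∀ n x, P.dₖ n (P.dₖ (n + 1) x) = 0 := fun n => (hP'.exact_succ n).apply_apply_eq_zero
  have hd' : ∀ n x, Q.dₖ n (Q.dₖ (n + 1) x) = 0 := fun n => (hQ'.exact_succ n).apply_apply_eq_zero
  induction z using totalX_induction with
  | zero => simp only [map_zero]
  | add x y hx hy => rw [map_add, map_add, hx, hy, add_zero]
  | inc i j h x y =>
    match i, j, h with
    | 0, j + 2, h =>
      rw [totalD_inc_zero_succ, totalD_inc_zero_succ, hd', TensorProduct.tmul_zero, map_zero]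
    | i + 2, 0, h =>
      rw [totalD_inc_succ_zero, totalD_inc_succ_zero, hd, TensorProduct.zero_tmul, map_zero]
    | 1, 1, h =>
      rw [totalD_inc_succ_succ, map_add, map_zsmul, totalD_inc_zero_succ, totalD_inc_succ_zero,
        neg_one_pow_zero_add_one, neg_one_smul, add_neg_cancel]
    | 1, j + 2, h =>
      rw [totalD_inc_succ_succ, map_add, map_zsmul, totalD_inc_zero_succ, totalD_inc_succ_succ,
        hd', TensorProduct.tmul_zero, map_zero, smul_zero, add_zero, neg_one_pow_zero_add_one,
        neg_one_smul, add_neg_cancel]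
    | i + 2, 1, h =>
      rw [totalD_inc_succ_succ, map_add, map_zsmul, totalD_inc_succ_zero, totalD_inc_succ_succ,
        hd, TensorProduct.zero_tmul, map_zero, zero_add, pow_succ _ (i + 1), mul_neg_one, neg_smul,
        add_neg_cancel]
    | i + 2, j + 2, h =>
      rw [totalD_inc_succ_succ, map_add, map_zsmul, totalD_inc_succ_succ, totalD_inc_succ_succ,
        hd, TensorProduct.zero_tmul, map_zero, zero_add, hd', TensorProduct.tmul_zero, map_zero,
        smul_zero, add_zero, pow_succ _ (i + 1), mul_neg_one, neg_smul, add_neg_cancel]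

/-- Exactness concerns kernels and images only, so a homotopy that is merely `k`-linear suffices. -/
theorem twistedProduct_isExact (hP' : P.IsExact) (hQ' : Q.IsExact) :
    (twistedProduct c c').IsExact := by
  obtain ⟨hP⟩ := hP'.exists_contraction
  obtain ⟨hQ⟩ := hQ'.exists_contraction
  refine ⟨fun n z => ⟨fun hz => ?_, ?_⟩, fun z => ⟨fun hz => ?_, ?_⟩, fun z => ?_⟩
  · refine ⟨totalHomotopy c c' hP hQ (n + 1) z, ?_⟩
    have hz : totalD c c' n z = 0 := hz
    have := totalHomotopy_succ c c' hP hQ hP' n z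
    rwa [hz, map_zero, add_zero] at this
  · rintro ⟨y, rfl⟩
    exact totalD_totalD c c' hP' hQ' n y
  · refine ⟨totalHomotopy c c' hP hQ 0 z, ?_⟩
    have hz : totalε c c' z = 0 := hz
    have := totalHomotopy_zero c c' hP hQ z
    rwa [hz, map_zero, map_zero, map_zero, add_zero] at this
  · rintro ⟨y, rfl⟩
    exact totalε_totalD c c' hP' hQ' y
  · obtain ⟨w, hw⟩ := TensorProduct.map_surjective hP'.surjective hQ'.surjective
      ((TwistedTensor.of τ).symm z)
    refine ⟨totalInc c c' 0 0 0 rfl w, ?_⟩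
    refine (totalε_of c c' ⟨(0, 0), rfl⟩ (TwistedBimodule.of (c.tw 0) (c'.tw 0) w)).trans ?_
    exact congrArg (TwistedTensor.of τ) hw

end TotalComplex

/-! ### Maps and subspaces compatible with moving `B` from left to right. -/

section Moves

variable {k B V W X Y Z : Type*} [Field k] [AddCommGroup B] [Module k B]
  [AddCommGroup V] [Module k V] [AddCommGroup W] [Module k W] [AddCommGroup X] [Module k X]
  [AddCommGroup Y] [Module k Y] [AddCommGroup Z] [Module k Z]

/-- The map `(1 ⊗ t') (t ⊗ 1) : B ⊗ V ⊗ Y → V ⊗ B ⊗ Y → V ⊗ Y ⊗ B`. -/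
def moveStep (t : B ⊗[k] V ≃ₗ[k] V ⊗[k] B) (t' : B ⊗[k] Y ≃ₗ[k] Y ⊗[k] B) :
    B ⊗[k] (V ⊗[k] Y) ≃ₗ[k] (V ⊗[k] Y) ⊗[k] B :=
  (TensorProduct.assoc k B V Y).symm
    ≪≫ₗ TensorProduct.congr t (LinearEquiv.refl k Y)
    ≪≫ₗ TensorProduct.assoc k V B Y
    ≪≫ₗ TensorProduct.congr (LinearEquiv.refl k V) t'
    ≪≫ₗ (TensorProduct.assoc k V Y B).symm

/-- The map `V ⊗ B → V ⊗ Y ⊗ B` that moves `B` past a fixed element of `Y`. -/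
def movePast (V : Type*) [AddCommGroup V] [Module k V] (t : B ⊗[k] Y ≃ₗ[k] Y ⊗[k] B) (y : Y) :
    V ⊗[k] B →ₗ[k] (V ⊗[k] Y) ⊗[k] B :=
  (TensorProduct.assoc k V Y B).symm.toLinearMap
    ∘ₗ LinearMap.lTensor V (t.toLinearMap ∘ₗ (TensorProduct.mk k B Y).flip y)

theorem movePast_tmul (t : B ⊗[k] Y ≃ₗ[k] Y ⊗[k] B) (y : Y) (v : V) (b : B) :
    movePast V t y (v ⊗ₜ b) = (TensorProduct.assoc k V Y B).symm (v ⊗ₜ t (b ⊗ₜ y)) := rfl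

theorem moveStep_eq (t : B ⊗[k] V ≃ₗ[k] V ⊗[k] B) (t' : B ⊗[k] Y ≃ₗ[k] Y ⊗[k] B)
    (x : B ⊗[k] (V ⊗[k] Y)) : moveStep t t' x =
      (TensorProduct.assoc k V Y B).symm (LinearMap.lTensor V t'.toLinearMap
        (slide t.toLinearMap x)) := rfl

theorem moveStep_tmul (t : B ⊗[k] V ≃ₗ[k] V ⊗[k] B) (t' : B ⊗[k] Y ≃ₗ[k] Y ⊗[k] B)
    (b : B) (v : V) (y : Y) : moveStep t t' (b ⊗ₜ (v ⊗ₜ y)) = movePast V t' y (t (b ⊗ₜ v)) := by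
  rw [moveStep_eq, slide_tmul, LinearEquiv.coe_coe]
  induction t (b ⊗ₜ v) using TensorProduct.induction_on with
  | zero => simp only [map_zero]
  | add x y hx hy => simp only [map_add, hx, hy]
  | tmul v b => rfl

/-- The map `f` commutes with moving `B` past its source and its target. -/
def Intertwines (f : X →ₗ[k] Y) (t : B ⊗[k] X ≃ₗ[k] X ⊗[k] B) (t' : B ⊗[k] Y ≃ₗ[k] Y ⊗[k] B) :
    Prop :=
  LinearMap.rTensor B f ∘ₗ t.toLinearMap = t'.toLinearMap ∘ₗ LinearMap.lTensor B f

variable {tV : B ⊗[k] V ≃ₗ[k] V ⊗[k] B} {tW : B ⊗[k] W ≃ₗ[k] W ⊗[k] B}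
  {tX : B ⊗[k] X ≃ₗ[k] X ⊗[k] B} {tY : B ⊗[k] Y ≃ₗ[k] Y ⊗[k] B} {tZ : B ⊗[k] Z ≃ₗ[k] Z ⊗[k] B}

namespace Intertwines

theorem apply {f : X →ₗ[k] Y} (h : Intertwines f tX tY) (x : B ⊗[k] X) :
    LinearMap.rTensor B f (tX x) = tY (LinearMap.lTensor B f x) :=
  LinearMap.congr_fun h x

theorem of_tmul {f : X →ₗ[k] Y}
    (h : ∀ b x, LinearMap.rTensor B f (tX (b ⊗ₜ x)) = tY (b ⊗ₜ f x)) : Intertwines f tX tY :=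
  TensorProduct.ext' h

theorem tmul {f : X →ₗ[k] Y} (h : Intertwines f tX tY) (b : B) (x : X) :
    LinearMap.rTensor B f (tX (b ⊗ₜ x)) = tY (b ⊗ₜ f x) :=
  h.apply (b ⊗ₜ x)

theorem id : Intertwines LinearMap.id tX tX := by
  simp [Intertwines]

theorem comp {g : Y →ₗ[k] Z} {f : X →ₗ[k] Y} (hg : Intertwines g tY tZ)
    (hf : Intertwines f tX tY) : Intertwines (g ∘ₗ f) tX tZ := by
  rw [Intertwines, LinearMap.rTensor_comp, LinearMap.lTensor_comp, LinearMap.comp_assoc, hf,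
    ← LinearMap.comp_assoc, hg, LinearMap.comp_assoc]

theorem sub {f g : X →ₗ[k] Y} (hf : Intertwines f tX tY)
    (hg : Intertwines g tX tY) : Intertwines (f - g) tX tY := by
  rw [Intertwines, LinearMap.rTensor_sub, LinearMap.lTensor_sub, LinearMap.sub_comp,
    LinearMap.comp_sub, hf, hg]

theorem equiv_symm {e : X ≃ₗ[k] Y} (h : Intertwines e.toLinearMap tX tY) :
    Intertwines e.symm.toLinearMap tY tX := by
  refine LinearMap.ext fun x => ?_
  obtain ⟨x, rfl⟩ : ∃ y, LinearMap.lTensor B e.toLinearMap y = x :=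
    LinearMap.lTensor_surjective B e.surjective x
  simp only [LinearMap.comp_apply, LinearEquiv.coe_coe]
  rw [← h.apply, ← LinearMap.comp_apply, ← LinearMap.rTensor_comp,
    ← LinearMap.comp_apply (LinearMap.lTensor _ _), ← LinearMap.lTensor_comp]
  simp

theorem moveStep {f : V →ₗ[k] W} {g : Y →ₗ[k] Z} (hf : Intertwines f tV tW)
    (hg : Intertwines g tY tZ) :
    Intertwines (TensorProduct.map f g) (moveStep tV tY) (moveStep tW tZ) := by
  refine of_tmul fun b x => ?_
  induction x using TensorProduct.induction_on with
  | zero => simp only [map_zero, TensorProduct.tmul_zero]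
  | add x y hx hy => simp only [map_add, TensorProduct.tmul_add, hx, hy]
  | tmul v y =>
  rw [TensorProduct.map_tmul, moveStep_tmul, moveStep_tmul, ← hf.tmul]
  induction tV (b ⊗ₜ v) using TensorProduct.induction_on with
  | zero => simp only [map_zero]
  | add x y hx hy => simp only [map_add, hx, hy]
  | tmul v b =>
  rw [LinearMap.rTensor_tmul, movePast_tmul, movePast_tmul, ← hg.tmul]
  induction tY (b ⊗ₜ y) using TensorProduct.induction_on with
  | zero => simp only [map_zero, TensorProduct.tmul_zero]
  | add x y hx hy => simp only [map_add, hx, hy, TensorProduct.tmul_add]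
  | tmul v b => rfl

theorem lTensor {g : Y →ₗ[k] Z} (hg : Intertwines g tY tZ) :
    Intertwines (LinearMap.lTensor V g) (TwistedProduct.moveStep tV tY)
      (TwistedProduct.moveStep tV tZ) :=
  id.moveStep hg

theorem rTensor {f : V →ₗ[k] W} (hf : Intertwines f tV tW) :
    Intertwines (LinearMap.rTensor Y f) (TwistedProduct.moveStep tV tY)
      (TwistedProduct.moveStep tW tY) :=
  hf.moveStep id

/-- With either bracketing, `B` passes `V`, `W` and `Y` in this order. -/
theorem assoc : Intertwines (TensorProduct.assoc k V W Y).toLinearMap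
    (TwistedProduct.moveStep (TwistedProduct.moveStep tV tW) tY)
    (TwistedProduct.moveStep tV (TwistedProduct.moveStep tW tY)) := by
  refine of_tmul fun b x => ?_
  induction x using TensorProduct.induction_on with
  | zero => simp only [map_zero, TensorProduct.tmul_zero]
  | add x y hx hy => simp only [map_add, TensorProduct.tmul_add, hx, hy]
  | tmul x y =>
  induction x using TensorProduct.induction_on with
  | zero => simp only [map_zero, TensorProduct.tmul_zero, TensorProduct.zero_tmul]
  | add x y hx hy => simp only [map_add, TensorProduct.tmul_add, hx, hy, TensorProduct.add_tmul]
  | tmul v w =>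
  rw [LinearEquiv.coe_coe, TensorProduct.assoc_tmul, moveStep_tmul, moveStep_tmul, moveStep_tmul]
  induction tV (b ⊗ₜ v) using TensorProduct.induction_on with
  | zero => simp only [map_zero]
  | add x y hx hy => simp only [map_add, hx, hy]
  | tmul v b =>
  rw [movePast_tmul, movePast_tmul, moveStep_tmul]
  induction tW (b ⊗ₜ w) using TensorProduct.induction_on with
  | zero => simp only [map_zero, TensorProduct.tmul_zero]
  | add x y hx hy => simp only [map_add, hx, hy, TensorProduct.tmul_add]
  | tmul w b =>
  rw [TensorProduct.assoc_symm_tmul, movePast_tmul, movePast_tmul]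
  induction tY (b ⊗ₜ y) using TensorProduct.induction_on with
  | zero => simp only [map_zero, TensorProduct.tmul_zero]
  | add x y hx hy => simp only [map_add, hx, hy, TensorProduct.tmul_add]
  | tmul y b => rfl

/-- Over a field `f ⊗ 1` is again injective, so the identity may be tested after applying `f`.
Subcomplexes of the bar resolution inherit their compatibility in this way. -/
theorem of_injective {f : Y →ₗ[k] Z} (hf : Function.Injective f) (h : Intertwines f tY tZ)
    {g : X →ₗ[k] Y} (hg : Intertwines (f ∘ₗ g) tX tZ) : Intertwines g tX tY := by
  refine LinearMap.ext fun x => Module.Flat.rTensor_preserves_injective_linearMap f hf ?_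
  have := hg.apply x
  rw [LinearMap.rTensor_comp, LinearMap.lTensor_comp] at this
  exact this.trans (h.apply _).symm

/-- The dual principle, by which quotients of the bar resolution inherit compatibility: `1 ⊗ f` is
surjective, so the identity may be tested on elements coming from `X`. -/
theorem of_surjective {f : X →ₗ[k] Y} (hf : Function.Surjective f) (h : Intertwines f tX tY)
    {g : Y →ₗ[k] Z} (hg : Intertwines (g ∘ₗ f) tX tZ) : Intertwines g tY tZ := by
  refine LinearMap.ext fun x => ?_
  obtain ⟨x, rfl⟩ := LinearMap.lTensor_surjective B hf x
  have := hg.apply x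
  rw [LinearMap.rTensor_comp, LinearMap.lTensor_comp] at this
  refine Eq.trans ?_ this
  exact congrArg _ (h.apply x).symm

end Intertwines

/-- The subspace `S` of `Y` is stable under moving `B`: the given map takes `B ⊗ S` onto
`S ⊗ B`. -/
def Stable (t : B ⊗[k] Y ≃ₗ[k] Y ⊗[k] B) (S : Submodule k Y) : Prop :=
  ∀ x, x ∈ LinearMap.range (LinearMap.lTensor B S.subtype) ↔
    t x ∈ LinearMap.range (LinearMap.rTensor B S.subtype)

theorem rTensor_subtype_injective (B : Type*) [AddCommGroup B] [Module k B] (S : Submodule k Y) :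
    Function.Injective (LinearMap.rTensor B S.subtype) :=
  Module.Flat.rTensor_preserves_injective_linearMap _ S.injective_subtype

/-- The restriction to a stable subspace. -/
def Stable.restrict {S : Submodule k Y} (h : Stable tY S) : B ⊗[k] S ≃ₗ[k] S ⊗[k] B :=
  LinearEquiv.ofInjective _ (lTensor_subtype_injective B S) ≪≫ₗ
    tY.ofSubmodules _ (LinearMap.range (LinearMap.rTensor B S.subtype)) (by
      ext x
      rw [Submodule.mem_map]
      refine ⟨?_, fun hx => ⟨tY.symm x, (h _).mpr ?_, tY.apply_symm_apply x⟩⟩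
      · rintro ⟨y, hy, rfl⟩
        exact (h y).mp hy
      · rwa [LinearEquiv.apply_symm_apply]) ≪≫ₗ
    (LinearEquiv.ofInjective _ (rTensor_subtype_injective B S)).symm

theorem Stable.intertwines {S : Submodule k Y} (h : Stable tY S) :
    Intertwines S.subtype h.restrict tY := by
  refine LinearMap.ext fun x => ?_
  exact congrArg Subtype.val ((LinearEquiv.ofInjective _
    (rTensor_subtype_injective B S)).apply_symm_apply _)

theorem range_lTensor_ker (f : X →ₗ[k] Y) :
    LinearMap.range (LinearMap.lTensor B (LinearMap.ker f).subtype) =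
      LinearMap.ker (LinearMap.lTensor B f) :=
  (LinearMap.exact_iff.mp (Module.Flat.lTensor_exact B f.exact_subtype_ker_map)).symm

theorem range_rTensor_ker (f : X →ₗ[k] Y) :
    LinearMap.range (LinearMap.rTensor B (LinearMap.ker f).subtype) =
      LinearMap.ker (LinearMap.rTensor B f) :=
  (LinearMap.exact_iff.mp (Module.Flat.rTensor_exact B f.exact_subtype_ker_map)).symm

theorem range_lTensor_range (f : X →ₗ[k] Y) :
    LinearMap.range (LinearMap.lTensor B (LinearMap.range f).subtype) =
      LinearMap.range (LinearMap.lTensor B f) := by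
  conv_rhs => rw [← f.subtype_comp_codRestrict _ f.mem_range_self]
  rw [LinearMap.lTensor_comp, LinearMap.range_comp_of_range_eq_top]
  exact LinearMap.range_eq_top.mpr (LinearMap.lTensor_surjective _ f.surjective_rangeRestrict)

theorem range_rTensor_range (f : X →ₗ[k] Y) :
    LinearMap.range (LinearMap.rTensor B (LinearMap.range f).subtype) =
      LinearMap.range (LinearMap.rTensor B f) := by
  conv_rhs => rw [← f.subtype_comp_codRestrict _ f.mem_range_self]
  rw [LinearMap.rTensor_comp, LinearMap.range_comp_of_range_eq_top]
  exact LinearMap.range_eq_top.mpr (LinearMap.rTensor_surjective _ f.surjective_rangeRestrict)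

/-- By flatness `B ⊗ ker f` is the kernel of `1 ⊗ f`, and likewise on the other side. Bijectivity of
`tY` gives the equivalence. -/
theorem Intertwines.stable_ker {f : X →ₗ[k] Y} (h : Intertwines f tX tY) :
    Stable tX (LinearMap.ker f) := fun x => by
  rw [range_lTensor_ker, range_rTensor_ker, LinearMap.mem_ker, LinearMap.mem_ker, h.apply,
    LinearEquiv.map_eq_zero_iff]

/-- The range of `1 ⊗ f` is `B ⊗ range f`. The converse direction needs that `tX` is onto, in order
to pull a preimage back. -/
theorem Intertwines.stable_range {f : X →ₗ[k] Y} (h : Intertwines f tX tY) :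
    Stable tY (LinearMap.range f) := fun x => by
  rw [range_lTensor_range, range_rTensor_range]
  constructor
  · rintro ⟨x, rfl⟩
    exact ⟨tX x, h.apply x⟩
  · rintro ⟨y, hy⟩
    refine ⟨tX.symm y, tY.injective ?_⟩
    rw [← h.apply, LinearEquiv.apply_symm_apply, hy]

theorem mem_range_rTensor_iff (S : Submodule k Y) (x : Y ⊗[k] B) :
    x ∈ LinearMap.range (LinearMap.rTensor B S.subtype) ↔
      TensorProduct.comm k Y B x ∈ LinearMap.range (LinearMap.lTensor B S.subtype) := by
  constructor
  · rintro ⟨w, rfl⟩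
    exact ⟨TensorProduct.comm k S B w, LinearMap.congr_fun (LinearMap.lTensor_comp_comm S.subtype) w⟩
  · rintro ⟨w, hw⟩
    refine ⟨TensorProduct.comm k B S w, ?_⟩
    refine (LinearMap.congr_fun (LinearMap.rTensor_comp_comm S.subtype) w).trans ?_
    exact (congrArg _ hw).trans ((TensorProduct.comm k Y B).symm_apply_apply x)

/-- Coordinates with respect to a basis of `B` lie in every `S i`, hence in the intersection; the
family may be infinite. -/
theorem mem_range_lTensor_iInf {ι : Type*} (S : ι → Submodule k Y) (x : B ⊗[k] Y) :
    x ∈ LinearMap.range (LinearMap.lTensor B (⨅ i, S i).subtype) ↔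
      ∀ i, x ∈ LinearMap.range (LinearMap.lTensor B (S i).subtype) := by
  constructor
  · rintro ⟨w, rfl⟩ i
    refine ⟨LinearMap.lTensor B (Submodule.inclusion (iInf_le S i)) w, ?_⟩
    rw [← LinearMap.comp_apply, ← LinearMap.lTensor_comp]
    rfl
  · exact fun h => iInf_relNext_le S ((Submodule.mem_iInf _).mpr h)

theorem mem_range_rTensor_iInf {ι : Type*} (S : ι → Submodule k Y) (x : Y ⊗[k] B) :
    x ∈ LinearMap.range (LinearMap.rTensor B (⨅ i, S i).subtype) ↔
      ∀ i, x ∈ LinearMap.range (LinearMap.rTensor B (S i).subtype) := by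
  simp only [mem_range_rTensor_iff, mem_range_lTensor_iInf]

theorem Stable.iInf {ι : Type*} {S : ι → Submodule k Y} (h : ∀ i, Stable tY (S i)) :
    Stable tY (⨅ i, S i) := fun x => by
  rw [mem_range_lTensor_iInf, mem_range_rTensor_iInf]
  exact forall_congr' fun i => h i x

theorem Stable.top : Stable tY ⊤ := by
  have := (Intertwines.id (tX := tY)).stable_range
  rwa [LinearMap.range_id] at this

/-- The subspace is the range of an intertwiner: the inclusion of `R` tensored with `Y`, followed by
reassociation. -/
theorem Stable.relFirst {R : Submodule k (V ⊗[k] V)} (h : Stable (moveStep tV tV) R) :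
    Stable (moveStep tV (moveStep tV tY)) (relFirst R Y) :=
  (Intertwines.assoc.comp (h.intertwines.rTensor (tY := tY))).stable_range

theorem Stable.relNext {S : Submodule k Y} (h : Stable tY S) :
    Stable (moveStep tV tY) (relNext V S) :=
  (h.intertwines.lTensor (tV := tV)).stable_range

/-- The move takes `B ⊗ ker f` onto `ker f ⊗ B`, so it induces a bijection of the quotients `B ⊗ Y`
and `Y ⊗ B`. -/
theorem exists_intertwines_of_surjective {f : X →ₗ[k] Y} (hf : Function.Surjective f)
    (h : Stable tX (LinearMap.ker f)) :
    ∃ t : B ⊗[k] Y ≃ₗ[k] Y ⊗[k] B, Intertwines f tX t := by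
  have h' : (LinearMap.ker (LinearMap.lTensor B f)).map tX.toLinearMap =
      LinearMap.ker (LinearMap.rTensor B f) := by
    rw [← range_lTensor_ker, ← range_rTensor_ker]
    ext x
    rw [Submodule.mem_map]
    refine ⟨?_, fun hx => ⟨tX.symm x, (h _).mpr ?_, tX.apply_symm_apply x⟩⟩
    · rintro ⟨y, hy, rfl⟩
      exact (h y).mp hy
    · rwa [LinearEquiv.apply_symm_apply]
  let e₁ := (LinearMap.lTensor B f).quotKerEquivOfSurjective (LinearMap.lTensor_surjective B hf)
  let e₂ := (LinearMap.rTensor B f).quotKerEquivOfSurjective (LinearMap.rTensor_surjective B hf)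
  refine ⟨e₁.symm ≪≫ₗ Submodule.Quotient.equiv _ _ tX h' ≪≫ₗ e₂, LinearMap.ext fun x => ?_⟩
  have : e₁.symm (LinearMap.lTensor B f x) = Submodule.Quotient.mk x :=
    e₁.symm_apply_eq.mpr rfl
  simp only [LinearMap.comp_apply, LinearEquiv.coe_coe, LinearEquiv.trans_apply, this]
  rfl

/-- Moving `B` is compatible with a multiplication of `B`. -/
def IsMulTwist {B : Type*} [Ring B] [Algebra k B] (t : B ⊗[k] Y ≃ₗ[k] Y ⊗[k] B) : Prop :=
  ∀ b b' y, t ((b * b') ⊗ₜ y) =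
    LinearMap.lTensor Y (LinearMap.mul' k B) (slide t.toLinearMap (b ⊗ₜ[k] t (b' ⊗ₜ y)))

section
variable {B : Type*} [Ring B] [Algebra k B] {tV : B ⊗[k] V ≃ₗ[k] V ⊗[k] B}
  {tX : B ⊗[k] X ≃ₗ[k] X ⊗[k] B} {tY : B ⊗[k] Y ≃ₗ[k] Y ⊗[k] B}

theorem slide_mul_natural {f : X →ₗ[k] Y} (h : Intertwines f tX tY) (b : B) (u : X ⊗[k] B) :
    LinearMap.rTensor B f (LinearMap.lTensor X (LinearMap.mul' k B)
        (slide tX.toLinearMap (b ⊗ₜ[k] u))) =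
      LinearMap.lTensor Y (LinearMap.mul' k B)
        (slide tY.toLinearMap (b ⊗ₜ[k] LinearMap.rTensor B f u)) := by
  induction u using TensorProduct.induction_on with
  | zero => simp only [map_zero, TensorProduct.tmul_zero]
  | add x y hx hy => simp only [map_add, hx, hy, TensorProduct.tmul_add]
  | tmul x b' =>
    rw [LinearMap.rTensor_tmul, slide_tmul, slide_tmul, LinearEquiv.coe_coe, LinearEquiv.coe_coe,
      ← h.tmul]
    induction tX (b ⊗ₜ x) using TensorProduct.induction_on with
    | zero => simp only [map_zero]
    | add x y hx hy => simp only [map_add, hx, hy]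
    | tmul x b => rfl

theorem IsMulTwist.of_injective {f : X →ₗ[k] Y} (hf : Function.Injective f)
    (h : Intertwines f tX tY) (hY : IsMulTwist tY) : IsMulTwist tX := fun b b' x => by
  refine Module.Flat.rTensor_preserves_injective_linearMap f hf ?_
  rw [slide_mul_natural h, h.tmul, h.tmul, hY]

theorem IsMulTwist.of_surjective {f : X →ₗ[k] Y} (hf : Function.Surjective f)
    (h : Intertwines f tX tY) (hX : IsMulTwist tX) : IsMulTwist tY := fun b b' y => by
  obtain ⟨x, rfl⟩ := hf y
  rw [← h.tmul, ← h.tmul, ← slide_mul_natural h, hX]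

/-- A product passes `V` first and `Y` second. The two factors can be moved independently, since
`b'` has already left `V` when `b` arrives there. -/
theorem IsMulTwist.moveStep (hV : IsMulTwist tV) (hY : IsMulTwist tY) :
    IsMulTwist (moveStep tV tY) := fun b b' x => by
  induction x using TensorProduct.induction_on with
  | zero => simp only [map_zero, TensorProduct.tmul_zero]
  | add x y hx hy => simp only [map_add, TensorProduct.tmul_add, hx, hy]
  | tmul v y =>
  rw [moveStep_tmul, moveStep_tmul, hV]
  induction tV (b' ⊗ₜ v) using TensorProduct.induction_on with
  | zero => simp only [map_zero, TensorProduct.tmul_zero]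
  | add x y hx hy => simp only [map_add, TensorProduct.tmul_add, hx, hy]
  | tmul v b' =>
  rw [slide_tmul, movePast_tmul]
  -- Here `u` is the result of moving `b` past `v`. Multiplying by `b'` and then passing `y` is the
  -- same as letting `b'` and then `b` pass `y` and multiplying at the end, by the hypothesis on
  -- `tY`.
  have key : ∀ u : V ⊗[k] B, movePast V tY y (LinearMap.lTensor V (LinearMap.mul' k B)
      (LinearMap.lTensor V ((TensorProduct.mk k B B).flip b') u)) =
      LinearMap.lTensor _ (LinearMap.mul' k B) ((TensorProduct.assoc k _ B B)
        ((LinearMap.rTensor B ((TensorProduct.assoc k V Y B).symm.toLinearMap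
          ∘ₗ LinearMap.lTensor V tY.toLinearMap ∘ₗ (TensorProduct.assoc k V B Y).toLinearMap))
        ((TensorProduct.assoc k (V ⊗[k] B) Y B).symm (u ⊗ₜ[k] tY (b' ⊗ₜ y))))) := by
    intro u
    induction u using TensorProduct.induction_on with
    | zero => simp only [map_zero, TensorProduct.zero_tmul]
    | add x y hx hy => simp only [map_add, TensorProduct.add_tmul, hx, hy]
    | tmul v b =>
    simp only [LinearMap.lTensor_tmul, LinearMap.flip_apply, TensorProduct.mk_apply,
      LinearMap.mul'_apply, movePast_tmul, hY b b' y]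
    induction tY (b' ⊗ₜ y) using TensorProduct.induction_on with
    | zero => simp only [map_zero, TensorProduct.tmul_zero]
    | add x y hx hy => simp only [map_add, TensorProduct.tmul_add, hx, hy]
    | tmul y b' =>
    rw [slide_tmul, LinearEquiv.coe_coe, TensorProduct.assoc_symm_tmul, LinearMap.rTensor_tmul,
      LinearMap.comp_apply, LinearMap.comp_apply, LinearEquiv.coe_coe, LinearEquiv.coe_coe,
      TensorProduct.assoc_tmul, LinearMap.lTensor_tmul, LinearEquiv.coe_coe]
    induction tY (b ⊗ₜ y) using TensorProduct.induction_on with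
    | zero => simp only [map_zero, TensorProduct.tmul_zero, TensorProduct.zero_tmul]
    | add x y hx hy => simp only [map_add, TensorProduct.tmul_add, TensorProduct.add_tmul, hx, hy]
    | tmul y b => rfl
  rw [LinearEquiv.coe_coe, key]
  induction tY (b' ⊗ₜ y) using TensorProduct.induction_on with
  | zero => simp only [map_zero, TensorProduct.tmul_zero]
  | add x y hx hy => simp only [map_add, TensorProduct.tmul_add, hx, hy]
  | tmul y b' =>
  rw [TensorProduct.assoc_symm_tmul, TensorProduct.assoc_symm_tmul, slide_tmul,
    LinearEquiv.coe_coe, moveStep_tmul, LinearMap.rTensor_tmul]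
  induction tV (b ⊗ₜ v) using TensorProduct.induction_on with
  | zero => simp only [map_zero, TensorProduct.zero_tmul]
  | add x y hx hy => simp only [map_add, TensorProduct.add_tmul, hx, hy]
  | tmul v b =>
  rw [LinearMap.comp_apply, LinearMap.comp_apply, LinearEquiv.coe_coe, LinearEquiv.coe_coe,
      TensorProduct.assoc_tmul, LinearMap.lTensor_tmul, LinearEquiv.coe_coe, movePast_tmul]
  induction tY (b ⊗ₜ y) using TensorProduct.induction_on with
  | zero => simp only [map_zero, TensorProduct.tmul_zero, TensorProduct.zero_tmul]
  | add x y hx hy => simp only [map_add, TensorProduct.tmul_add, TensorProduct.add_tmul, hx, hy]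
  | tmul y b => rfl

end

end Moves

/-! ### Moving `B` past iterated tensor products and the spaces `K n ⊗ X`. -/

section IteratedMoves

universe u

variable {k B : Type*} [Field k] [AddCommGroup B] [Module k B]
  {V W X X' : Type u} [AddCommGroup V] [Module k V] [AddCommGroup W] [Module k W]
  [AddCommGroup X] [Module k X] [AddCommGroup X'] [Module k X']

/-- Moving `B` past `V ⊗ ⋯ ⊗ V ⊗ X`. -/
def iterMove (tV : B ⊗[k] V ≃ₗ[k] V ⊗[k] B) (tX : B ⊗[k] X ≃ₗ[k] X ⊗[k] B) :
    ∀ n, B ⊗[k] iter k V X n ≃ₗ[k] iter k V X n ⊗[k] B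
  | 0 => tX
  | n + 1 => moveStep tV (iterMove tV tX n)

/-- The map `1 ⊗ ⋯ ⊗ 1 ⊗ f : V ⊗ ⋯ ⊗ V ⊗ X → V ⊗ ⋯ ⊗ V ⊗ X'`. -/
def iterLast (V : Type u) [AddCommGroup V] [Module k V] (f : X →ₗ[k] X') :
    ∀ n, iter k V X n →ₗ[k] iter k V X' n
  | 0 => f
  | n + 1 => LinearMap.lTensor V (iterLast V f n)

variable {tV : B ⊗[k] V ≃ₗ[k] V ⊗[k] B} {tW : B ⊗[k] W ≃ₗ[k] W ⊗[k] B}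
  {tX : B ⊗[k] X ≃ₗ[k] X ⊗[k] B} {tX' : B ⊗[k] X' ≃ₗ[k] X' ⊗[k] B}

theorem Intertwines.iterMap {f : V →ₗ[k] W} (hf : Intertwines f tV tW) :
    ∀ n, Intertwines (iterMap X f n) (iterMove tV tX n) (iterMove tW tX n)
  | 0 => Intertwines.id
  | n + 1 => hf.moveStep (hf.iterMap n)

theorem Intertwines.iterLast {f : X →ₗ[k] X'} (hf : Intertwines f tX tX') :
    ∀ n, Intertwines (iterLast V f n) (iterMove tV tX n) (iterMove tV tX' n)
  | 0 => hf
  | n + 1 => (hf.iterLast n).lTensor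

theorem IsMulTwist.iterMove {B : Type*} [Ring B] [Algebra k B] {tV : B ⊗[k] V ≃ₗ[k] V ⊗[k] B}
    {tX : B ⊗[k] X ≃ₗ[k] X ⊗[k] B} (hV : IsMulTwist tV) (hX : IsMulTwist tX) :
    ∀ n, IsMulTwist (iterMove tV tX n)
  | 0 => hX
  | n + 1 => hV.moveStep (hV.iterMove hX n)

theorem Stable.relAt {R : Submodule k (V ⊗[k] V)} (h : Stable (moveStep tV tV) R) :
    ∀ n i, Stable (iterMove tV tX n) (relAt R X n i)
  | 0, _ => Stable.top
  | 1, _ => Stable.top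
  | _ + 2, 0 => h.relFirst
  | n + 2, i + 1 => (h.relAt (n + 1) i).relNext

theorem Stable.kosSpace {R : Submodule k (V ⊗[k] V)} (h : Stable (moveStep tV tV) R) (n : ℕ) :
    Stable (iterMove tV tX n) (kosSpace R X n) :=
  Stable.iInf (h.relAt n)

end IteratedMoves

/-! ### Compatible bimodules from the calculus of moves. -/

section CompatibleMoves

variable {k A B Y : Type*} [Field k] [Ring A] [Algebra k A] [Ring B] [Algebra k B]
  [AddCommGroup Y] [Module k Y] {τ : TwistingMap k A B}

theorem TwistingMap.isMulTwist (τ : TwistingMap k A B) : IsMulTwist τ.toEquiv := τ.mul_tmul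

/-- This is the axiom of a twisting map with one element of `B` set equal to `1`. The intertwining
properties of the bar differential and of the actions are built on it. -/
theorem TwistingMap.intertwines_mul (τ : TwistingMap k A B) :
    Intertwines (LinearMap.mul' k A) (moveStep τ.toEquiv τ.toEquiv) τ.toEquiv :=
  Intertwines.of_tmul fun b x => by
    induction x using TensorProduct.induction_on with
    | zero => simp only [map_zero, TensorProduct.tmul_zero]
    | add x y hx hy => simp only [map_add, TensorProduct.tmul_add, hx, hy]
    | tmul a a' => exact (τ.tmul_mul b a a').symm

section
variable {M : Type*} [AddCommGroup M] [Module k M] [Module (A ⊗[k] Aᵐᵒᵖ) M]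
  [IsScalarTower k (A ⊗[k] Aᵐᵒᵖ) M]

/-- A compatible map from a map that commutes with the multiplication of `B` and the bimodule
structure. -/
def CompatibleMap.ofIntertwines (t : B ⊗[k] M ≃ₗ[k] M ⊗[k] B) (h : IsMulTwist t)
    (h' : Intertwines (bimoduleMap k A M) (moveStep τ.toEquiv (moveStep t τ.toEquiv)) t) :
    CompatibleMap τ M where
  toEquiv := t
  map_mul := TensorProduct.ext' fun b x => by
    induction x using TensorProduct.induction_on with
    | zero => simp only [map_zero, TensorProduct.tmul_zero]
    | add x y hx hy => simp only [map_add, TensorProduct.tmul_add, hx, hy]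
    | tmul b' m => exact h b b' m
  map_bimodule := h'.symm

/-- A subspace `U` of generators of a bimodule `M`, with `A ⊗ U ⊗ A = M`, past which `B` can be
moved. -/
structure TwistBasis.{w} (A : Type*) {B M : Type*} [Ring A] [Algebra k A] [Ring B] [Algebra k B]
    [AddCommGroup M] [Module k M] [Module (A ⊗[k] Aᵐᵒᵖ) M]
    [IsScalarTower k (A ⊗[k] Aᵐᵒᵖ) M] (t : B ⊗[k] M ≃ₗ[k] M ⊗[k] B) where
  U : Type w
  [addCommGroup : AddCommGroup U]
  [module : Module k U]
  ι : U →ₗ[k] M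
  e : B ⊗[k] U ≃ₗ[k] U ⊗[k] B
  intertwines : Intertwines ι e t
  bijective : Function.Bijective
    (bimoduleMap k A M ∘ₗ LinearMap.lTensor A (LinearMap.rTensor A ι))

attribute [instance] TwistBasis.addCommGroup TwistBasis.module

end

section
variable (r : Aᵐᵒᵖ →ₐ[k] Module.End k Y) {t : B ⊗[k] Y ≃ₗ[k] Y ⊗[k] B}

/-- Up to reassociation, the structure map is the multiplication of `A` tensored with the right
action on `Y`. Compatibility can thus be checked on these two maps separately. -/
theorem inducedBimodule_bimoduleMap :
    letI := inducedBimodule r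
    letI := inducedBimodule_tower r
    bimoduleMap k A (A ⊗[k] Y) = TensorProduct.map (LinearMap.mul' k A) (rightMap r)
      ∘ₗ (TensorProduct.assoc k A A (Y ⊗[k] A)).symm.toLinearMap
      ∘ₗ LinearMap.lTensor A (TensorProduct.assoc k A Y A).toLinearMap := by
  let := inducedBimodule r
  let := inducedBimodule_tower r
  refine TensorProduct.ext' fun a x => ?_
  induction x using TensorProduct.induction_on with
  | zero => simp only [map_zero, TensorProduct.tmul_zero]
  | add x y hx hy => simp only [map_add, TensorProduct.tmul_add, hx, hy]
  | tmul x a' =>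
  induction x using TensorProduct.induction_on with
  | zero => simp only [map_zero, TensorProduct.tmul_zero, TensorProduct.zero_tmul]
  | add x y hx hy => simp only [map_add, TensorProduct.tmul_add, TensorProduct.add_tmul, hx, hy]
  | tmul b y =>
  rw [bimoduleMap_tmul]
  simp only [LinearMap.comp_apply, LinearMap.lTensor_tmul, LinearEquiv.coe_coe,
    TensorProduct.assoc_tmul, TensorProduct.assoc_symm_tmul, TensorProduct.map_tmul,
    LinearMap.mul'_apply, rightMap_tmul]
  exact inducedBimodule_smul r a b (op a') y

theorem inducedBimodule_intertwines
    (h : Intertwines (rightMap r) (moveStep t τ.toEquiv) t) :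
    letI := inducedBimodule r
    letI := inducedBimodule_tower r
    Intertwines (bimoduleMap k A (A ⊗[k] Y))
      (moveStep τ.toEquiv (moveStep (moveStep τ.toEquiv t) τ.toEquiv)) (moveStep τ.toEquiv t) := by
  rw [inducedBimodule_bimoduleMap]
  exact (τ.intertwines_mul.moveStep h).comp
    ((Intertwines.equiv_symm Intertwines.assoc).comp Intertwines.assoc.lTensor)

/-- A subspace `U` of generators of a right module `Y`, with `U ⊗ A = Y`, past which `B` can be
moved. -/
structure RightBasis.{w} (t : B ⊗[k] Y ≃ₗ[k] Y ⊗[k] B) where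
  U : Type w
  [addCommGroup : AddCommGroup U]
  [module : Module k U]
  ι : U →ₗ[k] Y
  e : B ⊗[k] U ≃ₗ[k] U ⊗[k] B
  intertwines : Intertwines ι e t
  bijective : Function.Bijective (rightMap r ∘ₗ LinearMap.rTensor A ι)

attribute [instance] RightBasis.addCommGroup RightBasis.module

/-- The generators `1 ⊗ U` of `A ⊗ Y`. -/
def RightBasis.toTwistBasis (τ : TwistingMap k A B) (h : RightBasis r t) :
    letI := inducedBimodule r
    letI := inducedBimodule_tower r
    TwistBasis A (moveStep τ.toEquiv t) :=
  letI := inducedBimodule r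
  letI := inducedBimodule_tower r
  { U := h.U
    ι := TensorProduct.mk k A Y 1 ∘ₗ h.ι
    e := h.e
    intertwines := by
      refine Intertwines.comp (Intertwines.of_tmul fun b y => ?_) h.intertwines
      -- Since `τ (b ⊗ 1) = 1 ⊗ b`, moving past `1 ⊗ y` is just moving past `y`.
      rw [TensorProduct.mk_apply, moveStep_tmul, τ.map_tmul_one, movePast_tmul]
      induction t (b ⊗ₜ y) using TensorProduct.induction_on with
      | zero => simp only [map_zero, TensorProduct.tmul_zero]
      | add x y hx hy => simp only [map_add, TensorProduct.tmul_add, hx, hy]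
      | tmul y b => rfl
    bijective := by
      have : bimoduleMap k A (A ⊗[k] Y) ∘ₗ LinearMap.lTensor A
          (LinearMap.rTensor A (TensorProduct.mk k A Y 1 ∘ₗ h.ι)) =
          LinearMap.lTensor A (rightMap r ∘ₗ LinearMap.rTensor A h.ι) := by
        rw [inducedBimodule_bimoduleMap]
        ext a u a'
        simp
      rw [this]
      exact (LinearEquiv.lTensor A (LinearEquiv.ofBijective _ h.bijective)).bijective }

end

end CompatibleMoves

/-! ### The bimodules `P i ⊗ Q j` are free. -/

section Projective

variable {k A B M N U W : Type*} [Field k] [Ring A] [Algebra k A] [Ring B] [Algebra k B]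
  {τ : TwistingMap k A B}
  [AddCommGroup M] [Module k M] [Module (A ⊗[k] Aᵐᵒᵖ) M] [IsScalarTower k (A ⊗[k] Aᵐᵒᵖ) M]
  [AddCommGroup N] [Module k N] [Module (B ⊗[k] Bᵐᵒᵖ) N] [IsScalarTower k (B ⊗[k] Bᵐᵒᵖ) N]
  [AddCommGroup U] [Module k U] [AddCommGroup W] [Module k W]

theorem mid_bijective {P Q R Q' R' S : Type*}
    [AddCommGroup P] [Module k P] [AddCommGroup Q] [Module k Q] [AddCommGroup Q'] [Module k Q']
    [AddCommGroup R] [Module k R] [AddCommGroup R'] [Module k R'] [AddCommGroup S] [Module k S]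
    (f : Q ⊗[k] R ≃ₗ[k] Q' ⊗[k] R') :
    Function.Bijective (mid (P := P) (S := S) f.toLinearMap) := by
  refine Function.bijective_iff_has_inverse.mpr ⟨mid f.symm.toLinearMap, fun x => ?_, fun x => ?_⟩
  · have := LinearMap.congr_fun (mid_comp (P := P) (S := S) f.symm.toLinearMap f.toLinearMap) x
    simpa [mid_id] using this
  · have := LinearMap.congr_fun (mid_comp (P := P) (S := S) f.toLinearMap f.symm.toLinearMap) x
    simpa [mid_id] using this

/-- The rearrangement `(A ⊗ B) ⊗ (A ⊗ B) ⊗ (U ⊗ W) ≃ (A ⊗ (B ⊗ U)) ⊗ ((W ⊗ A) ⊗ B)`. -/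
def rearrange (τ : TwistingMap k A B) (U W : Type*) [AddCommGroup U] [Module k U]
    [AddCommGroup W] [Module k W] :
    (TwistedTensor τ ⊗[k] (TwistedTensor τ)ᵐᵒᵖ) ⊗[k] (U ⊗[k] W) ≃ₗ[k]
      (A ⊗[k] (B ⊗[k] U)) ⊗[k] ((W ⊗[k] A) ⊗[k] B) :=
  TensorProduct.congr (TensorProduct.congr (TwistedTensor.of τ).symm
      ((opLinearEquiv k).symm ≪≫ₗ (TwistedTensor.of τ).symm)) (LinearEquiv.refl k _)
    ≪≫ₗ TensorProduct.tensorTensorTensorComm k _ _ _ _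
    ≪≫ₗ TensorProduct.congr (TensorProduct.assoc k _ _ _)
      (TensorProduct.comm k _ _ ≪≫ₗ (TensorProduct.assoc k _ _ _).symm)

theorem rearrange_tmul (a a' : A) (b b' : B) (u : U) (w : W) :
    rearrange τ U W ((TwistedTensor.of τ (a ⊗ₜ b) ⊗ₜ[k] op (TwistedTensor.of τ (a' ⊗ₜ b'))) ⊗ₜ[k]
      (u ⊗ₜ[k] w)) = (a ⊗ₜ (b ⊗ₜ u)) ⊗ₜ ((w ⊗ₜ a') ⊗ₜ b') := rfl

/-- The bijections that move `B` past `U`, `A` past `W`, and then `B` past `A`. -/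
def freeTwist (τ : TwistingMap k A B) (e : B ⊗[k] U ≃ₗ[k] U ⊗[k] B)
    (e' : A ⊗[k] W ≃ₗ[k] W ⊗[k] A) : (A ⊗[k] (B ⊗[k] U)) ⊗[k] ((W ⊗[k] A) ⊗[k] B) →ₗ[k]
      (A ⊗[k] (U ⊗[k] A)) ⊗[k] (B ⊗[k] (W ⊗[k] B)) :=
  TensorProduct.map (TensorProduct.assoc k _ _ _).toLinearMap LinearMap.id
    ∘ₗ mid τ.toEquiv.toLinearMap
    ∘ₗ TensorProduct.map (TensorProduct.assoc k _ _ _).symm.toLinearMap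
      (TensorProduct.assoc k _ _ _).toLinearMap
    ∘ₗ TensorProduct.map (LinearMap.lTensor A e.toLinearMap)
      (LinearMap.rTensor B e'.symm.toLinearMap)

theorem freeTwist_bijective (e : B ⊗[k] U ≃ₗ[k] U ⊗[k] B) (e' : A ⊗[k] W ≃ₗ[k] W ⊗[k] A) :
    Function.Bijective (freeTwist τ e e') := by
  have h₁ := (TensorProduct.congr (TensorProduct.assoc k A U A)
    (LinearEquiv.refl k (B ⊗[k] (W ⊗[k] B)))).bijective
  have h₂ := mid_bijective (P := A ⊗[k] U) (S := W ⊗[k] B) τ.toEquiv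
  have h₃ := (TensorProduct.congr (TensorProduct.assoc k A U B).symm
    (TensorProduct.assoc k A W B)).bijective
  have h₄ := (TensorProduct.congr (LinearEquiv.lTensor A e) (LinearEquiv.rTensor B e'.symm)).bijective
  exact h₁.comp (h₂.comp (h₃.comp h₄))

/-- The action moves `b` past the element of `M`, `a'` past the element of `N`, and then `b` past
`a'`. On generators the first two moves already take place in `U` and `W`, by the intertwining
hypotheses. -/
theorem freeTwist_smul (c : CompatibleMap τ M) (c' : CompatibleMap τ.symm N)
    {e : B ⊗[k] U ≃ₗ[k] U ⊗[k] B} {e' : A ⊗[k] W ≃ₗ[k] W ⊗[k] A} {ι : U →ₗ[k] M} {ι' : W →ₗ[k] N}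
    (h : Intertwines ι e c.toEquiv) (h' : Intertwines ι' e' c'.toEquiv)
    (a a' : A) (b b' : B) (u : U) (w : W) :
    (TwistedTensor.of τ (a ⊗ₜ b) ⊗ₜ[k] op (TwistedTensor.of τ (a' ⊗ₜ b'))) •
        TwistedBimodule.of c c' (ι u ⊗ₜ ι' w) =
      TwistedBimodule.of c c' (TensorProduct.map
        (bimoduleMap k A M ∘ₗ LinearMap.lTensor A (LinearMap.rTensor A ι))
        (bimoduleMap k B N ∘ₗ LinearMap.lTensor B (LinearMap.rTensor B ι'))
        (freeTwist τ e e' ((a ⊗ₜ (b ⊗ₜ u)) ⊗ₜ ((w ⊗ₜ a') ⊗ₜ b')))) := by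
  rw [TwistedBimodule.smul_tmul]
  congr 1
  have hw : c'.toEquiv.symm (ι' w ⊗ₜ a') =
      LinearMap.lTensor A ι' (e'.symm (w ⊗ₜ a')) :=
    (comm_symm (e := e') (e' := c'.toEquiv) h' (w ⊗ₜ a')).symm
  rw [← h.tmul, hw]
  simp only [freeTwist, LinearMap.comp_apply, TensorProduct.map_tmul, LinearMap.lTensor_tmul,
    LinearMap.rTensor_tmul, LinearEquiv.coe_coe]
  induction e (b ⊗ₜ u) using TensorProduct.induction_on with
  | zero => simp only [map_zero, TensorProduct.tmul_zero, TensorProduct.zero_tmul]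
  | add x y hx hy => simp only [map_add, TensorProduct.tmul_add, TensorProduct.add_tmul, hx, hy]
  | tmul u b =>
  induction e'.symm (w ⊗ₜ a') using TensorProduct.induction_on with
  | zero => simp only [map_zero, TensorProduct.tmul_zero, TensorProduct.zero_tmul]
  | add x y hx hy => simp only [map_add, TensorProduct.tmul_add, TensorProduct.add_tmul, hx, hy]
  | tmul a' w =>
  rw [LinearMap.rTensor_tmul, LinearMap.lTensor_tmul, TensorProduct.assoc_symm_tmul,
    TensorProduct.assoc_tmul, mid_tmul, mid_tmul]
  induction τ.toEquiv.toLinearMap (b ⊗ₜ a') using TensorProduct.induction_on with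
  | zero => simp only [map_zero]
  | add x y hx hy => simp only [map_add, hx, hy]
  | tmul α β => rfl

/-- The vector space `V` is free over `k`, so `E ⊗ V` is free over `E`; by the formula on pure
tensors `F` is `E`-linear. -/
theorem projective_of_free {E X V : Type*} [Ring E] [Algebra k E] [AddCommGroup X] [Module k X]
    [Module E X] [IsScalarTower k E X] [AddCommGroup V] [Module k V] (F : E ⊗[k] V →ₗ[k] X)
    (g : V → X) (hF : ∀ x v, F (x ⊗ₜ v) = x • g v) (hb : Function.Bijective F) :
    Module.Projective E X := by
  let F' : E ⊗[k] V →ₗ[E] X :=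
    { F with
      map_smul' := fun x z => by
        change F (x • z) = x • F z
        induction z using TensorProduct.induction_on with
        | zero => simp only [smul_zero, map_zero]
        | add y z hy hz => simp only [smul_add, map_add, hy, hz]
        | tmul y v => rw [TensorProduct.smul_tmul', hF, hF, smul_eq_mul, mul_smul] }
  exact Module.Projective.of_equiv (LinearEquiv.ofBijective F' hb)

/-- The action on the generators `U ⊗ W` is a composite of bijections, which exhibits the bimodule
as free on `U ⊗ W`. -/
theorem twistedBimodule_projective (c : CompatibleMap τ M) (c' : CompatibleMap τ.symm N)
    (h : TwistBasis A c.toEquiv) (h' : TwistBasis B c'.toEquiv) :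
    Module.Projective (TwistedTensor τ ⊗[k] (TwistedTensor τ)ᵐᵒᵖ) (TwistedBimodule c c') := by
  let F : (TwistedTensor τ ⊗[k] (TwistedTensor τ)ᵐᵒᵖ) ⊗[k] (h.U ⊗[k] h'.U) →ₗ[k]
      TwistedBimodule c c' :=
    TensorProduct.lift ((Algebra.lsmul k k (TwistedBimodule c c')).toLinearMap.compl₂
      ((TwistedBimodule.of c c').toLinearMap ∘ₗ TensorProduct.map h.ι h'.ι))
  -- The action map is rewritten as a rearrangement of factors, the moves, and the isomorphisms `A ⊗
  -- U ⊗ A ≃ M` and `B ⊗ W ⊗ B ≃ N`. Each factor is visibly bijective, which is not clear for `F`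
  -- itself.
  have hF : ∀ x, F x = TwistedBimodule.of c c' (TensorProduct.map
        (bimoduleMap k A M ∘ₗ LinearMap.lTensor A (LinearMap.rTensor A h.ι))
        (bimoduleMap k B N ∘ₗ LinearMap.lTensor B (LinearMap.rTensor B h'.ι))
        (freeTwist τ h.e h'.e (rearrange τ h.U h'.U x))) := by
    intro x
    induction x using TensorProduct.induction_on with
    | zero => simp only [map_zero]
    | add x y hx hy => simp only [map_add, hx, hy]
    | tmul x y =>
    induction x using TensorProduct.induction_on with
    | zero => simp only [map_zero, TensorProduct.zero_tmul]
    | add x y hx hy => simp only [map_add, TensorProduct.add_tmul, hx, hy]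
    | tmul x x' =>
    induction y using TensorProduct.induction_on with
    | zero => simp only [map_zero, TensorProduct.tmul_zero]
    | add x y hx hy => simp only [map_add, TensorProduct.tmul_add, hx, hy]
    | tmul u w =>
    obtain ⟨x, rfl⟩ := (TwistedTensor.of τ).surjective x
    obtain ⟨x', rfl⟩ := MulOpposite.op_surjective x'
    obtain ⟨x', rfl⟩ := (TwistedTensor.of τ).surjective x'
    induction x using TensorProduct.induction_on with
    | zero => simp only [map_zero, TensorProduct.zero_tmul]
    | add x y hx hy => simp only [map_add, TensorProduct.add_tmul, hx, hy]
    | tmul a b =>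
    induction x' using TensorProduct.induction_on with
    | zero => simp only [map_zero, op_zero, TensorProduct.zero_tmul, TensorProduct.tmul_zero]
    | add x y hx hy =>
      simp only [map_add, op_add, TensorProduct.add_tmul, TensorProduct.tmul_add, hx, hy]
    | tmul a' b' =>
    rw [rearrange_tmul, ← freeTwist_smul c c' h.intertwines h'.intertwines]
    rfl
  have hb : Function.Bijective F := by
    have h₁ := (TensorProduct.congr (LinearEquiv.ofBijective _ h.bijective)
      (LinearEquiv.ofBijective _ h'.bijective)).bijective
    rw [show (F : _ → _) = _ from funext hF]
    exact (TwistedBimodule.of c c').bijective.comp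
      (h₁.comp ((freeTwist_bijective h.e h'.e).comp (rearrange τ h.U h'.U).bijective))
  exact projective_of_free F
    ((TwistedBimodule.of c c').toLinearMap ∘ₗ TensorProduct.map h.ι h'.ι) (fun _ _ => rfl) hb

theorem twistedProduct_isProjectiveResolution {P : AugmentedSequence k A}
    {Q : AugmentedSequence k B} (c : CompatibleTwist τ P) (c' : CompatibleTwist τ.symm Q)
    (hP : P.IsExact) (hQ : Q.IsExact) (h : ∀ n, Nonempty (TwistBasis A (c.tw n).toEquiv))
    (h' : ∀ n, Nonempty (TwistBasis B (c'.tw n).toEquiv)) :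
    (twistedProduct c c').IsProjectiveResolution where
  projective n := by
    have : ∀ p : {p : ℕ × ℕ // p.1 + p.2 = n}, Module.Projective
        (TwistedTensor τ ⊗[k] (TwistedTensor τ)ᵐᵒᵖ) (bicomplexX c c' p.1.1 p.1.2) := fun p =>
      (h p.1.1).elim fun h => (h' p.1.2).elim fun h' => twistedBimodule_projective _ _ h h'
    exact inferInstanceAs (Module.Projective (TwistedTensor τ ⊗[k] (TwistedTensor τ)ᵐᵒᵖ)
      (Π₀ p : {p : ℕ × ℕ // p.1 + p.2 = n}, bicomplexX c c' p.1.1 p.1.2))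
  exact_succ := (twistedProduct_isExact c c' hP hQ).exact_succ
  exact_zero := (twistedProduct_isExact c c' hP hQ).exact_zero
  surjective := (twistedProduct_isExact c c' hP hQ).surjective

end Projective

/-! ### Changing the last factor of `K n ⊗ X`. -/

section Extension

universe u

variable {k : Type*} [Field k]

section
variable {V W W' Y Y' Z : Type*} [AddCommGroup V] [Module k V] [AddCommGroup W] [Module k W]
  [AddCommGroup W'] [Module k W'] [AddCommGroup Y] [Module k Y] [AddCommGroup Y'] [Module k Y']
  [AddCommGroup Z] [Module k Z]

/-- The map `m : Y ⊗ Z → Y'` takes `S ⊗ Z` onto `T`. -/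
def Extends (m : Y ⊗[k] Z →ₗ[k] Y') (S : Submodule k Y) (T : Submodule k Y') : Prop :=
  ∀ x, x ∈ LinearMap.range (LinearMap.rTensor Z S.subtype) ↔ m x ∈ T

/-- An element of the target range comes from `W'`, hence from `W ⊗ Z` because `g` is onto;
injectivity of `m` then identifies it with `x`. -/
theorem Extends.of_range {m : Y ⊗[k] Z →ₗ[k] Y'} (hm : Function.Injective m) {f : W →ₗ[k] Y}
    {f' : W' →ₗ[k] Y'} (g : W ⊗[k] Z →ₗ[k] W') (hg : Function.Surjective g)
    (h : f' ∘ₗ g = m ∘ₗ LinearMap.rTensor Z f) :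
    Extends m (LinearMap.range f) (LinearMap.range f') := fun x => by
  rw [range_rTensor_range]
  constructor
  · rintro ⟨w, rfl⟩
    exact ⟨g w, LinearMap.congr_fun h w⟩
  · rintro ⟨w, hw⟩
    obtain ⟨w, rfl⟩ := hg w
    exact ⟨w, hm ((LinearMap.congr_fun h w).symm.trans hw)⟩

/-- The restriction `S ⊗ Z → T` of `m : Y ⊗ Z → Y'`. -/
def Extends.restrict {m : Y ⊗[k] Z →ₗ[k] Y'} {S : Submodule k Y} {T : Submodule k Y'}
    (h : Extends m S T) : S ⊗[k] Z →ₗ[k] T :=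
  (m ∘ₗ LinearMap.rTensor Z S.subtype).codRestrict T fun x => (h _).mp ⟨x, rfl⟩

theorem Extends.subtype_restrict {m : Y ⊗[k] Z →ₗ[k] Y'} {S : Submodule k Y} {T : Submodule k Y'}
    (h : Extends m S T) : T.subtype ∘ₗ h.restrict = m ∘ₗ LinearMap.rTensor Z S.subtype := rfl

theorem Extends.restrict_bijective {m : Y ⊗[k] Z →ₗ[k] Y'} (hm : Function.Bijective m)
    {S : Submodule k Y} {T : Submodule k Y'} (h : Extends m S T) :
    Function.Bijective h.restrict := by
  constructor
  · intro x y hxy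
    exact rTensor_subtype_injective Z S (hm.1 (congrArg Subtype.val hxy))
  · intro y
    obtain ⟨x, hx⟩ := hm.2 y.1
    obtain ⟨x, rfl⟩ := (h x).mpr (hx ▸ y.2)
    exact ⟨x, Subtype.ext hx⟩

theorem Extends.top (m : Y ⊗[k] Z →ₗ[k] Y') : Extends m ⊤ ⊤ := fun x =>
  ⟨fun _ => trivial, fun _ => LinearMap.rTensor_surjective Z
    (LinearMap.range_eq_top.mp (Submodule.range_subtype _)) x⟩

theorem Extends.iInf {m : Y ⊗[k] Z →ₗ[k] Y'} {ι : Type*} {S : ι → Submodule k Y}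
    {T : ι → Submodule k Y'} (h : ∀ i, Extends m (S i) (T i)) :
    Extends m (⨅ i, S i) (⨅ i, T i) := fun x => by
  rw [mem_range_rTensor_iInf, Submodule.mem_iInf]
  exact forall_congr' fun i => h i x

/-- The map `V ⊗ Y ⊗ Z → V ⊗ Y'` given by `m : Y ⊗ Z → Y'`. -/
def extendStep (V : Type*) [AddCommGroup V] [Module k V] (m : Y ⊗[k] Z →ₗ[k] Y') :
    (V ⊗[k] Y) ⊗[k] Z →ₗ[k] V ⊗[k] Y' :=
  LinearMap.lTensor V m ∘ₗ (TensorProduct.assoc k V Y Z).toLinearMap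

theorem extendStep_bijective {m : Y ⊗[k] Z →ₗ[k] Y'} (hm : Function.Bijective m) :
    Function.Bijective (extendStep V m) :=
  ((LinearEquiv.lTensor V (LinearEquiv.ofBijective m hm)).bijective).comp
    (TensorProduct.assoc k V Y Z).bijective

theorem Extends.relFirst (R : Submodule k (V ⊗[k] V)) {m : Y ⊗[k] Z →ₗ[k] Y'}
    (hm : Function.Bijective m) :
    Extends (extendStep V (extendStep V m)) (relFirst R Y) (relFirst R Y') := by
  have h : ((TensorProduct.assoc k V V Y').toLinearMap ∘ₗ LinearMap.rTensor Y' R.subtype) ∘ₗ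
      extendStep R m = extendStep V (extendStep V m) ∘ₗ LinearMap.rTensor Z
        ((TensorProduct.assoc k V V Y).toLinearMap ∘ₗ LinearMap.rTensor Y R.subtype) := by
    refine TensorProduct.ext' fun x z => ?_
    induction x using TensorProduct.induction_on with
    | zero => simp only [map_zero, TensorProduct.zero_tmul]
    | add x y hx hy => simp only [map_add, TensorProduct.add_tmul, hx, hy]
    | tmul r y =>
    simp only [extendStep, LinearMap.comp_apply, LinearEquiv.coe_coe, TensorProduct.assoc_tmul,
      LinearMap.lTensor_tmul, LinearMap.rTensor_tmul]
    induction R.subtype r using TensorProduct.induction_on with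
    | zero => simp only [map_zero, TensorProduct.zero_tmul]
    | add x y hx hy => simp only [map_add, TensorProduct.add_tmul, hx, hy]
    | tmul v w => rfl
  have hs : Function.Surjective (extendStep R m) := (extendStep_bijective hm).2
  have hi : Function.Injective (extendStep V (extendStep V m)) :=
    (extendStep_bijective (extendStep_bijective hm)).1
  have := Extends.of_range hi (extendStep R m) hs h
  exact this

theorem Extends.relNext {m : Y ⊗[k] Z →ₗ[k] Y'} (hm : Function.Bijective m)
    {S : Submodule k Y} {T : Submodule k Y'} (h : Extends m S T) :
    Extends (extendStep V m) (relNext V S) (relNext V T) := by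
  refine Extends.of_range (extendStep_bijective hm).1 (extendStep V h.restrict)
    (extendStep_bijective (h.restrict_bijective hm)).2 ?_
  ext v s z
  rfl

end

section
variable {V X X' Z : Type u} [AddCommGroup V] [Module k V]
  [AddCommGroup X] [Module k X] [AddCommGroup X'] [Module k X'] [AddCommGroup Z] [Module k Z]

/-- The map `V ⊗ ⋯ ⊗ V ⊗ X ⊗ Z → V ⊗ ⋯ ⊗ V ⊗ X'` given by `m : X ⊗ Z → X'`. -/
def iterExtend (V : Type u) [AddCommGroup V] [Module k V] (m : X ⊗[k] Z →ₗ[k] X') :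
    ∀ n, iter k V X n ⊗[k] Z →ₗ[k] iter k V X' n
  | 0 => m
  | n + 1 => extendStep V (iterExtend V m n)

theorem iterExtend_bijective {m : X ⊗[k] Z →ₗ[k] X'} (hm : Function.Bijective m) :
    ∀ n, Function.Bijective (iterExtend V m n)
  | 0 => hm
  | n + 1 => extendStep_bijective (iterExtend_bijective hm n)

theorem Extends.relAt (R : Submodule k (V ⊗[k] V)) {m : X ⊗[k] Z →ₗ[k] X'}
    (hm : Function.Bijective m) :
    ∀ n i, Extends (iterExtend V m n) (relAt R X n i) (relAt R X' n i)
  | 0, _ => Extends.top _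
  | 1, _ => Extends.top _
  | n + 2, 0 => Extends.relFirst R (iterExtend_bijective hm n)
  | n + 2, i + 1 => (Extends.relAt R hm (n + 1) i).relNext (iterExtend_bijective hm (n + 1))

/-- The conditions defining `K n` do not involve the last factor. So `kosSpace R X n` behaves as `K
n ⊗ X`: its tensor product with `Z` is the corresponding space over `X ⊗ Z`. -/
theorem Extends.kosSpace (R : Submodule k (V ⊗[k] V)) {m : X ⊗[k] Z →ₗ[k] X'}
    (hm : Function.Bijective m) (n : ℕ) :
    Extends (iterExtend V m n) (kosSpace R X n) (kosSpace R X' n) :=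
  Extends.iInf (Extends.relAt R hm n)

end

section
variable {A : Type u} [Ring A] [Algebra k A] (S : Submodule k A)

/-- The multiplication `S ⊗ A → A` for a subspace `S` of `A`. -/
def mulSubspace : S ⊗[k] A →ₗ[k] A := LinearMap.mul' k A ∘ₗ LinearMap.rTensor A S.subtype

/-- The inverse is `a ↦ 1 ⊗ a`, because scalars move across the tensor sign. -/
theorem mulSubspace_bijective (hS : S = 1) : Function.Bijective (mulSubspace S) := by
  have hS' : ∀ s : S, ∃ c : k, algebraMap k A c = s.1 := by
    subst hS
    exact fun s => Submodule.mem_one.mp s.2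
  have h1 : (1 : A) ∈ S := hS ▸ Submodule.mem_one.mpr ⟨1, map_one _⟩
  have h : ∀ x : S ⊗[k] A, (⟨1, h1⟩ : S) ⊗ₜ[k] mulSubspace S x = x := by
    intro x
    induction x using TensorProduct.induction_on with
    | zero => simp only [map_zero, TensorProduct.tmul_zero]
    | add x y hx hy => simp only [map_add, TensorProduct.tmul_add, hx, hy]
    | tmul s a =>
      obtain ⟨c, hc⟩ := hS' s
      have hs : s = c • (⟨1, h1⟩ : S) :=
        Subtype.ext (by rw [← hc, Algebra.algebraMap_eq_smul_one]; rfl)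
      rw [hs, TensorProduct.smul_tmul]
      congr 1
      simp [mulSubspace]
  refine ⟨fun x y hxy => ?_, fun a => ⟨(⟨1, h1⟩ : S) ⊗ₜ a, ?_⟩⟩
  · rw [← h x, ← h y, hxy]
  · simp [mulSubspace]

theorem rightMap_lTensor {V Y Y' : Type*} [AddCommGroup V] [Module k V] [AddCommGroup Y]
    [Module k Y] [AddCommGroup Y'] [Module k Y'] (r : Aᵐᵒᵖ →ₐ[k] Module.End k Y)
    (f : Y' →ₗ[k] Y) :
    rightMap ((Module.End.lTensorAlgHom k Y V).comp r) ∘ₗ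
        LinearMap.rTensor A (LinearMap.lTensor V f) =
      extendStep V (rightMap r ∘ₗ LinearMap.rTensor A f) := by
  ext v y a
  simp [extendStep]
  rfl

/-- This compares the action map `U ⊗ A → Y`, for `U = V ⊗ ⋯ ⊗ V ⊗ S` and `Y = V ⊗ ⋯ ⊗ V ⊗ A`, with
the multiplication `S ⊗ A → A` on the last factor. For `S = k 1` it is therefore bijective. -/
theorem rightMap_iterLast (V : Type u) [AddCommGroup V] [Module k V] :
    ∀ n, rightMap (iterRight k V A n) ∘ₗ LinearMap.rTensor A (iterLast V S.subtype n) =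
      iterExtend V (mulSubspace S) n
  | 0 => by
    ext s a
    rfl
  | n + 1 => (rightMap_lTensor (iterRight k V A n) (iterLast V S.subtype n)).trans
      (congrArg (extendStep V) (rightMap_iterLast V n))

end

end Extension

/-! ### Generators of `V ⊗ ⋯ ⊗ V ⊗ A` as a right module. -/

section IteratedBasis

universe u v

variable {k : Type*} [Field k] {A : Type u} [Ring A] [Algebra k A] {B : Type v} [Ring B]
  [Algebra k B] {τ : TwistingMap k A B} {V : Type u} [AddCommGroup V] [Module k V]

/-- The line `k 1` is the range of the unit map `k → A`. By `τ (b ⊗ 1) = 1 ⊗ b` this map intertwines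
the flip of `B ⊗ k` with `τ`. -/
theorem TwistingMap.stable_one (τ : TwistingMap k A B) :
    Stable τ.toEquiv (1 : Submodule k A) := by
  have h : Intertwines (Algebra.linearMap k A) (TensorProduct.comm k B k) τ.toEquiv :=
    Intertwines.of_tmul fun b c => by
      simp only [TensorProduct.comm_tmul, LinearMap.rTensor_tmul, Algebra.linearMap_apply,
        Algebra.algebraMap_eq_smul_one, TensorProduct.tmul_smul, τ.map_tmul_one,
        TensorProduct.smul_tmul']
  rw [Submodule.one_eq_range]
  exact h.stable_range

/-- The right action touches the last factor only, where it is the multiplication of `A`; the other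
factors are added by reassociation. -/
theorem rightMap_iterRight_intertwines (tV : B ⊗[k] V ≃ₗ[k] V ⊗[k] B) :
    ∀ n, Intertwines (rightMap (iterRight k V A n))
      (moveStep (iterMove tV τ.toEquiv n) τ.toEquiv) (iterMove tV τ.toEquiv n)
  | 0 => by
    have : rightMap (rmul k A) = LinearMap.mul' k A := by
      ext a a'
      simp
    exact this ▸ τ.intertwines_mul
  | n + 1 => by
    have : rightMap (iterRight k V A (n + 1)) = extendStep V (rightMap (iterRight k V A n)) := by
      have := rightMap_lTensor (V := V) (iterRight k V A n) LinearMap.id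
      rw [LinearMap.lTensor_id, LinearMap.rTensor_id, LinearMap.rTensor_id] at this
      exact this
    rw [this]
    exact (rightMap_iterRight_intertwines tV n).lTensor.comp Intertwines.assoc

/-- The generators `V ⊗ ⋯ ⊗ V ⊗ 1` of `V ⊗ ⋯ ⊗ V ⊗ A`. -/
def iterBasis (τ : TwistingMap k A B) (tV : B ⊗[k] V ≃ₗ[k] V ⊗[k] B) (n : ℕ) :
    RightBasis (iterRight k V A n) (iterMove tV τ.toEquiv n) where
  U := iter k V (1 : Submodule k A) n
  ι := iterLast V (1 : Submodule k A).subtype n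
  e := iterMove tV τ.stable_one.restrict n
  intertwines := τ.stable_one.intertwines.iterLast n
  bijective := by
    rw [rightMap_iterLast]
    exact iterExtend_bijective (mulSubspace_bijective _ rfl) n

end IteratedBasis

/-! ### The bar and reduced bar resolutions: twists, generators, exactness. -/

section BarTwists

universe u v

variable {k : Type*} [Field k] {A : Type u} [Ring A] [Algebra k A] {B : Type v} [Ring B]
  [Algebra k B] (τ : TwistingMap k A B)

theorem iterTwist_eq : ∀ n, iterTwist τ n = iterMove τ.toEquiv τ.toEquiv n
  | 0 => rfl
  | n + 1 => congrArg (moveStep τ.toEquiv) (iterTwist_eq n)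

theorem barTwist_eq (n : ℕ) :
    barTwist τ n = moveStep τ.toEquiv (iterMove τ.toEquiv τ.toEquiv n) :=
  congrArg (moveStep τ.toEquiv) (iterTwist_eq τ n)

variable {τ} in
theorem TwistingMap.intertwines_mulFirst {Y : Type*} [AddCommGroup Y] [Module k Y]
    {t : B ⊗[k] Y ≃ₗ[k] Y ⊗[k] B} :
    Intertwines (LinearMap.rTensor Y (LinearMap.mul' k A) ∘ₗ
      (TensorProduct.assoc k A A Y).symm.toLinearMap)
      (moveStep τ.toEquiv (moveStep τ.toEquiv t)) (moveStep τ.toEquiv t) :=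
  τ.intertwines_mul.rTensor.comp (Intertwines.equiv_symm Intertwines.assoc)

/-- In the recursion `barD (n + 1) = m ⊗ 1 - 1 ⊗ barD n` the first term intertwines by the twisting
axiom, the second by induction. -/
theorem barD_intertwines : ∀ n, Intertwines (barD k A n)
    (moveStep τ.toEquiv (iterMove τ.toEquiv τ.toEquiv n)) (iterMove τ.toEquiv τ.toEquiv n)
  | 0 => τ.intertwines_mul
  | n + 1 => TwistingMap.intertwines_mulFirst.sub (barD_intertwines n).lTensor

/-- The iterations of `τ` on the bar resolution. -/
def barCompatible : CompatibleTwist τ (bar k A) where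
  tw n := CompatibleMap.ofIntertwines (moveStep τ.toEquiv (iterMove τ.toEquiv τ.toEquiv n))
    (τ.isMulTwist.moveStep (τ.isMulTwist.iterMove τ.isMulTwist n))
    (inducedBimodule_intertwines (iterRight k A A n)
      (rightMap_iterRight_intertwines τ.toEquiv n))
  d_comm n := barD_intertwines τ (n + 1)
  ε_comm := τ.intertwines_mul

theorem barCompatible_isBarTwist : IsBarTwist (barCompatible τ) := fun n => (barTwist_eq τ n).symm

/-- The generators `1 ⊗ A ⊗ ⋯ ⊗ A ⊗ 1` of the bar resolution. -/
theorem IsBarTwist.exists_basis {c : CompatibleTwist τ (bar k A)} (h : IsBarTwist c) (n : ℕ) :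
    Nonempty (TwistBasis.{_, u, _, _, _} A (c.tw n).toEquiv) := by
  rw [h n, barTwist_eq]
  exact ⟨(iterBasis τ τ.toEquiv n).toTwistBasis (τ := τ)⟩

section
variable {Y : Type*} [AddCommGroup Y] [Module k Y]

theorem barStep_one_tmul (q : A ⊗[k] Y →ₗ[k] Y) (x : A ⊗[k] Y) :
    barStep q (1 ⊗ₜ x) = x - 1 ⊗ₜ q x := by
  induction x using TensorProduct.induction_on with
  | zero => simp only [map_zero, TensorProduct.tmul_zero, sub_zero]
  | add x y hx hy => simp only [map_add, TensorProduct.tmul_add, hx, hy, add_sub_add_comm]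
  | tmul a y => rw [barStep_tmul, one_mul]

/-- By linearity in the left factor it is enough to take `a = 1`. Put `y = barStep q z`. The inner
map sends `1 ⊗ z` to `z - 1 ⊗ y`, and the outer one sends this to `y - (y - 1 ⊗ q y) = 1 ⊗ q y`,
which vanishes by hypothesis. -/
theorem barStep_barStep {q : A ⊗[k] Y →ₗ[k] Y} (h : ∀ x, q (barStep q x) = 0)
    (x : A ⊗[k] (A ⊗[k] (A ⊗[k] Y))) : barStep q (barStep (barStep q) x) = 0 := by
  induction x using TensorProduct.induction_on with
  | zero => simp only [map_zero]
  | add x y hx hy => simp only [map_add, hx, hy, add_zero]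
  | tmul a z =>
    have h' : ∀ y, barStep q (LinearMap.rTensor _ (LinearMap.mulLeft k a) y) =
        LinearMap.rTensor _ (LinearMap.mulLeft k a) (barStep q y) := by
      intro y
      induction y using TensorProduct.induction_on with
      | zero => simp only [map_zero]
      | add x y hx hy => simp only [map_add, hx, hy]
      | tmul b y => exact barStep_left q a b y
    rw [← mul_one a, barStep_left, h', barStep_one_tmul, map_sub, barStep_one_tmul,
      sub_sub_cancel, h, TensorProduct.tmul_zero, map_zero]

end

/-- This is the contraction identity for `x ↦ 1 ⊗ x`, from which exactness of the bar resolution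
follows. -/
theorem barD_one_tmul (n : ℕ) (x : A ⊗[k] iter k A A n) :
    barD k A (n + 1) ((1 : A) ⊗ₜ[k] x : A ⊗[k] iter k A A (n + 1)) =
      x - (1 : A) ⊗ₜ[k] barD k A n x :=
  barStep_one_tmul (barD k A n) x

theorem barD_barD : ∀ (n : ℕ) (x : A ⊗[k] iter k A A (n + 1)),
    barD k A n (barD k A (n + 1) x) = 0
  | 0, x => by
    have : LinearMap.mul' k A ∘ₗ barStep (LinearMap.mul' k A) = 0 := by
      ext a b c
      simp [barStep_tmul, mul_assoc]
    exact LinearMap.congr_fun this x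
  | n + 1, x => barStep_barStep (barD_barD n) x

variable (k A) in
theorem bar_isExact : (bar k A).IsExact where
  exact_succ n := fun (x : A ⊗[k] iter k A A (n + 1)) => by
    constructor
    · intro hx
      refine ⟨((1 : A) ⊗ₜ[k] x : A ⊗[k] (A ⊗[k] iter k A A (n + 1))), ?_⟩
      refine (barD_one_tmul (n + 1) x).trans ?_
      rw [show barD k A (n + 1) x = 0 from hx, TensorProduct.tmul_zero, sub_zero]
    · rintro ⟨y, rfl⟩
      exact barD_barD (n + 1) y
  exact_zero := fun (x : A ⊗[k] iter k A A 0) => by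
    constructor
    · intro hx
      refine ⟨((1 : A) ⊗ₜ[k] x : A ⊗[k] (A ⊗[k] iter k A A 0)), ?_⟩
      refine (barD_one_tmul 0 x).trans ?_
      rw [show barD k A 0 x = 0 from hx, TensorProduct.tmul_zero, sub_zero]
    · rintro ⟨y, rfl⟩
      exact barD_barD 0 y
  surjective a := ⟨((1 : A) ⊗ₜ[k] a : A ⊗[k] A), mul'_one_tmul (k := k) a⟩

theorem ker_reduce : LinearMap.ker (reduce k A) = 1 := by
  rw [reduce, Submodule.ker_mkQ, Submodule.one_eq_span]

/-- The kernel of the quotient map is `k 1`, which is stable, so `τ` descends. -/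
theorem exists_reducedTwist :
    ∃ t : B ⊗[k] Reduced k A ≃ₗ[k] Reduced k A ⊗[k] B,
      Intertwines (reduce k A) τ.toEquiv t :=
  exists_intertwines_of_surjective reduce_surjective (ker_reduce (k := k) (A := A) ▸ τ.stable_one)

/-- The map of `A / k 1` induced by `τ`. -/
def reducedTwist : B ⊗[k] Reduced k A ≃ₗ[k] Reduced k A ⊗[k] B :=
  Classical.choose (exists_reducedTwist τ)

theorem reducedTwist_intertwines : Intertwines (reduce k A) τ.toEquiv (reducedTwist τ) :=
  Classical.choose_spec (exists_reducedTwist τ)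

theorem barToReduced_intertwines (n : ℕ) : Intertwines
    (LinearMap.lTensor A (iterMap A (reduce k A) n))
    (moveStep τ.toEquiv (iterMove τ.toEquiv τ.toEquiv n))
    (moveStep τ.toEquiv (iterMove (reducedTwist τ) τ.toEquiv n)) :=
  ((reducedTwist_intertwines τ).iterMap n).lTensor

theorem iterMap_reduce_surjective : ∀ n, Function.Surjective (iterMap A (reduce k A) n)
  | 0 => Function.surjective_id
  | n + 1 => TensorProduct.map_surjective reduce_surjective (iterMap_reduce_surjective n)

variable (k A) in
theorem barToReduced_surjective (n : ℕ) : Function.Surjective (barToReduced k A n) :=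
  LinearMap.lTensor_surjective A (iterMap_reduce_surjective n)

/-- The map induced by the iteration of `τ` on the terms of the reduced bar resolution. -/
def reducedBarTwist (n : ℕ) :
    B ⊗[k] (reducedBar k A).X n ≃ₗ[k] (reducedBar k A).X n ⊗[k] B :=
  moveStep τ.toEquiv (iterMove (reducedTwist τ) τ.toEquiv n)

/-- The maps induced by the iterations of `τ` on the reduced bar resolution. -/
def reducedBarCompatible : CompatibleTwist τ (reducedBar k A) where
  tw n := CompatibleMap.ofIntertwines (reducedBarTwist τ n)
    (τ.isMulTwist.moveStep ((IsMulTwist.of_surjective reduce_surjective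
      (reducedTwist_intertwines τ) τ.isMulTwist).iterMove τ.isMulTwist n))
    (inducedBimodule_intertwines (iterRight k (Reduced k A) A n)
      (rightMap_iterRight_intertwines (reducedTwist τ) n))
  d_comm n := by
    -- The differential is induced from the bar resolution, where it already commutes with the
    -- moves.
    refine Intertwines.of_surjective (barToReduced_surjective k A (n + 1))
      (barToReduced_intertwines τ (n + 1)) ?_
    have : (reducedBar k A).dₖ n ∘ₗ barToReduced k A (n + 1) =
        barToReduced k A n ∘ₗ (bar k A).dₖ n := LinearMap.ext (barToReduced_comm n)
    rw [this]
    exact Intertwines.comp (barToReduced_intertwines τ n) (barD_intertwines τ (n + 1))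
  ε_comm := τ.intertwines_mul

theorem reducedBarCompatible_isReducedBarTwist : IsReducedBarTwist (reducedBarCompatible τ) :=
  fun n => by
    rw [barTwist_eq]
    exact (barToReduced_intertwines τ n).symm

/-- The condition fixes the twist on the image of a surjection, so it must be the one constructed
above, for which generators are known. -/
theorem IsReducedBarTwist.exists_basis {c : CompatibleTwist τ (reducedBar k A)}
    (h : IsReducedBarTwist c) (n : ℕ) :
    Nonempty (TwistBasis.{_, u, _, _, _} A (c.tw n).toEquiv) := by
  have : (c.tw n).toEquiv = reducedBarTwist τ n := by
    refine LinearEquiv.toLinearMap_injective (LinearMap.ext fun x => ?_)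
    obtain ⟨x, rfl⟩ := LinearMap.lTensor_surjective B (barToReduced_surjective k A n) x
    exact LinearMap.congr_fun ((h n).trans (reducedBarCompatible_isReducedBarTwist τ n).symm) x
  rw [this]
  exact ⟨(iterBasis τ (reducedTwist τ) n).toTwistBasis (τ := τ)⟩

theorem reducedStep_one_tmul {Y : Type*} [AddCommGroup Y] [Module k Y] (q : A ⊗[k] Y →ₗ[k] Y)
    (hq : ∀ y, q (1 ⊗ₜ y) = y) (x : A ⊗[k] Y) :
    reducedStep q hq (1 ⊗ₜ LinearMap.rTensor Y (reduce k A) x) = x - 1 ⊗ₜ q x := by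
  induction x using TensorProduct.induction_on with
  | zero => simp only [map_zero, TensorProduct.tmul_zero, sub_zero]
  | add x y hx hy => simp only [map_add, TensorProduct.tmul_add, hx, hy, add_sub_add_comm]
  | tmul a y => rw [LinearMap.rTensor_tmul, reducedStep_tmul, one_mul]

/-- Sending `x` to `1 ⊗ x`, with the first factor of `x` read modulo `k 1`, plays the role of the
contraction of the bar resolution. -/
theorem reducedD_one_tmul (n : ℕ) (x : A ⊗[k] iter k (Reduced k A) A n) :
    reducedD k A n ((1 : A) ⊗ₜ[k] (LinearMap.rTensor _ (reduce k A) x :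
      Reduced k A ⊗[k] iter k (Reduced k A) A n)) =
      x - (1 : A) ⊗ₜ[k] (reducedAux k A n).1 x :=
  reducedStep_one_tmul _ _ x

/-- Inherited from the bar resolution, which surjects onto the reduced one. -/
theorem reducedBar_d_d (n : ℕ) (x : (reducedBar k A).X (n + 2)) :
    (reducedBar k A).d n ((reducedBar k A).d (n + 1) x) = 0 := by
  obtain ⟨x, rfl⟩ := barToReduced_surjective k A (n + 2) x
  rw [barToReduced_comm, barToReduced_comm]
  exact (congrArg _ (barD_barD (n + 1) x)).trans (map_zero _)

theorem reducedBar_ε_d (x : (reducedBar k A).X 1) :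
    (reducedBar k A).ε ((reducedBar k A).d 0 x) = 0 := by
  obtain ⟨x, rfl⟩ := barToReduced_surjective k A 1 x
  rw [barToReduced_comm]
  have h : LinearMap.mul' k A ∘ₗ LinearMap.lTensor A LinearMap.id = LinearMap.mul' k A := by
    rw [LinearMap.lTensor_id, LinearMap.comp_id]
  exact (LinearMap.congr_fun h _).trans (barD_barD 0 x)

variable (k A) in
theorem reducedBar_isExact : (reducedBar k A).IsExact where
  exact_succ n := fun (x : A ⊗[k] iter k (Reduced k A) A (n + 1)) => by
    constructor
    · intro hx
      refine ⟨(1 : A) ⊗ₜ[k] (LinearMap.rTensor _ (reduce k A) x :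
        Reduced k A ⊗[k] iter k (Reduced k A) A (n + 1)), ?_⟩
      refine (reducedD_one_tmul (n + 1) x).trans ?_
      -- In positive degree the auxiliary map is the differential followed by a quotient map, so it
      -- kills cycles.
      have h : (reducedAux k A (n + 1)).1 x = 0 :=
        (congrArg (LinearMap.rTensor _ (reduce k A)) hx).trans (map_zero _)
      rw [h, TensorProduct.tmul_zero, sub_zero]
    · rintro ⟨y, rfl⟩
      exact reducedBar_d_d n y
  exact_zero := fun (x : A ⊗[k] iter k (Reduced k A) A 0) => by
    constructor
    · intro hx
      refine ⟨(1 : A) ⊗ₜ[k] (LinearMap.rTensor _ (reduce k A) x :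
        Reduced k A ⊗[k] iter k (Reduced k A) A 0), ?_⟩
      refine (reducedD_one_tmul 0 x).trans ?_
      rw [show (reducedAux k A 0).1 x = 0 from hx, TensorProduct.tmul_zero, sub_zero]
    · rintro ⟨y, rfl⟩
      exact reducedBar_ε_d y
  surjective a := ⟨((1 : A) ⊗ₜ[k] a : A ⊗[k] A), mul'_one_tmul (k := k) a⟩

end BarTwists

/-! ### The Koszul complex as a subcomplex of the bar resolution. -/

section KoszulEmbedding

universe u

variable {k : Type*} [Field k]

section
variable {A V Y Y' : Type*} [Ring A] [Algebra k A] [AddCommGroup V] [Module k V]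
  [AddCommGroup Y] [Module k Y] [AddCommGroup Y'] [Module k Y'] (i : V →ₗ[k] A)

theorem mulFirst_map (g : Y' →ₗ[k] Y) (S : Submodule k Y') (a : A) (w : V ⊗[k] S) :
    LinearMap.rTensor Y (LinearMap.mul' k A) ((TensorProduct.assoc k A A Y).symm
      (a ⊗ₜ TensorProduct.map i g (LinearMap.lTensor V S.subtype w))) =
      LinearMap.lTensor A (g ∘ₗ S.subtype) (mulFirst i S (a ⊗ₜ w)) := by
  induction w using TensorProduct.induction_on with
  | zero => simp only [map_zero, TensorProduct.tmul_zero]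
  | add x y hx hy => simp only [map_add, TensorProduct.tmul_add, hx, hy]
  | tmul v s => simp [mulFirst]

/-- Multiplying the first two factors kills `R ⊗ Y'`, as the relations have product zero. -/
theorem mul_relFirst {R : Submodule k (V ⊗[k] V)}
    (hR : R ≤ LinearMap.ker (LinearMap.mul' k A ∘ₗ TensorProduct.map i i)) (g : Y' →ₗ[k] Y)
    {x : V ⊗[k] (V ⊗[k] Y')} (hx : x ∈ relFirst R Y') :
    LinearMap.rTensor Y (LinearMap.mul' k A) ((TensorProduct.assoc k A A Y).symm
      (TensorProduct.map i (TensorProduct.map i g) x)) = 0 := by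
  obtain ⟨w, rfl⟩ := hx
  induction w using TensorProduct.induction_on with
  | zero => simp only [map_zero]
  | add x y hx hy => simp only [map_add, hx, hy, add_zero]
  | tmul r y =>
    have key : ∀ u : V ⊗[k] V, LinearMap.rTensor Y (LinearMap.mul' k A)
        ((TensorProduct.assoc k A A Y).symm (TensorProduct.map i (TensorProduct.map i g)
          (TensorProduct.assoc k V V Y' (u ⊗ₜ y)))) =
        LinearMap.mul' k A (TensorProduct.map i i u) ⊗ₜ g y := by
      intro u
      induction u using TensorProduct.induction_on with
      | zero => simp only [map_zero, TensorProduct.zero_tmul]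
      | add x y hx hy => simp only [map_add, TensorProduct.add_tmul, hx, hy]
      | tmul v w => simp
    refine (key r.1).trans ?_
    rw [show LinearMap.mul' k A (TensorProduct.map i i r.1) = 0 from hR r.2,
      TensorProduct.zero_tmul]

/-- Induction step for `barD_iterMap`: of the two terms of `barStep`, the product of the first two
factors dies on relations, and the other contributes a sign and the operation `p` on the later
factors. -/
theorem barStep_map {R : Submodule k (V ⊗[k] V)}
    (hR : R ≤ LinearMap.ker (LinearMap.mul' k A ∘ₗ TensorProduct.map i i))
    (q : A ⊗[k] Y →ₗ[k] Y) (g : Y' →ₗ[k] Y) (p : V ⊗[k] Y' →ₗ[k] Y') (c : ℤ)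
    {S : Submodule k (V ⊗[k] Y')} (hS : ∀ s ∈ S, q (TensorProduct.map i g s) = c • g (p s))
    {x : V ⊗[k] (V ⊗[k] Y')} (hx : x ∈ relFirst R Y') (hx' : x ∈ relNext V S) :
    barStep q (TensorProduct.map i (TensorProduct.map i g) x) =
      (-c) • TensorProduct.map i g (LinearMap.lTensor V p x) := by
  have h : LinearMap.lTensor A q (TensorProduct.map i (TensorProduct.map i g) x) =
      c • TensorProduct.map i g (LinearMap.lTensor V p x) := by
    obtain ⟨w, rfl⟩ := hx'
    clear hx
    induction w using TensorProduct.induction_on with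
    | zero => simp only [map_zero, smul_zero]
    | add x y hx hy => simp only [map_add, smul_add, hx, hy]
    | tmul v s =>
      simp only [LinearMap.lTensor_tmul, TensorProduct.map_tmul]
      rw [Submodule.subtype_apply, hS s.1 s.2, TensorProduct.tmul_smul]
  rw [barStep, LinearMap.sub_apply, LinearMap.comp_apply, h, LinearEquiv.coe_coe,
    mul_relFirst i hR g hx, zero_sub, neg_smul]

end

variable {A V X X' : Type u} [Ring A] [Algebra k A] [AddCommGroup V] [Module k V]
  [AddCommGroup X] [Module k X] [AddCommGroup X'] [Module k X']
  {R : Submodule k (V ⊗[k] V)} {i : V →ₗ[k] A}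

/-- On `K (n + 1) ⊗ A` all products of neighbouring factors in `V` vanish. Only the product of the
last factor of `V` with `A` survives, with its sign from the bar differential. -/
theorem barD_iterMap (hR : R ≤ LinearMap.ker (LinearMap.mul' k A ∘ₗ TensorProduct.map i i)) :
    ∀ (n : ℕ) (x : iter k V A (n + 1)), x ∈ kosSpace R A (n + 1) →
      barD k A n (iterMap A i (n + 1) x) = (-1 : ℤ) ^ n • iterMap A i n (mulLast i n x)
  | 0, x, _ => by
    have h : LinearMap.mul' k A ∘ₗ TensorProduct.map i LinearMap.id =
        LinearMap.mul' k A ∘ₗ LinearMap.rTensor A i := rfl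
    rw [pow_zero, one_smul]
    exact LinearMap.congr_fun h x
  | n + 1, x, hx => by
    refine (barStep_map i hR (barD k A n) (iterMap A i n) (mulLast i n) ((-1) ^ n)
      (S := kosSpace R A (n + 1)) (fun s hs => barD_iterMap hR n s hs)
      ((mem_kosSpace R A).mp hx 0) (kosSpace_succ_le R A (n + 1) hx)).trans ?_
    rw [pow_succ, mul_neg_one]
    rfl

/-- The product into the left factor `A` is `kosLeft`. The remaining terms reduce to the last
product, with sign `(-1)^n` from `barD` and one more minus sign from `barStep`; together these give
the sign in `kosD`. -/
theorem koszulToBar_d (hR : R ≤ LinearMap.ker (LinearMap.mul' k A ∘ₗ TensorProduct.map i i))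
    (n : ℕ) (x : A ⊗[k] kosSpace R A (n + 1)) :
    LinearMap.lTensor A (iterMap A i n ∘ₗ (kosSpace R A n).subtype) (kosD R i n x) =
      barStep (barD k A n)
        (LinearMap.lTensor A (TensorProduct.map i (iterMap A i n) ∘ₗ
          (kosSpace R A (n + 1)).subtype) x) := by
  induction x using TensorProduct.induction_on with
  | zero => simp only [map_zero]
  | add x y hx hy => simp only [map_add, hx, hy]
  | tmul a x =>
  have h₁ := mulFirst_map i (iterMap A i n) (kosSpace R A n) a (kosHead R A n x)
  rw [show LinearMap.lTensor V (kosSpace R A n).subtype (kosHead R A n x) = x.1 from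
      lTensor_intoTensor _ _] at h₁
  have h₂ : LinearMap.lTensor A (barD k A n)
      (a ⊗ₜ (TensorProduct.map i (iterMap A i n) x.1 : A ⊗[k] iter k A A n)) =
      (-1 : ℤ) ^ n • LinearMap.lTensor A (iterMap A i n ∘ₗ (kosSpace R A n).subtype)
        (LinearMap.lTensor A (kosRight R i n) (a ⊗ₜ x)) := by
    rw [LinearMap.lTensor_tmul]
    refine (congrArg (fun z => a ⊗ₜ[k] z) (barD_iterMap hR n x.1 x.2)).trans ?_
    exact TensorProduct.tmul_smul _ _ _
  rw [LinearMap.lTensor_tmul, barStep, LinearMap.sub_apply, LinearMap.comp_apply,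
    LinearEquiv.coe_coe]
  refine Eq.trans ?_ (congrArg₂ (· - ·) h₁ h₂).symm
  rw [kosD, LinearMap.add_apply, LinearMap.smul_apply, pow_succ, mul_neg_one, neg_smul, map_add,
    map_neg, map_zsmul, sub_eq_add_neg]
  rfl

theorem iterMap_injective (hi : Function.Injective i) : ∀ n, Function.Injective (iterMap X i n)
  | 0 => Function.injective_id
  | n + 1 => TensorProduct.map_injective_of_flat_flat _ _ hi (iterMap_injective hi n)

theorem koszulToBar_injective (hi : Function.Injective i) (n : ℕ) :
    Function.Injective (koszulToBar R i n) :=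
  Module.Flat.lTensor_preserves_injective_linearMap _
    ((iterMap_injective hi n).comp (kosSpace R A n).injective_subtype)

theorem iterLast_mem (R : Submodule k (V ⊗[k] V)) (f : X →ₗ[k] X') :
    ∀ n j (x : iter k V X n), x ∈ relAt R X n j → iterLast V f n x ∈ relAt R X' n j
  | 0, _, _, _ => trivial
  | 1, _, _, _ => trivial
  | _ + 2, 0, _, hx => relFirst_map R _ hx
  | n + 2, j + 1, _, hx => relNext_map _ (iterLast_mem R f (n + 1) j) hx

/-- The map `K n ⊗ X → K n ⊗ X'` given by a map `X → X'`. -/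
def kosLast (R : Submodule k (V ⊗[k] V)) (f : X →ₗ[k] X') (n : ℕ) :
    kosSpace R X n →ₗ[k] kosSpace R X' n :=
  (iterLast V f n).restrict fun x hx => (mem_kosSpace R X').mpr fun j =>
    iterLast_mem R f n j x ((mem_kosSpace R X).mp hx j)

end KoszulEmbedding

/-! ### Twists of the Koszul complex and its generators. -/

section KoszulTwists

universe u v

variable {k : Type*} [Field k] {A : Type u} [Ring A] [Algebra k A] {B : Type v} [Ring B]
  [Algebra k B] {τ : TwistingMap k A B} {V : Type u} [AddCommGroup V] [Module k V]
  {tV : B ⊗[k] V ≃ₗ[k] V ⊗[k] B} {R : Submodule k (V ⊗[k] V)} {i : V →ₗ[k] A}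

section
variable (τ) (hR : Stable (moveStep tV tV) R)

/-- The restriction of the iterated twist to `K n ⊗ A`. -/
def kosTwist (n : ℕ) : B ⊗[k] kosSpace R A n ≃ₗ[k] kosSpace R A n ⊗[k] B :=
  (hR.kosSpace (tX := τ.toEquiv) n).restrict

theorem kosTwist_intertwines (n : ℕ) : Intertwines (kosSpace R A n).subtype (kosTwist τ hR n)
    (iterMove tV τ.toEquiv n) :=
  (hR.kosSpace (tX := τ.toEquiv) n).intertwines

theorem rightMap_kosAct (n : ℕ) : (kosSpace R A n).subtype ∘ₗ rightMap (kosAct R A n) =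
    rightMap (iterRight k V A n) ∘ₗ LinearMap.rTensor A (kosSpace R A n).subtype := by
  refine TensorProduct.ext' fun x a => ?_
  rw [LinearMap.comp_apply, LinearMap.comp_apply, rightMap_tmul, LinearMap.rTensor_tmul,
    rightMap_tmul]
  rfl

/-- Both the action and the twist are restricted from `V ⊗ ⋯ ⊗ V ⊗ A`, where the claim is known. -/
theorem rightMap_kosAct_intertwines (n : ℕ) : Intertwines (rightMap (kosAct R A n))
    (moveStep (kosTwist τ hR n) τ.toEquiv) (kosTwist τ hR n) := by
  refine Intertwines.of_injective (kosSpace R A n).injective_subtype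
    (kosTwist_intertwines τ hR n) ?_
  rw [rightMap_kosAct]
  exact (rightMap_iterRight_intertwines tV n).comp (kosTwist_intertwines τ hR n).rTensor

theorem koszulToBar_intertwines (hi : Intertwines i tV τ.toEquiv) (n : ℕ) :
    Intertwines (koszulToBar R i n) (moveStep τ.toEquiv (kosTwist τ hR n))
      (moveStep τ.toEquiv (iterMove τ.toEquiv τ.toEquiv n)) :=
  ((hi.iterMap n).comp (kosTwist_intertwines τ hR n)).lTensor

/-- The generators `K n ⊗ 1` of `K n ⊗ A`. -/
def kosBasis (n : ℕ) : RightBasis (kosAct R A n) (kosTwist τ hR n) where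
  U := kosSpace R (1 : Submodule k A) n
  ι := kosLast R (1 : Submodule k A).subtype n
  e := (hR.kosSpace (tX := τ.stable_one.restrict) n).restrict
  intertwines := by
    refine Intertwines.of_injective (kosSpace R A n).injective_subtype
      (kosTwist_intertwines τ hR n) ?_
    exact (τ.stable_one.intertwines.iterLast n).comp
      (hR.kosSpace (tX := τ.stable_one.restrict) n).intertwines
  bijective := by
    have hm := mulSubspace_bijective (1 : Submodule k A) rfl
    -- The action map on generators is the identification `(K n ⊗ k 1) ⊗ A ≃ K n ⊗ A` induced by `k
    -- 1 ⊗ A ≃ A`, which is bijective.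
    have h : rightMap (kosAct R A n) ∘ₗ
        LinearMap.rTensor A (kosLast R (1 : Submodule k A).subtype n) =
        (Extends.kosSpace R hm n).restrict := by
      refine LinearMap.ext fun x => (kosSpace R A n).injective_subtype ?_
      have h₁ := LinearMap.congr_fun (rightMap_kosAct (R := R) (A := A) n)
        (LinearMap.rTensor A (kosLast R (1 : Submodule k A).subtype n) x)
      have h₂ := LinearMap.congr_fun (rightMap_iterLast (1 : Submodule k A) V n)
        (LinearMap.rTensor A (kosSpace R (1 : Submodule k A) n).subtype x)
      refine h₁.trans (Eq.trans ?_ h₂)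
      simp only [LinearMap.comp_apply]
      rw [← LinearMap.comp_apply (LinearMap.rTensor _ _), ← LinearMap.rTensor_comp,
        ← LinearMap.comp_apply (LinearMap.rTensor _ _) (LinearMap.rTensor _ _),
        ← LinearMap.rTensor_comp]
      rfl
    rw [h]
    exact (Extends.kosSpace R hm n).restrict_bijective (iterExtend_bijective hm n)

/-- The restrictions of the iterations of `τ` to the terms of the Koszul complex. -/
def koszulCompatible (hi : Function.Injective i) (hiV : Intertwines i tV τ.toEquiv)
    (hRi : R ≤ LinearMap.ker (LinearMap.mul' k A ∘ₗ TensorProduct.map i i)) :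
    CompatibleTwist τ (koszulSequence R i) where
  tw n := CompatibleMap.ofIntertwines (moveStep τ.toEquiv (kosTwist τ hR n))
    (τ.isMulTwist.moveStep (IsMulTwist.of_injective (kosSpace R A n).injective_subtype
      (kosTwist_intertwines τ hR n)
      ((IsMulTwist.of_injective hi hiV τ.isMulTwist).iterMove τ.isMulTwist n)))
    (inducedBimodule_intertwines (kosAct R A n) (rightMap_kosAct_intertwines τ hR n))
  d_comm n := by
    -- Checked in the bar resolution, into which the Koszul complex embeds compatibly with
    -- differentials and moves.
    refine Intertwines.of_injective (koszulToBar_injective hi n)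
      (koszulToBar_intertwines τ hR hiV n) ?_
    have : koszulToBar R i n ∘ₗ (koszulSequence R i).dₖ n =
      barD k A (n + 1) ∘ₗ koszulToBar R i (n + 1) :=
        LinearMap.ext (koszulToBar_d hRi n)
    rw [this]
    exact Intertwines.comp (barD_intertwines τ (n + 1)) (koszulToBar_intertwines τ hR hiV (n + 1))
  ε_comm := by
    exact Intertwines.comp τ.intertwines_mul (koszulToBar_intertwines τ hR hiV 0)

end

variable {𝒜 : ℕ → Submodule k A}

/-- The relations form the kernel of `A₁ ⊗ A₁ → A`, a map which commutes with the moves. -/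
theorem relations_stable (h : Stable τ.toEquiv (𝒜 1)) :
    Stable (moveStep h.restrict h.restrict) (relations 𝒜) :=
  (τ.intertwines_mul.comp (h.intertwines.moveStep h.intertwines)).stable_ker

theorem exists_isKoszulTwist (h : Stable τ.toEquiv (𝒜 1)) :
    ∃ c : CompatibleTwist τ (koszul 𝒜), IsKoszulTwist c :=
  ⟨koszulCompatible τ (relations_stable h) (𝒜 1).injective_subtype h.intertwines le_rfl,
    fun n => by
      rw [barTwist_eq]
      exact koszulToBar_intertwines τ (relations_stable h) h.intertwines n⟩

/-- The embedding into the bar resolution stays injective after tensoring with `B`. Hence the twist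
is determined by the condition and agrees with the restricted one. -/
theorem IsKoszulTwist.exists_basis (h : Stable τ.toEquiv (𝒜 1))
    {c : CompatibleTwist τ (koszul 𝒜)} (hc : IsKoszulTwist c) (n : ℕ) :
    Nonempty (TwistBasis.{_, u, _, _, _} A (c.tw n).toEquiv) := by
  have h₁ : (c.tw n).toEquiv = moveStep τ.toEquiv (kosTwist τ (relations_stable h) n) := by
    refine LinearEquiv.toLinearMap_injective (LinearMap.ext fun x => ?_)
    refine Module.Flat.rTensor_preserves_injective_linearMap (M := B) (koszulEmbedding 𝒜 n)
      (koszulToBar_injective (𝒜 1).injective_subtype n) ?_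
    have h₂ := hc n
    rw [barTwist_eq] at h₂
    exact LinearMap.congr_fun (h₂.trans
      (koszulToBar_intertwines τ (relations_stable h) h.intertwines n).symm) x
  rw [h₁]
  exact ⟨(kosBasis τ (relations_stable h) n).toTwistBasis (τ := τ)⟩

section
variable [GradedAlgebra 𝒜]

/-- The graded piece is the range of its projection, and ranges of intertwiners are stable. -/
theorem stable_of_proj {j : ℕ}
    (h : Intertwines (GradedAlgebra.proj 𝒜 j) τ.toEquiv τ.toEquiv) :
    Stable τ.toEquiv (𝒜 j) := by
  have : LinearMap.range (GradedAlgebra.proj 𝒜 j) = 𝒜 j := by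
    ext a
    constructor
    · rintro ⟨a, rfl⟩
      exact SetLike.coe_mem _
    · exact fun ha => ⟨a, DirectSum.decompose_of_mem_same 𝒜 ha⟩
  have h' := h.stable_range
  rwa [this] at h'

variable {ℬ : ℕ → Submodule k B} [GradedAlgebra ℬ]

/-- On homogeneous elements this is the definition of strong grading. Together with bijectivity of
`τ` it upgrades the assumed inclusions to the equivalence required by `Stable`. -/
theorem TwistingMap.StronglyGraded.proj_left (h : τ.StronglyGraded 𝒜 ℬ) (i : ℕ) (a : A) (b : B) :
    LinearMap.rTensor B (GradedAlgebra.proj 𝒜 i) (τ.toEquiv (b ⊗ₜ a)) =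
      τ.toEquiv (b ⊗ₜ GradedAlgebra.proj 𝒜 i a) := by
  induction a using DirectSum.Decomposition.inductionOn 𝒜 with
  | zero => simp only [map_zero, TensorProduct.tmul_zero]
  | add x y hx hy => simp only [map_add, TensorProduct.tmul_add, hx, hy]
  | @homogeneous i' a =>
  induction b using DirectSum.Decomposition.inductionOn ℬ with
  | zero => simp only [map_zero, TensorProduct.zero_tmul]
  | add x y hx hy => simp only [map_add, TensorProduct.add_tmul, hx, hy]
  | @homogeneous j b =>
  obtain ⟨w, hw⟩ := h i' j a.1 a.2 b.1 b.2
  rw [← hw, ← LinearMap.comp_apply, LinearMap.rTensor, ← TensorProduct.map_comp,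
    GradedAlgebra.proj_apply]
  by_cases hi : i' = i
  · subst hi
    rw [DirectSum.decompose_of_mem_same 𝒜 a.2, ← hw]
    congr 2
    exact LinearMap.ext fun a => DirectSum.decompose_of_mem_same 𝒜 a.2
  · rw [DirectSum.decompose_of_mem_ne 𝒜 a.2 hi, TensorProduct.tmul_zero, map_zero,
      show GradedAlgebra.proj 𝒜 i ∘ₗ (𝒜 i').subtype = 0 from
        LinearMap.ext fun a => DirectSum.decompose_of_mem_ne 𝒜 a.2 hi,
      TensorProduct.map_zero_left, LinearMap.zero_apply]

theorem TwistingMap.StronglyGraded.proj_right (h : τ.StronglyGraded 𝒜 ℬ) (j : ℕ) (a : A) (b : B) :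
    LinearMap.lTensor A (GradedAlgebra.proj ℬ j) (τ.toEquiv (b ⊗ₜ a)) =
      τ.toEquiv (GradedAlgebra.proj ℬ j b ⊗ₜ a) := by
  induction a using DirectSum.Decomposition.inductionOn 𝒜 with
  | zero => simp only [map_zero, TensorProduct.tmul_zero]
  | add x y hx hy => simp only [map_add, TensorProduct.tmul_add, hx, hy]
  | @homogeneous i a =>
  induction b using DirectSum.Decomposition.inductionOn ℬ with
  | zero => simp only [map_zero, TensorProduct.zero_tmul]
  | add x y hx hy => simp only [map_add, TensorProduct.add_tmul, hx, hy]
  | @homogeneous j' b =>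
  obtain ⟨w, hw⟩ := h i j' a.1 a.2 b.1 b.2
  rw [← hw, ← LinearMap.comp_apply, LinearMap.lTensor, ← TensorProduct.map_comp,
    GradedAlgebra.proj_apply]
  by_cases hj : j' = j
  · subst hj
    rw [DirectSum.decompose_of_mem_same ℬ b.2, ← hw]
    congr 2
    exact LinearMap.ext fun b => DirectSum.decompose_of_mem_same ℬ b.2
  · rw [DirectSum.decompose_of_mem_ne ℬ b.2 hj, TensorProduct.zero_tmul, map_zero,
      show GradedAlgebra.proj ℬ j ∘ₗ (ℬ j').subtype = 0 from
        LinearMap.ext fun b => DirectSum.decompose_of_mem_ne ℬ b.2 hj,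
      TensorProduct.map_zero_right, LinearMap.zero_apply]

theorem TwistingMap.StronglyGraded.stable (h : τ.StronglyGraded 𝒜 ℬ) (i : ℕ) :
    Stable τ.toEquiv (𝒜 i) :=
  stable_of_proj (Intertwines.of_tmul fun b a => h.proj_left i a b)

/-- Commutation of the projections of `B` with `τ` passes to the inverse, so strong grading need not
be assumed for `τ.symm`. -/
theorem TwistingMap.StronglyGraded.stable_symm (h : τ.StronglyGraded 𝒜 ℬ) (j : ℕ) :
    Stable τ.symm.toEquiv (ℬ j) := by
  have h' : LinearMap.lTensor A (GradedAlgebra.proj ℬ j) ∘ₗ τ.toEquiv.toLinearMap =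
      τ.toEquiv.toLinearMap ∘ₗ LinearMap.rTensor A (GradedAlgebra.proj ℬ j) :=
    TensorProduct.ext' fun b a => h.proj_right j a b
  exact stable_of_proj (LinearMap.ext fun x => comm_symm h' x)

end

end KoszulTwists

/-! ### Removing leading terms of cycles. -/

section LeadingTerms

variable {k : Type*} [Field k] {C₂ C₁ C₀ : Type*} [AddCommGroup C₂] [Module k C₂]
  [AddCommGroup C₁] [Module k C₁] [AddCommGroup C₀] [Module k C₀]

/-- A cycle whose components in all degrees are eventually zero is a boundary if its leading
components are images under the part `l` of degree one of the differential `l + r`. -/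
theorem mem_range_of_leading {l r : C₂ →ₗ[k] C₁} {d : C₁ →ₗ[k] C₀}
    {π : ℕ → Module.End k C₁} {π' : ℕ → Module.End k C₂}
    (hl₀ : ∀ w, π 0 (l w) = 0) (hl : ∀ m w, π (m + 1) (l w) = l (π' m w))
    (hr : ∀ m w, π m (r w) = r (π' m w)) (hπ : ∀ m z, π m (π m z) = π m z)
    (hne : ∀ j m, j ≠ m → ∀ z, π j (π m z) = 0) (hne' : ∀ j m, j ≠ m → ∀ w, π' j (π' m w) = 0)
    (hsep : ∀ z, (∀ j, π j z = 0) → z = 0) (hd : ∀ w, d (l w + r w) = 0)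
    (hlead : ∀ z m, d z = 0 → (∀ j, m < j → π j z = 0) → ∃ w, l w = π m z) :
    ∀ (m : ℕ) (z : C₁), d z = 0 → (∀ j, m ≤ j → π j z = 0) → ∃ w, l w + r w = z
  | 0, z, _, hm => ⟨0, by rw [map_zero, map_zero, add_zero, hsep z fun j => hm j (Nat.zero_le j)]⟩
  | m + 1, z, hz, hm => by
    -- As `r` keeps the degree, `w` has to live in degrees below `m`; otherwise subtracting `l w + r
    -- w` would create new components in degree `m` or above.
    obtain ⟨w, hw, hw'⟩ : ∃ w, l w = π m z ∧ ∀ j, m ≤ j → π' j w = 0 := by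
      obtain ⟨w, hw⟩ := hlead z m hz fun j hj => hm j hj
      cases m with
      | zero =>
        -- In degree zero the leading component is itself zero, because the image of `l` has no
        -- component there.
        refine ⟨0, ?_, fun j _ => map_zero _⟩
        rw [map_zero, ← hπ, ← hw, hl₀]
      | succ m =>
        -- Only the part of `w` one degree below the leading component is needed, as `l` raises the
        -- degree by one.
        exact ⟨π' m w, by rw [← hl, hw, hπ], fun j hj => hne' j m (by omega) w⟩
    obtain ⟨w', h⟩ := mem_range_of_leading hl₀ hl hr hπ hne hne' hsep hd hlead m
      (z - (l w + r w)) (by rw [map_sub, hz, hd, sub_zero]) fun j hj => by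
        rw [map_sub, map_add, hr, hw' j hj, map_zero, add_zero, hw]
        rcases hj.eq_or_lt with rfl | hj
        · rw [hπ, sub_self]
        · rw [hm j hj, hne j m hj.ne', sub_self]
    refine ⟨w' + w, ?_⟩
    rw [map_add, map_add, add_add_add_comm, h, sub_add_cancel]

end LeadingTerms

/-! ### Exactness of the bimodule Koszul complex. -/

section KoszulExact

universe u

variable {k : Type*} [Field k]

section
variable {A V Y Y' Z : Type*} [Ring A] [Algebra k A] [AddCommGroup V] [Module k V]
  [AddCommGroup Y] [Module k Y] [AddCommGroup Y'] [Module k Y'] [AddCommGroup Z] [Module k Z]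

theorem mulFirst_extendStep (i : V →ₗ[k] A) (m : Y ⊗[k] Z →ₗ[k] Y')
    (x : (A ⊗[k] (V ⊗[k] Y)) ⊗[k] Z) :
    mulFirst i Y' (extendStep A (extendStep V m) x) =
      extendStep A m (LinearMap.rTensor Z (mulFirst i Y) x) := by
  have : mulFirst i Y' ∘ₗ extendStep A (extendStep V m) =
      extendStep A m ∘ₗ LinearMap.rTensor Z (mulFirst i Y) := by
    ext a v y z
    simp [mulFirst, extendStep]
  exact LinearMap.congr_fun this x

theorem extendStep_natural {W W' : Type*} [AddCommGroup W] [Module k W] [AddCommGroup W']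
    [Module k W'] {m : Y ⊗[k] Z →ₗ[k] Y'} {m' : W ⊗[k] Z →ₗ[k] W'} {f : Y →ₗ[k] W}
    {f' : Y' →ₗ[k] W'} (h : f' ∘ₗ m = m' ∘ₗ LinearMap.rTensor Z f) :
    LinearMap.lTensor V f' ∘ₗ extendStep V m =
      extendStep V m' ∘ₗ LinearMap.rTensor Z (LinearMap.lTensor V f) := by
  rw [extendStep, ← LinearMap.comp_assoc, ← LinearMap.lTensor_comp, h]
  ext v y z
  simp [extendStep]

end

variable {A V X X' Z : Type u} [Ring A] [Algebra k A] [AddCommGroup V] [Module k V]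
  [AddCommGroup X] [Module k X] [AddCommGroup X'] [Module k X'] [AddCommGroup Z] [Module k Z]

section
variable (R : Submodule k (V ⊗[k] V)) {m : X ⊗[k] Z →ₗ[k] X'} (hm : Function.Bijective m)

/-- The map `K n ⊗ X ⊗ Z → K n ⊗ X'` given by a bijection `X ⊗ Z → X'`. -/
def kosExtend (n : ℕ) : kosSpace R X n ⊗[k] Z →ₗ[k] kosSpace R X' n :=
  (Extends.kosSpace R hm n).restrict

theorem kosExtend_bijective (n : ℕ) : Function.Bijective (kosExtend R hm n) :=
  (Extends.kosSpace R hm n).restrict_bijective (iterExtend_bijective hm n)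

theorem kosHead_kosExtend (n : ℕ) :
    kosHead R X' n ∘ₗ kosExtend R hm (n + 1) =
      extendStep V (kosExtend R hm n) ∘ₗ LinearMap.rTensor Z (kosHead R X n) := by
  refine LinearMap.ext fun x => lTensor_subtype_injective V (kosSpace R X' n) ?_
  have h₁ : LinearMap.lTensor V (kosSpace R X n).subtype ∘ₗ kosHead R X n =
      (kosSpace R X (n + 1)).subtype := LinearMap.ext fun y => lTensor_intoTensor _ y
  have h₂ := LinearMap.congr_fun (extendStep_natural (V := V)
    ((Extends.kosSpace R hm n).subtype_restrict)) (LinearMap.rTensor Z (kosHead R X n) x)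
  refine (lTensor_intoTensor _ _).trans (Eq.trans ?_ h₂.symm)
  rw [LinearMap.comp_apply, ← LinearMap.comp_apply (LinearMap.rTensor _ _),
    ← LinearMap.rTensor_comp]
  exact (congrArg (fun f => extendStep V (iterExtend V m n) (LinearMap.rTensor Z f x)) h₁).symm

/-- The left differential does not touch the last factor, so it commutes with changing `X` to `X'`.
-/
theorem kosLeft_kosExtend (i : V →ₗ[k] A) (n : ℕ)
    (x : (A ⊗[k] kosSpace R X (n + 1)) ⊗[k] Z) :
    kosLeft R X' i n (extendStep A (kosExtend R hm (n + 1)) x) =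
      extendStep A (kosExtend R hm n) (LinearMap.rTensor Z (kosLeft R X i n) x) := by
  have h := LinearMap.congr_fun (extendStep_natural (V := A) (kosHead_kosExtend R hm n)) x
  refine (congrArg (mulFirst i _) h).trans ?_
  refine (mulFirst_extendStep i (kosExtend R hm n) _).trans ?_
  rw [kosLeft, LinearMap.rTensor_comp]
  rfl

/-- Tensoring with `Z` is exact, which carries exactness from coefficients `X` to coefficients `X'`.
With `X = A₀` and `Z = X' = A`, it makes the left Koszul complex available inside the bimodule
complex. -/
theorem kosLeft_exact {m : X ⊗[k] Z →ₗ[k] X'} (hm : Function.Bijective m)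
    (i : V →ₗ[k] A) (n : ℕ)
    (h : Function.Exact (kosLeft R X i (n + 1)) (kosLeft R X i n))
    (z : A ⊗[k] kosSpace R X' (n + 1)) (hz : kosLeft R X' i n z = 0) :
    ∃ w, kosLeft R X' i (n + 1) w = z := by
  obtain ⟨x, rfl⟩ := (extendStep_bijective (V := A) (kosExtend_bijective R hm (n + 1))).2 z
  rw [kosLeft_kosExtend] at hz
  have hx := (extendStep_bijective (V := A) (kosExtend_bijective R hm n)).1
    (hz.trans (map_zero _).symm)
  obtain ⟨y, rfl⟩ := (Module.Flat.rTensor_exact Z h x).mp hx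
  exact ⟨_, kosLeft_kosExtend R hm i (n + 1) y⟩

end

/-- The component of degree `m` of `A ⊗ Y` in the grading of `A`. -/
def leftProj (𝒜 : ℕ → Submodule k A) [GradedAlgebra 𝒜] (Y : Type*) [AddCommGroup Y] [Module k Y]
    (m : ℕ) : Module.End k (A ⊗[k] Y) :=
  LinearMap.rTensor Y (GradedAlgebra.proj 𝒜 m)

section
variable {𝒜 : ℕ → Submodule k A} [GradedAlgebra 𝒜] {Y Y' : Type*} [AddCommGroup Y] [Module k Y]
  [AddCommGroup Y'] [Module k Y']

theorem leftProj_leftProj (m : ℕ) (z : A ⊗[k] Y) :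
    leftProj 𝒜 Y m (leftProj 𝒜 Y m z) = leftProj 𝒜 Y m z := by
  rw [leftProj, ← LinearMap.comp_apply, ← LinearMap.rTensor_comp]
  congr 2
  exact LinearMap.ext fun a => DirectSum.decompose_of_mem_same 𝒜 (SetLike.coe_mem _)

theorem leftProj_leftProj_of_ne (j m : ℕ) (h : j ≠ m) (z : A ⊗[k] Y) :
    leftProj 𝒜 Y j (leftProj 𝒜 Y m z) = 0 := by
  rw [leftProj, leftProj, ← LinearMap.comp_apply, ← LinearMap.rTensor_comp,
    show GradedAlgebra.proj 𝒜 j ∘ₗ GradedAlgebra.proj 𝒜 m = 0 from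
      LinearMap.ext fun a => DirectSum.decompose_of_mem_ne 𝒜 (SetLike.coe_mem _) h.symm,
    LinearMap.rTensor_zero, LinearMap.zero_apply]

theorem leftProj_lTensor (f : Y →ₗ[k] Y') (m : ℕ) (z : A ⊗[k] Y) :
    leftProj 𝒜 Y' m (LinearMap.lTensor A f z) = LinearMap.lTensor A f (leftProj 𝒜 Y m z) := by
  rw [leftProj, leftProj, ← LinearMap.comp_apply, ← LinearMap.comp_apply,
    LinearMap.rTensor_comp_lTensor, LinearMap.lTensor_comp_rTensor]

variable (𝒜) in
-- Finiteness of the decomposition: the bound starts the descending removal of leading terms.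
theorem exists_sum_leftProj (z : A ⊗[k] Y) : ∃ M, ∀ N, M ≤ N →
    leftProj 𝒜 Y N z = 0 ∧ ∑ j ∈ Finset.range N, leftProj 𝒜 Y j z = z := by
  classical
  induction z using TensorProduct.induction_on with
  | zero => exact ⟨0, fun N _ => by simp⟩
  | add x y hx hy =>
    obtain ⟨M, hM⟩ := hx
    obtain ⟨M', hM'⟩ := hy
    refine ⟨max M M', fun N hN => ?_⟩
    obtain ⟨h₁, h₂⟩ := hM N (le_of_max_le_left hN)
    obtain ⟨h₃, h₄⟩ := hM' N (le_of_max_le_right hN)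
    simp only [map_add, Finset.sum_add_distrib, h₁, h₂, h₃, h₄, add_zero, and_self]
  | tmul a y =>
    have h : ∃ M, ∀ N, M ≤ N → GradedAlgebra.proj 𝒜 N a = 0 ∧
        ∑ j ∈ Finset.range N, GradedAlgebra.proj 𝒜 j a = a := by
      induction a using DirectSum.Decomposition.inductionOn 𝒜 with
      | zero => exact ⟨0, fun N _ => by simp⟩
      | add x y hx hy =>
        obtain ⟨M, hM⟩ := hx
        obtain ⟨M', hM'⟩ := hy
        refine ⟨max M M', fun N hN => ?_⟩
        obtain ⟨h₁, h₂⟩ := hM N (le_of_max_le_left hN)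
        obtain ⟨h₃, h₄⟩ := hM' N (le_of_max_le_right hN)
        simp only [map_add, Finset.sum_add_distrib, h₁, h₂, h₃, h₄, add_zero, and_self]
      | @homogeneous i a =>
        refine ⟨i + 1, fun N hN => ⟨DirectSum.decompose_of_mem_ne 𝒜 a.2 (by omega), ?_⟩⟩
        rw [Finset.sum_eq_single i]
        · exact DirectSum.decompose_of_mem_same 𝒜 a.2
        · exact fun j _ hj => DirectSum.decompose_of_mem_ne 𝒜 a.2 hj.symm
        · exact fun hi => absurd (Finset.mem_range.mpr (by omega)) hi
    obtain ⟨M, hM⟩ := h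
    refine ⟨M, fun N hN => ?_⟩
    obtain ⟨h₁, h₂⟩ := hM N hN
    simp only [leftProj, LinearMap.rTensor_tmul, h₁, TensorProduct.zero_tmul, true_and]
    rw [← TensorProduct.sum_tmul, h₂]

theorem eq_zero_of_leftProj (z : A ⊗[k] Y) (h : ∀ j, leftProj 𝒜 Y j z = 0) : z = 0 := by
  obtain ⟨M, hM⟩ := exists_sum_leftProj 𝒜 z
  rw [← (hM M le_rfl).2, Finset.sum_eq_zero fun j _ => h j]

theorem leftProj_zero_of_lt (z : A ⊗[k] Y) (h : ∀ j, 0 < j → leftProj 𝒜 Y j z = 0) :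
    leftProj 𝒜 Y 0 z = z := by
  obtain ⟨M, hM⟩ := exists_sum_leftProj 𝒜 z
  rw [← (hM (M + 1) (Nat.le_succ M)).2, Finset.sum_eq_single_of_mem 0 (by simp)
    fun j _ hj => h j (Nat.pos_of_ne_zero hj), leftProj_leftProj]

theorem leftProj_zero_mulFirst (z : A ⊗[k] (𝒜 1 ⊗[k] Y)) :
    leftProj 𝒜 Y 0 (mulFirst (𝒜 1).subtype Y z) = 0 := by
  have : leftProj 𝒜 Y 0 ∘ₗ mulFirst (𝒜 1).subtype Y = 0 := by
    ext a v y
    have h : GradedAlgebra.proj 𝒜 0 (a * v) = 0 :=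
      DirectSum.coe_decompose_mul_of_right_mem_of_not_le 𝒜 v.2 (by omega)
    simp [leftProj, mulFirst, h]
  exact LinearMap.congr_fun this z

/-- Multiplication by an element of `A₁` raises the degree of the left factor by exactly one. -/
theorem leftProj_succ_mulFirst (m : ℕ) (z : A ⊗[k] (𝒜 1 ⊗[k] Y)) :
    leftProj 𝒜 Y (m + 1) (mulFirst (𝒜 1).subtype Y z) =
      mulFirst (𝒜 1).subtype Y (leftProj 𝒜 (𝒜 1 ⊗[k] Y) m z) := by
  have : leftProj 𝒜 Y (m + 1) ∘ₗ mulFirst (𝒜 1).subtype Y =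
      mulFirst (𝒜 1).subtype Y ∘ₗ leftProj 𝒜 (𝒜 1 ⊗[k] Y) m := by
    ext a v y
    have h : GradedAlgebra.proj 𝒜 (m + 1) (a * v) = GradedAlgebra.proj 𝒜 m a * v :=
      DirectSum.coe_decompose_mul_add_of_right_mem 𝒜 v.2
    simp [leftProj, mulFirst, h]
  exact LinearMap.congr_fun this z

theorem exists_one_tmul (h : 𝒜 0 = 1) (z : A ⊗[k] Y) : ∃ y, leftProj 𝒜 Y 0 z = 1 ⊗ₜ y := by
  induction z using TensorProduct.induction_on with
  | zero => exact ⟨0, by simp⟩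
  | add x y hx hy =>
    obtain ⟨x', hx⟩ := hx
    obtain ⟨y', hy⟩ := hy
    exact ⟨x' + y', by rw [map_add, hx, hy, TensorProduct.tmul_add]⟩
  | tmul a y =>
    obtain ⟨c, hc⟩ : ∃ c : k, algebraMap k A c = GradedAlgebra.proj 𝒜 0 a :=
      Submodule.mem_one.mp (h ▸ SetLike.coe_mem (DirectSum.decompose 𝒜 a 0))
    refine ⟨c • y, ?_⟩
    rw [leftProj, LinearMap.rTensor_tmul, ← hc, Algebra.algebraMap_eq_smul_one,
      TensorProduct.smul_tmul]

variable (R : Submodule k (𝒜 1 ⊗[k] 𝒜 1))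

theorem leftProj_zero_kosLeft (n : ℕ) (z : A ⊗[k] kosSpace R X (n + 1)) :
    leftProj 𝒜 (kosSpace R X n) 0 (kosLeft R X (𝒜 1).subtype n z) = 0 :=
  leftProj_zero_mulFirst _

theorem leftProj_succ_kosLeft (m n : ℕ) (z : A ⊗[k] kosSpace R X (n + 1)) :
    leftProj 𝒜 (kosSpace R X n) (m + 1) (kosLeft R X (𝒜 1).subtype n z) =
      kosLeft R X (𝒜 1).subtype n (leftProj 𝒜 (kosSpace R X (n + 1)) m z) := by
  refine (leftProj_succ_mulFirst m _).trans ?_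
  exact congrArg _ (leftProj_lTensor _ m z)

theorem leftProj_extendStep {Z : Type*} [AddCommGroup Z] [Module k Z] (m : Y ⊗[k] Z →ₗ[k] Y')
    (j : ℕ) (x : (A ⊗[k] Y) ⊗[k] Z) :
    leftProj 𝒜 Y' j (extendStep A m x) =
      extendStep A m (LinearMap.rTensor Z (leftProj 𝒜 Y j) x) := by
  have : leftProj 𝒜 Y' j ∘ₗ extendStep A m =
      extendStep A m ∘ₗ LinearMap.rTensor Z (leftProj 𝒜 Y j) := by
    ext a y z
    simp [leftProj, extendStep]
  exact LinearMap.congr_fun this x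

/-- The augmentation of the left Koszul complex sees only the component of degree zero. Without that
component, an element lies in the kernel of the augmentation tensored with `A`, hence in the image
of the left differential. -/
theorem kosLeft_zero_exact (h : IsKoszul 𝒜) (z : A ⊗[k] kosSpace (relations 𝒜) A 0)
    (hz : leftProj 𝒜 (kosSpace (relations 𝒜) A 0) 0 z = 0) :
    ∃ w, kosLeft (relations 𝒜) A (𝒜 1).subtype 0 w = z := by
  have hm := mulSubspace_bijective (𝒜 0) h.connected
  have hb := extendStep_bijective (V := A) (kosExtend_bijective (relations 𝒜) hm 0)
  obtain ⟨x, rfl⟩ := hb.2 z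
  rw [leftProj_extendStep] at hz
  have hx := hb.1 (hz.trans (map_zero _).symm)
  have hε : koszulAugmentation 𝒜 = (LinearMap.mul' k A ∘ₗ LinearMap.lTensor A
      ((𝒜 0).subtype ∘ₗ (kosSpace (relations 𝒜) (𝒜 0) 0).subtype)) ∘ₗ
        leftProj 𝒜 (kosSpace (relations 𝒜) (𝒜 0) 0) 0 := by
    rw [leftProj, LinearMap.comp_assoc, LinearMap.lTensor_comp_rTensor]
    rfl
  obtain ⟨y, rfl⟩ := (Module.Flat.rTensor_exact A h.exact_zero x).mp (by
    rw [hε, LinearMap.rTensor_comp, LinearMap.comp_apply, hx, map_zero])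
  exact ⟨_, kosLeft_kosExtend (relations 𝒜) hm (𝒜 1).subtype 0 y⟩

end

section
variable {R : Submodule k (V ⊗[k] V)} {i : V →ₗ[k] A}

/-- Inherited from `barD_barD`, since the Koszul complex embeds in the bar resolution. -/
theorem kosD_kosD (hi : Function.Injective i)
    (hR : R ≤ LinearMap.ker (LinearMap.mul' k A ∘ₗ TensorProduct.map i i)) (n : ℕ)
    (x : A ⊗[k] kosSpace R A (n + 2)) : kosD R i n (kosD R i (n + 1) x) = 0 :=
  koszulToBar_injective hi n <| (koszulToBar_d hR n _).trans <|
    (congrArg (barD k A (n + 1)) (koszulToBar_d hR (n + 1) x)).trans <|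
      (barD_barD (n + 1) _).trans (map_zero _).symm

theorem kosε_kosD (hR : R ≤ LinearMap.ker (LinearMap.mul' k A ∘ₗ TensorProduct.map i i))
    (x : A ⊗[k] kosSpace R A 1) : kosε R A (kosD R i 0 x) = 0 :=
  (congrArg (LinearMap.mul' k A) (koszulToBar_d hR 0 x)).trans (barD_barD 0 _)

theorem kosε_one_tmul (R : Submodule k (V ⊗[k] V)) (y : kosSpace R A 0) :
    kosε R A (1 ⊗ₜ y) = y.1 :=
  mul'_one_tmul (k := k) (show A from y.1)

end

variable {𝒜 : ℕ → Submodule k A} [GradedAlgebra 𝒜]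

/-- The leading term argument for the degree of the left factor, with `kosD` split into the left
multiplication, which raises this degree, and the signed right multiplication, which preserves it.
-/
theorem exists_kosD_eq {n : ℕ} {C : Type*} [AddCommGroup C] [Module k C]
    {d : A ⊗[k] kosSpace (relations 𝒜) A n →ₗ[k] C}
    (hd : ∀ w, d (kosD (relations 𝒜) (𝒜 1).subtype n w) = 0)
    (hlead : ∀ z m, d z = 0 → (∀ j, m < j → leftProj 𝒜 _ j z = 0) →
      ∃ w, kosLeft (relations 𝒜) A (𝒜 1).subtype n w = leftProj 𝒜 _ m z)
    {z : A ⊗[k] kosSpace (relations 𝒜) A n} (hz : d z = 0) :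
    ∃ w, kosD (relations 𝒜) (𝒜 1).subtype n w = z := by
  obtain ⟨M, hM⟩ := exists_sum_leftProj 𝒜 z
  refine mem_range_of_leading (π := leftProj 𝒜 (kosSpace (relations 𝒜) A n))
    (π' := leftProj 𝒜 (kosSpace (relations 𝒜) A (n + 1)))
    (l := kosLeft (relations 𝒜) A (𝒜 1).subtype n)
    (r := (-1 : ℤ) ^ (n + 1) • LinearMap.lTensor A (kosRight (relations 𝒜) (𝒜 1).subtype n))
    (leftProj_zero_kosLeft _ n) (fun m w => leftProj_succ_kosLeft _ m n w) ?_
    leftProj_leftProj leftProj_leftProj_of_ne leftProj_leftProj_of_ne eq_zero_of_leftProj hd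
    hlead M z hz fun j hj => (hM j hj).1
  intro m w
  rw [LinearMap.smul_apply, map_zsmul, leftProj_lTensor, LinearMap.smul_apply]

/-- Compare components of degree `m + 1` in `l z + r z = 0`: the one of `r z` comes from the
component `m + 1` of `z`, which is zero. -/
theorem kosLeft_leftProj_eq_zero {n m : ℕ} {z : A ⊗[k] kosSpace (relations 𝒜) A (n + 1)}
    (hz : kosD (relations 𝒜) (𝒜 1).subtype n z = 0)
    (hm : leftProj 𝒜 (kosSpace (relations 𝒜) A (n + 1)) (m + 1) z = 0) :
    kosLeft (relations 𝒜) A (𝒜 1).subtype n (leftProj 𝒜 _ m z) = 0 := by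
  rw [← leftProj_succ_kosLeft, eq_neg_of_add_eq_zero_left hz, LinearMap.smul_apply, map_neg,
    map_zsmul, leftProj_lTensor, hm, map_zero, smul_zero, neg_zero]

/-- In each degree only the hypothesis on leading components has to be supplied, and this is where
Koszulness of `A` enters. -/
theorem koszul_isExact (h : IsKoszul 𝒜) : (koszul 𝒜).IsExact where
  exact_succ n := fun z => by
    constructor
    · exact fun hz => exists_kosD_eq (d := kosD (relations 𝒜) (𝒜 1).subtype n)
        (kosD_kosD (𝒜 1).injective_subtype le_rfl n) (fun z m hz hm =>
          kosLeft_exact (relations 𝒜) (mulSubspace_bijective (𝒜 0) h.connected) (𝒜 1).subtype n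
            (h.exact_succ n) _ (kosLeft_leftProj_eq_zero hz (hm (m + 1) (Nat.lt_succ_self m)))) hz
    · rintro ⟨y, rfl⟩
      exact kosD_kosD (𝒜 1).injective_subtype le_rfl n y
  exact_zero := fun z => by
    constructor
    · refine fun hz => exists_kosD_eq (d := kosε (relations 𝒜) A) (kosε_kosD le_rfl)
        (fun z m hz hm => ?_) hz
      -- If the leading degree is zero, connectedness gives `z = 1 ⊗ y`, and `ε z = y` forces `z =
      -- 0`. A component of positive degree is always in the image of the left differential, without
      -- using that `z` is a cycle.
      cases m with
      | zero =>
        obtain ⟨y, hy⟩ := exists_one_tmul h.connected z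
        have hy' : y = 0 := by
          rw [← leftProj_zero_of_lt z hm, hy, kosε_one_tmul] at hz
          exact Subtype.ext hz
        exact ⟨0, by rw [hy, hy', TensorProduct.tmul_zero, map_zero]⟩
      | succ m =>
        exact kosLeft_zero_exact h _ (leftProj_leftProj_of_ne 0 (m + 1) (Nat.succ_ne_zero m).symm z)
    · rintro ⟨y, rfl⟩
      exact kosε_kosD le_rfl y
  surjective a := ⟨(1 : A) ⊗ₜ[k] (⟨a, (mem_kosSpace _ A).mpr fun _ => trivial⟩ :
    kosSpace (relations 𝒜) A 0), kosε_one_tmul _ _⟩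

end KoszulExact

/-! ### Assembling the cases. -/

section Resolutions

universe u v w w'

variable {k : Type*} [Field k] {A : Type u} [Ring A] [Algebra k A] {B : Type v} [Ring B]
  [Algebra k B] {τ : TwistingMap k A B}

/-- Twistings of the exact sequence `P` that satisfy `hP` exist, and for all of them there is a
space of generators past which `B` can be moved. -/
structure TwistsWithBasis (τ : TwistingMap k A B) (P : AugmentedSequence.{_, u, u} k A)
    (hP : CompatibleTwist τ P → Prop) : Prop where
  isExact : P.IsExact
  exists_twist : ∃ c, hP c
  exists_basis : ∀ c, hP c → ∀ n, Nonempty (TwistBasis.{_, u, _, _, _} A (c.tw n).toEquiv)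

/-- The requirements on `P` and on `Q` are independent of each other, so every combination follows
from one statement for each type of complex. -/
theorem TwistsWithBasis.resolves {P : AugmentedSequence.{_, u, u} k A}
    {Q : AugmentedSequence.{_, v, v} k B} {hP : CompatibleTwist τ P → Prop}
    {hQ : CompatibleTwist τ.symm Q → Prop} (h : TwistsWithBasis τ P hP)
    (h' : TwistsWithBasis τ.symm Q hQ) : TwistedProductResolves τ P Q hP hQ :=
  ⟨h.exists_twist, h'.exists_twist, fun c c' hc hc' => twistedProduct_isProjectiveResolution c c'
    h.isExact h'.isExact (h.exists_basis c hc) (h'.exists_basis c' hc')⟩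

theorem bar_twistsWithBasis (τ : TwistingMap k A B) : TwistsWithBasis τ (bar k A) IsBarTwist :=
  ⟨bar_isExact k A, ⟨_, barCompatible_isBarTwist τ⟩, fun _ h n => h.exists_basis τ n⟩

theorem reducedBar_twistsWithBasis (τ : TwistingMap k A B) :
    TwistsWithBasis τ (reducedBar k A) IsReducedBarTwist :=
  ⟨reducedBar_isExact k A, ⟨_, reducedBarCompatible_isReducedBarTwist τ⟩,
    fun _ h n => h.exists_basis τ n⟩

theorem koszul_twistsWithBasis {𝒜 : ℕ → Submodule k A} [GradedAlgebra 𝒜] (h : IsKoszul 𝒜)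
    (hτ : Stable τ.toEquiv (𝒜 1)) : TwistsWithBasis τ (koszul 𝒜) IsKoszulTwist :=
  ⟨koszul_isExact h, exists_isKoszulTwist hτ, fun _ hc n => hc.exists_basis hτ n⟩

end Resolutions

end TwistedProduct

end

theorem mainTheorem6 {k : Type*} [Field k] {A : Type*} [Ring A] [Algebra k A] {B : Type*} [Ring B]
    [Algebra k B] (τ : TwistedProduct.TwistingMap k A B) :
    -- two bar resolutions, each of which may be replaced by the reduced bar resolution
    (TwistedProduct.TwistedProductResolves τ
        (TwistedProduct.bar k A) (TwistedProduct.bar k B)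
        TwistedProduct.IsBarTwist TwistedProduct.IsBarTwist ∧
      TwistedProduct.TwistedProductResolves τ
        (TwistedProduct.bar k A) (TwistedProduct.reducedBar k B)
        TwistedProduct.IsBarTwist TwistedProduct.IsReducedBarTwist ∧
      TwistedProduct.TwistedProductResolves τ
        (TwistedProduct.reducedBar k A) (TwistedProduct.bar k B)
        TwistedProduct.IsReducedBarTwist TwistedProduct.IsBarTwist ∧
      TwistedProduct.TwistedProductResolves τ
        (TwistedProduct.reducedBar k A) (TwistedProduct.reducedBar k B)
        TwistedProduct.IsReducedBarTwist TwistedProduct.IsReducedBarTwist) ∧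
    ∀ (𝒜 : ℕ → Submodule k A) (ℬ : ℕ → Submodule k B) [GradedAlgebra 𝒜] [GradedAlgebra ℬ],
      τ.StronglyGraded 𝒜 ℬ →
      -- two Koszul resolutions
      (TwistedProduct.IsKoszul 𝒜 → TwistedProduct.IsKoszul ℬ →
        TwistedProduct.TwistedProductResolves τ
          (TwistedProduct.koszul 𝒜) (TwistedProduct.koszul ℬ)
          TwistedProduct.IsKoszulTwist TwistedProduct.IsKoszulTwist) ∧
      -- the Koszul resolution of `A` and a (reduced) bar resolution of `B`
      (TwistedProduct.IsKoszul 𝒜 →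
        TwistedProduct.TwistedProductResolves τ
          (TwistedProduct.koszul 𝒜) (TwistedProduct.bar k B)
          TwistedProduct.IsKoszulTwist TwistedProduct.IsBarTwist ∧
        TwistedProduct.TwistedProductResolves τ
          (TwistedProduct.koszul 𝒜) (TwistedProduct.reducedBar k B)
          TwistedProduct.IsKoszulTwist TwistedProduct.IsReducedBarTwist) ∧
      -- a (reduced) bar resolution of `A` and the Koszul resolution of `B`
      (TwistedProduct.IsKoszul ℬ →
        TwistedProduct.TwistedProductResolves τ
          (TwistedProduct.bar k A) (TwistedProduct.koszul ℬ)
          TwistedProduct.IsBarTwist TwistedProduct.IsKoszulTwist ∧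
        TwistedProduct.TwistedProductResolves τ
          (TwistedProduct.reducedBar k A) (TwistedProduct.koszul ℬ)
          TwistedProduct.IsReducedBarTwist TwistedProduct.IsKoszulTwist) :=
  ⟨⟨(TwistedProduct.bar_twistsWithBasis τ).resolves (TwistedProduct.bar_twistsWithBasis τ.symm),
    (TwistedProduct.bar_twistsWithBasis τ).resolves
      (TwistedProduct.reducedBar_twistsWithBasis τ.symm),
    (TwistedProduct.reducedBar_twistsWithBasis τ).resolves
      (TwistedProduct.bar_twistsWithBasis τ.symm),
    (TwistedProduct.reducedBar_twistsWithBasis τ).resolves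
      (TwistedProduct.reducedBar_twistsWithBasis τ.symm)⟩,
  fun 𝒜 ℬ _ _ hs =>
    -- Strong grading is needed only to make the degree one pieces stable.
    have hA : TwistedProduct.IsKoszul 𝒜 → _ := fun h =>
      TwistedProduct.koszul_twistsWithBasis h (hs.stable 1)
    have hB : TwistedProduct.IsKoszul ℬ → _ := fun h =>
      TwistedProduct.koszul_twistsWithBasis h (hs.stable_symm 1)
    ⟨fun h h' => (hA h).resolves (hB h'),
    fun h => ⟨(hA h).resolves (TwistedProduct.bar_twistsWithBasis τ.symm),
      (hA h).resolves (TwistedProduct.reducedBar_twistsWithBasis τ.symm)⟩,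
    fun h => ⟨(TwistedProduct.bar_twistsWithBasis τ).resolves (hB h),
      (TwistedProduct.reducedBar_twistsWithBasis τ).resolves (hB h)⟩⟩⟩
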